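/- Let $n_t,n_r\ge 0$ be integers, $\sigma>0$ and $P_1,\dots,P_{n_t}>0$. Consider the MIMO fading channel $\mathbf Y=\mathbf H\mathbf X+\mathbf Z$, where $\mathbf X\in\mathbb C^{n_t}$ has independent components $X_i\sim\mathcal{CN}(0,P_i)$, $\mathbf Z\sim\mathcal{CN}(\mathbf 0,\sigma^2\mathbf I_{n_r})$, $\mathbf H=[\mathbf h_1,\dots,\mathbf h_{n_t}]$ is a random $n_r\times n_t$ complex matrix of arbitrary law, and $\mathbf H,\mathbf X,\mathbf Z$ are independent. The receiver knows $\mathbf V=\mathbf H$. Put $\mathbf K_x=\mathrm{diag}(P_1,\dots,P_{n_t})$ and $\mathbf K_{z_i}=\sum_{k>i}P_k\mathbf h_k\mathbf h_k^*+\sigma^2\mathbf I_{n_r}$. Expectations take values in $[-\infty,\infty]$; logarithms are natural. The successive generalized nearest neighbor decoder (S-GNNDR) decodes the $i$th substream with the metric $|g(S)-f(S)x|^2$, where $S=(\mathbf Y,\mathbf V,\mathbf X^{i-1})$ and $\mathbf X^{i-1}=(X_1,\dots,X_{i-1})$ has been decoded before. Its generalized mutual information (GMI) under the i.i.d. $\mathcal{CN}(0,P_i)$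 codebook ensemble is $$I^{(i)}(g,f)=\sup_{\theta<0}\Big\{\theta\,\mathbf E\big[|g(S)-f(S)X_i|^2\big]-\mathbf E\big[\log \mathbf E\big[e^{\theta|g(S)-f(S)X'|^2}\,\big|\,S\big]\big]\Big\},$$ with $X'\sim\mathcal{CN}(0,P_i)$ independent of $S$. (If the mean metric is infinite, the expression in braces is $-\infty$.) Let $I^{(i)}_{\rm opt}$ be the supremum of $I^{(i)}(g,f)$ over all measurable $g,f$, and $I^{(i)}_{\rm lin}$ the supremum over those of the form $g=\beta(\mathbf v)^*(\mathbf y-\gamma(\mathbf v)\mathbf x^{i-1})$, $f=f(\mathbf v)$, with $\beta,\gamma,f$ measurable. 1. For every $i$, $I^{(i)}_{\rm opt}=I^{(i)}_{\rm lin}=\mathbf E[\log(1+P_i\mathbf h_i^*\mathbf K_{z_i}^{-1}\mathbf h_i)]$. 2. $\sum_i I^{(i)}_{\rm opt}=\sum_i I^{(i)}_{\rm lin}=\mathbf E[\log\det(\mathbf I_{n_r}+\sigma^{-2}\mathbf H\mathbf K_x\mathbf H^*)]$. 3. (Equivalence with V-BLAST.) Let $a_i(\mathbf h)=(P_i\mathbf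 h_i\mathbf h_i^*+\mathbf K_{z_i})^{-1}P_i\mathbf h_i$. For every fixed $\mathbf h$, this filter minimizes the mean squared error of the estimate $b^*(\mathbf Y-\sum_{k<i}\mathbf h_kX_k)$ of $X_i$ over $b\in\mathbb C^{n_r}$. The V-BLAST rate of the $i$th substream, $\mathbf E[\log(1+\mathrm{SINR}_i)]$ with $\mathrm{SINR}_i=P_i|a_i^*\mathbf h_i|^2/(a_i^*\mathbf K_{z_i}a_i)$ ($0$ if $a_i=0$), equals $I^{(i)}_{\rm opt}$. Moreover, with $w_i=P_i/(1+P_i\mathbf h_i^*\mathbf K_{z_i}^{-1}\mathbf h_i)$ and $q_i=((P_i-w_i)w_i)^{-1/2}$ ($q_i=0$ if $\mathbf h_i=0$), the maximum $I^{(i)}_{\rm opt}$ is attained by $g=q_i\,a_i^*(\mathbf y-\sum_{k<i}\mathbf h_kx_k)$ and $f=q_i(P_i-w_i)/P_i$. 4. If $P_i=P/n_t$ for all $i$ and $\mathsf{SNR}=P/\sigma^2$, then $\sum_i I^{(i)}_{\rm opt}=\sum_i I^{(i)}_{\rm lin}=\mathbf E[\log\det(\mathbf I_{n_r}+\frac{\mathsf{SNR}}{n_t}\mathbf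 H\mathbf H^*)]$. If in addition the entries of $\mathbf H$ are i.i.d. $\mathcal{CN}(0,1)$, this equals the capacity of the channel with $\mathbf H$ known to the receiver only, that is, the supremum of $I(\mathbf X;\mathbf H,\mathbf Y)$ over all laws of $\mathbf X$ (independent of $(\mathbf H,\mathbf Z)$) with $\mathbf E[\mathbf X^*\mathbf X]\le P$. -/

import Mathlib

open MeasureTheory ProbabilityTheory Matrix

open scoped ENNReal NNReal

noncomputable section

instance Matrix.instMeasurableSpaceComplex {m n : Type*} : MeasurableSpace (Matrix m n ℂ) :=
  inferInstanceAs (MeasurableSpace (m → n → ℂ))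

/-- Expectation with values in `[-∞, ∞]`: the integral of the positive part minus that of the
negative part. (If both are infinite the value is `⊥`; this never happens below.) -/
def extExp {Ω : Type*} [MeasurableSpace Ω] (μ : Measure Ω) (u : Ω → ℝ) : EReal :=
  ((∫⁻ ω, ENNReal.ofReal (u ω) ∂μ : ℝ≥0∞) : EReal) -
    ((∫⁻ ω, ENNReal.ofReal (-u ω) ∂μ : ℝ≥0∞) : EReal)

/-- The circularly symmetric complex Gaussian law `CN(0, v)`: independent real and imaginary
parts, each `N(0, v / 2)`. -/
def complexGaussian (v : ℝ) : Measure ℂ :=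
  ((gaussianReal 0 (v / 2).toNNReal).prod (gaussianReal 0 (v / 2).toNNReal)).map
    Complex.measurableEquivRealProd.symm

/-! ### Generalized nearest neighbour decoding and its GMI -/

/-- What the `i`th stage of the successive decoder observes: the channel output, the receiver CSI
and the previously decoded inputs `x_k`, `k < i`. -/
def observation {Ω 𝒴 𝒱 : Type*} {nt : ℕ} (Y : Ω → 𝒴) (V : Ω → 𝒱) (X : Ω → Fin nt → ℂ)
    (i : Fin nt) (ω : Ω) : 𝒴 × 𝒱 × (Set.Iio i → ℂ) :=
  (Y ω, V ω, fun k => X ω k)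

/-- The GMI of the `i`th substream for the decoding metric `|g(s) - f(s) x|²`, where
`s = (y, v, x^{i-1})`, under the i.i.d. `CN(0, p)` codebook ensemble:
`sup_{θ < 0} { θ E[|g(S) - f(S) X_i|²] - Λ(θ) }` with
`Λ(θ) = E[ log ∫ exp(θ |g(S) - f(S) x'|²) dCN(0, p)(x') ]`. -/
def gmi {Ω 𝒴 𝒱 : Type*} [MeasurableSpace Ω] {nt : ℕ} (μ : Measure Ω) (p : ℝ)
    (Y : Ω → 𝒴) (V : Ω → 𝒱) (X : Ω → Fin nt → ℂ) (i : Fin nt)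
    (g f : 𝒴 × 𝒱 × (Set.Iio i → ℂ) → ℂ) : EReal :=
  ⨆ θ : Set.Iio (0 : ℝ),
    ((θ : ℝ) : EReal) *
        extExp μ (fun ω =>
          ‖g (observation Y V X i ω) - f (observation Y V X i ω) * X ω i‖ ^ 2) -
      extExp μ (fun ω =>
        Real.log (∫ x', Real.exp ((θ : ℝ) *
          ‖g (observation Y V X i ω) - f (observation Y V X i ω) * x'‖ ^ 2) ∂complexGaussian p))

/-- The GMI of the `i`th substream optimized over all (measurable) processing functions `g` and
scaling functions `f`. -/
def gmiOpt {Ω 𝒴 𝒱 : Type*} [MeasurableSpace Ω] [MeasurableSpace 𝒴] [MeasurableSpace 𝒱] {nt : ℕ}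
    (μ : Measure Ω) (p : ℝ) (Y : Ω → 𝒴) (V : Ω → 𝒱) (X : Ω → Fin nt → ℂ) (i : Fin nt) : EReal :=
  ⨆ (g : 𝒴 × 𝒱 × (Set.Iio i → ℂ) → ℂ) (f : 𝒴 × 𝒱 × (Set.Iio i → ℂ) → ℂ)
    (_ : Measurable g) (_ : Measurable f), gmi μ p Y V X i g f

/-- The linear processing function `g(y, v, x^{i-1}) = β(v)^* (y - γ(v) x^{i-1})`. -/
def linearProcessing {𝒱 : Type*} {nr nt : ℕ} (i : Fin nt) (β : 𝒱 → Fin nr → ℂ)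
    (γ : 𝒱 → Matrix (Fin nr) (Set.Iio i) ℂ) (s : (Fin nr → ℂ) × 𝒱 × (Set.Iio i → ℂ)) : ℂ :=
  star (β s.2.1) ⬝ᵥ (s.1 - γ s.2.1 *ᵥ s.2.2)

/-- The GMI of the `i`th substream optimized over the linear processing functions and the scaling
functions that depend on the CSI only. -/
def gmiLin {Ω 𝒱 : Type*} [MeasurableSpace Ω] [MeasurableSpace 𝒱] {nr nt : ℕ}
    (μ : Measure Ω) (p : ℝ) (Y : Ω → Fin nr → ℂ) (V : Ω → 𝒱) (X : Ω → Fin nt → ℂ)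
    (i : Fin nt) : EReal :=
  ⨆ (β : 𝒱 → Fin nr → ℂ) (γ : 𝒱 → Matrix (Fin nr) (Set.Iio i) ℂ) (φ : 𝒱 → ℂ)
    (_ : Measurable β) (_ : Measurable γ) (_ : Measurable φ),
    gmi μ p Y V X i (linearProcessing i β γ) (fun s => φ s.2.1)

/-! ### The MIMO channel `Y = H X + Z` and the V-BLAST receiver -/

/-- `K_{z_i} = ∑_{k > i} P_k h_k h_k^* + σ² I`. -/
def interferenceCov {nr nt : ℕ} (P : Fin nt → ℝ) (σ : ℝ) (h : Matrix (Fin nr) (Fin nt) ℂ)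
    (i : Fin nt) : Matrix (Fin nr) (Fin nr) ℂ :=
  ∑ k ∈ Finset.Ioi i, (P k : ℂ) • vecMulVec (h.col k) (star (h.col k)) + ((σ ^ 2 : ℝ) : ℂ) • 1

/-- `h_i^* K_{z_i}^{-1} h_i`, a real number since `K_{z_i}` is Hermitian. -/
def quadForm {nr nt : ℕ} (P : Fin nt → ℝ) (σ : ℝ) (h : Matrix (Fin nr) (Fin nt) ℂ)
    (i : Fin nt) : ℝ :=
  (star (h.col i) ⬝ᵥ ((interferenceCov P σ h i)⁻¹ *ᵥ h.col i)).re

/-- Channel output `y` after subtraction of the substreams decoded before the `i`th. -/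
def cancelled {nr nt : ℕ} (h : Matrix (Fin nr) (Fin nt) ℂ) (i : Fin nt) (y : Fin nr → ℂ)
    (x : Set.Iio i → ℂ) : Fin nr → ℂ :=
  y - ∑ k : Set.Iio i, x k • h.col (k : Fin nt)

/-- The linear MMSE filter of the `i`th V-BLAST stage,
`(P_i h_i h_i^* + K_{z_i})^{-1} P_i h_i`. -/
def vblastFilter {nr nt : ℕ} (P : Fin nt → ℝ) (σ : ℝ) (h : Matrix (Fin nr) (Fin nt) ℂ)
    (i : Fin nt) : Fin nr → ℂ :=
  ((P i : ℂ) • vecMulVec (h.col i) (star (h.col i)) + interferenceCov P σ h i)⁻¹ *ᵥ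
    ((P i : ℂ) • h.col i)

/-- Mean squared error, for the channel matrix `h`, of the estimate `b^* ỹ` of `X_i`, where `ỹ` is
the output after cancellation of the substreams `k < i`. -/
def linearMSE {nr nt : ℕ} (P : Fin nt → ℝ) (σ : ℝ) (h : Matrix (Fin nr) (Fin nt) ℂ)
    (i : Fin nt) (b : Fin nr → ℂ) : ℝ :=
  ∫ q : (Fin nt → ℂ) × (Fin nr → ℂ),
    ‖q.1 i - star b ⬝ᵥ cancelled h i (h *ᵥ q.1 + q.2) (fun k => q.1 k)‖ ^ 2
    ∂((Measure.pi fun k => complexGaussian (P k)).prod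
      (Measure.pi fun _ => complexGaussian (σ ^ 2)))

/-- Signal to interference and noise ratio of the `i`th substream at the output of the filter `b`,
after cancellation of the substreams `k < i`: `P_i |b^* h_i|² / (b^* K_{z_i} b)`. -/
def sinr {nr nt : ℕ} (P : Fin nt → ℝ) (σ : ℝ) (h : Matrix (Fin nr) (Fin nt) ℂ)
    (i : Fin nt) (b : Fin nr → ℂ) : ℝ :=
  P i * ‖star b ⬝ᵥ h.col i‖ ^ 2 / (star b ⬝ᵥ (interferenceCov P σ h i *ᵥ b)).re

/-- The ergodic rate of the `i`th substream under V-BLAST (linear MMSE estimation and successive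
interference cancellation). -/
def vblastRate {Ω : Type*} [MeasurableSpace Ω] {nr nt : ℕ} (μ : Measure Ω) (P : Fin nt → ℝ)
    (σ : ℝ) (H : Ω → Matrix (Fin nr) (Fin nt) ℂ) (i : Fin nt) : EReal :=
  extExp μ fun ω => Real.log (1 + sinr P σ (H ω) i (vblastFilter P σ (H ω) i))

/-- `P_i / (1 + P_i h_i^* K_{z_i}^{-1} h_i)`. -/
def errVar {nr nt : ℕ} (P : Fin nt → ℝ) (σ : ℝ) (h : Matrix (Fin nr) (Fin nt) ℂ)
    (i : Fin nt) : ℝ :=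
  P i / (1 + P i * quadForm P σ h i)

/-- The weight `1 / √((P_i - w) w)` with `w = errVar`. (It is `0` where `h_i = 0`.) -/
def gnndrWeight {nr nt : ℕ} (P : Fin nt → ℝ) (σ : ℝ) (h : Matrix (Fin nr) (Fin nt) ℂ)
    (i : Fin nt) : ℝ :=
  1 / Real.sqrt ((P i - errVar P σ h i) * errVar P σ h i)

/-- The V-BLAST estimate of `X_i`, weighted, as a processing function. -/
def vblastProcessing {nr nt : ℕ} (P : Fin nt → ℝ) (σ : ℝ) (i : Fin nt)
    (s : (Fin nr → ℂ) × Matrix (Fin nr) (Fin nt) ℂ × (Set.Iio i → ℂ)) : ℂ :=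
  (gnndrWeight P σ s.2.1 i : ℂ) *
    (star (vblastFilter P σ s.2.1 i) ⬝ᵥ cancelled s.2.1 i s.1 s.2.2)

/-- The scaling function `(P_i - w) / P_i`, weighted. -/
def vblastScaling {nr nt : ℕ} (P : Fin nt → ℝ) (σ : ℝ) (i : Fin nt)
    (s : (Fin nr → ℂ) × Matrix (Fin nr) (Fin nt) ℂ × (Set.Iio i → ℂ)) : ℂ :=
  ((gnndrWeight P σ s.2.1 i * ((P i - errVar P σ s.2.1 i) / P i) : ℝ) : ℂ)

/-! ### Capacity -/

/-- The joint law of `(X, (H, Y))` with `Y = H X + Z`, where `X ∼ ρ`, `H ∼ ν` and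
`Z ∼ CN(0, σ² I)` are independent. -/
def jointLaw {nr nt : ℕ} (ν : Measure (Matrix (Fin nr) (Fin nt) ℂ)) (σ : ℝ)
    (ρ : Measure (Fin nt → ℂ)) :
    Measure ((Fin nt → ℂ) × (Matrix (Fin nr) (Fin nt) ℂ × (Fin nr → ℂ))) :=
  (ρ.prod (ν.prod (Measure.pi fun _ => complexGaussian (σ ^ 2)))).map
    fun q => (q.1, (q.2.1, q.2.1 *ᵥ q.1 + q.2.2))

/-- The mutual information (in nats) of two jointly distributed variables. -/
def mutualInfo {A B : Type*} [MeasurableSpace A] [MeasurableSpace B] (J : Measure (A × B)) :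
    ℝ≥0∞ :=
  InformationTheory.klDiv J (J.fst.prod J.snd)

/-- The ergodic capacity, with `H ∼ ν` known at the receiver only, under the average power
constraint `E[X^* X] ≤ Ptot`: the supremum of `I(X; H, Y)` over all admissible input laws. -/
def channelCapacity {nr nt : ℕ} (ν : Measure (Matrix (Fin nr) (Fin nt) ℂ)) (σ Ptot : ℝ) : ℝ≥0∞ :=
  ⨆ (ρ : Measure (Fin nt → ℂ)) (_ : IsProbabilityMeasure ρ)
    (_ : ∫⁻ x, ENNReal.ofReal (∑ k, ‖x k‖ ^ 2) ∂ρ ≤ ENNReal.ofReal Ptot),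
    mutualInfo (jointLaw ν σ ρ)

end

/-! ### Circularly symmetric complex Gaussian variables -/

/-! Fix a stage `i` and write `p = P i`, `w = errVar`, and `m` for the V-BLAST estimate of the
input. For a fixed channel matrix, the observation and the input are jointly Gaussian. The filter
solves the normal equations, so the error `X_i - m` is uncorrelated with the observation, hence
independent of it with law `CN(0, w)` (`map_observation_error`), and `m` has law `CN(0, p - w)`
(`map_estimate`). The mean metric is therefore the mean of `|g - f m|² + |f|² w`
(`lintegral_metric`), while the moment generating function of the metric has a closed form
(`integral_exp_metric_complexGaussian`).

Upper bound: for `θ = -t`, Cauchy-Schwarz gives `t|g|²/(1 + t|f|²p) ≤ |m|²/p + t|g - f m|²`, and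
`log u ≤ u - 1` at `u = (1 + t|f|²p) w / p` bounds the logarithmic term. Their sum is the pointwise
inequality `negLogMGF_add_le`. In the mean, the surplus `|m|²/p` cancels against `(p - w)/p`, and `E
log (p / w)` remains, where `p / w = 1 + p h_i^* K⁻¹ h_i` (`gmi_le`). The V-BLAST rule makes the
averaged bound an equality at `t = p` (`le_gmi_vblast`). Since it is a linear rule, both suprema
agree. All bounds are between integrals in `[0, ∞]`, so the rate may be infinite; only the mean of
`|m|²/p`, which is at most 1, has to be cancelled.

Sum rate: adding one substream is a rank-one update of the covariance, so the determinants telescope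
(`prod_one_add_mul_quadForm`).

Capacity: mutual information is at most the divergence of the joint law from the product of the
input law with any fixed output law (`mutualInfo_le_klDiv_prod`). With the output law of the
Gaussian input, this divergence is the mean of `log det - |z|²/σ² + y^* K_h⁻¹ y`, where `K_h` is the
output covariance given `h`. Rayleigh fading is invariant under right multiplication by unitary
matrices, so the fading average of `(hx)^* K_h⁻¹ (hx)` is a multiple of `|x|²`
(`exists_meanForm_eq`). The last two terms then have nonpositive total mean for every admissible
input, and mean zero for the Gaussian one. -/

instance complexGaussian.instIsProbabilityMeasure (v : ℝ) :
    IsProbabilityMeasure (complexGaussian v) :=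
  Measure.isProbabilityMeasure_map (by fun_prop)

/-- `complexGaussian` as the law of `a + b I` with independent real Gaussians `a`, `b`. -/
theorem integral_complexGaussian {E : Type*} [NormedAddCommGroup E] [NormedSpace ℝ E]
    (v : ℝ) (F : ℂ → E) :
    ∫ z, F z ∂complexGaussian v =
      ∫ q : ℝ × ℝ, F ⟨q.1, q.2⟩ ∂(gaussianReal 0 (v / 2).toNNReal).prod
        (gaussianReal 0 (v / 2).toNNReal) := by
  rw [complexGaussian, integral_map_equiv]
  rfl

theorem integrable_complexGaussian_iff {E : Type*} [NormedAddCommGroup E] (v : ℝ) (F : ℂ → E) :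
    Integrable F (complexGaussian v) ↔
      Integrable (fun q : ℝ × ℝ => F ⟨q.1, q.2⟩) ((gaussianReal 0 (v / 2).toNNReal).prod
        (gaussianReal 0 (v / 2).toNNReal)) := by
  rw [complexGaussian, integrable_map_equiv]
  rfl

theorem complexGaussian_eq_withDensity {v : ℝ} (hv : 0 < v) :
    complexGaussian v = (volume : Measure ℂ).withDensity
      (fun z => ENNReal.ofReal ((Real.pi * v)⁻¹ * Real.exp (-(‖z‖ ^ 2 / v)))) := by
  have hv' : (v / 2).toNNReal ≠ 0 := by simpa using hv
  have hvc : (((v / 2).toNNReal : ℝ≥0) : ℝ) = v / 2 := Real.coe_toNNReal _ (by positivity)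
  rw [complexGaussian, gaussianReal_of_var_ne_zero _ hv',
    prod_withDensity (measurable_gaussianPDF _ _) (measurable_gaussianPDF _ _)]
  ext s hs
  rw [Measure.map_apply (by fun_prop) hs, withDensity_apply _ hs,
    withDensity_apply _ (Complex.measurableEquivRealProd.symm.measurable hs),
    ← Complex.volume_preserving_equiv_real_prod.symm.setLIntegral_comp_preimage hs (by fun_prop)]
  refine lintegral_congr fun q => ?_
  rw [gaussianPDF, gaussianPDF, ← ENNReal.ofReal_mul (gaussianPDFReal_nonneg _ _ _)]
  congr 1
  simp only [gaussianPDFReal, hvc, sub_zero, Complex.sq_norm, Complex.normSq_apply,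
    Complex.measurableEquivRealProd_symm_apply]
  have h1 : (√(2 * Real.pi * (v / 2)))⁻¹ * (√(2 * Real.pi * (v / 2)))⁻¹ = (Real.pi * v)⁻¹ := by
    rw [← mul_inv, Real.mul_self_sqrt (by positivity)]
    congr 1; ring
  rw [mul_mul_mul_comm, h1, ← Real.exp_add]
  congr 2
  field_simp
  ring

theorem integral_complexGaussian_re_im {v : ℝ} (hv : 0 ≤ v) :
    Integrable (fun z : ℂ => z.re ^ 2 + z.im ^ 2) (complexGaussian v) ∧
    ∫ z, (z.re ^ 2 + z.im ^ 2) ∂complexGaussian v = v ∧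
    (∀ a b : ℝ, Integrable (fun z : ℂ => a * z.re + b * z.im) (complexGaussian v)) ∧
    (∀ a b : ℝ, ∫ z, (a * z.re + b * z.im) ∂complexGaussian v = 0) := by
  set γ := gaussianReal 0 (v / 2).toNNReal with hγ
  have hvc : (((v / 2).toNNReal : ℝ≥0) : ℝ) = v / 2 := Real.coe_toNNReal _ (by positivity)
  have hmem : MemLp (fun x : ℝ => x) 2 γ := memLp_id_gaussianReal 2
  have hi1 : Integrable (fun x : ℝ => x) γ := hmem.integrable (by norm_num)
  have hi2 : Integrable (fun x : ℝ => x ^ 2) γ := hmem.integrable_sq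
  have hm : ∫ x, x ∂γ = 0 := integral_id_gaussianReal
  have hs : ∫ x, x ^ 2 ∂γ = v / 2 := by
    have := variance_fun_id_gaussianReal (μ := 0) (v := (v / 2).toNNReal)
    rw [variance_of_integral_eq_zero (by fun_prop) integral_id_gaussianReal, hvc] at this
    exact this
  have e1 : ∀ f : ℝ → ℝ, ∫ q : ℝ × ℝ, f q.1 ∂(γ.prod γ) = ∫ x, f x ∂γ := fun f => by
    rw [integral_fun_fst]; simp
  have e2 : ∀ f : ℝ → ℝ, ∫ q : ℝ × ℝ, f q.2 ∂(γ.prod γ) = ∫ x, f x ∂γ := fun f => by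
    rw [integral_fun_snd]; simp
  refine ⟨?_, ?_, fun a b => ?_, fun a b => ?_⟩
  · rw [integrable_complexGaussian_iff]
    exact (hi2.comp_fst γ).add (hi2.comp_snd γ)
  · rw [integral_complexGaussian]
    rw [integral_add (f := fun q : ℝ × ℝ => q.1 ^ 2) (g := fun q => q.2 ^ 2)
      (hi2.comp_fst γ) (hi2.comp_snd γ), e1 (fun x => x ^ 2), e2 (fun x => x ^ 2), hs]
    ring
  · rw [integrable_complexGaussian_iff]
    exact ((hi1.comp_fst γ).const_mul a).add ((hi1.comp_snd γ).const_mul b)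
  · rw [integral_complexGaussian]
    rw [integral_add (f := fun q : ℝ × ℝ => a * q.1) (g := fun q => b * q.2)
      ((hi1.comp_fst γ).const_mul a) ((hi1.comp_snd γ).const_mul b), integral_const_mul,
      integral_const_mul, e1 (fun x => x), e2 (fun x => x), hm]
    ring

theorem integral_normSq_sub_mul_complexGaussian {v : ℝ} (hv : 0 ≤ v) (c f : ℂ) :
    Integrable (fun z : ℂ => ‖c - f * z‖ ^ 2) (complexGaussian v) ∧
    ∫ z, ‖c - f * z‖ ^ 2 ∂complexGaussian v = ‖c‖ ^ 2 + ‖f‖ ^ 2 * v := by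
  obtain ⟨h1, h2, h3, h4⟩ := integral_complexGaussian_re_im hv
  set a := -2 * (c.re * f.re + c.im * f.im)
  set b := 2 * (c.re * f.im - c.im * f.re)
  have e : (fun z : ℂ => ‖c - f * z‖ ^ 2) =
      fun z : ℂ => (‖c‖ ^ 2 + (a * z.re + b * z.im)) + ‖f‖ ^ 2 * (z.re ^ 2 + z.im ^ 2) := by
    ext z
    simp only [Complex.sq_norm, Complex.normSq_apply, Complex.sub_re, Complex.sub_im,
      Complex.mul_re, Complex.mul_im, a, b]
    ring
  have i1 : Integrable (fun z : ℂ => ‖c‖ ^ 2 + (a * z.re + b * z.im)) (complexGaussian v) :=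
    (integrable_const _).add (h3 a b)
  rw [e]
  refine ⟨i1.add (h1.const_mul _), ?_⟩
  rw [integral_add i1 (h1.const_mul _), integral_add (integrable_const _) (h3 a b), h4,
    integral_const_mul, h2]
  simp

theorem lintegral_normSq_sub_mul_complexGaussian {v : ℝ} (hv : 0 ≤ v) (c f : ℂ) :
    ∫⁻ z, ENNReal.ofReal (‖c - f * z‖ ^ 2) ∂complexGaussian v =
      ENNReal.ofReal (‖c‖ ^ 2 + ‖f‖ ^ 2 * v) := by
  obtain ⟨h1, h2⟩ := integral_normSq_sub_mul_complexGaussian hv c f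
  rw [← h2, ofReal_integral_eq_lintegral_ofReal h1 (ae_of_all _ fun z => by positivity)]

theorem lintegral_normSq_complexGaussian {v : ℝ} (hv : 0 ≤ v) :
    ∫⁻ z, ENNReal.ofReal (‖z‖ ^ 2) ∂complexGaussian v = ENNReal.ofReal v := by
  simpa using lintegral_normSq_sub_mul_complexGaussian hv 0 1

/-- Up to translation this is the statement that `complexGaussian b⁻¹` has total mass one. -/
theorem integral_exp_neg_normSq {b : ℝ} (hb : 0 < b) (c : ℂ) :
    ∫ z : ℂ, Real.exp (-(b * ‖z - c‖ ^ 2)) = Real.pi / b := by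
  rw [integral_sub_right_eq_self (fun z : ℂ => Real.exp (-(b * ‖z‖ ^ 2))) c]
  have h := measure_univ (μ := complexGaussian b⁻¹)
  rw [complexGaussian_eq_withDensity (by positivity), withDensity_apply _ .univ,
    setLIntegral_univ] at h
  have h' : ∫ z : ℂ, (Real.pi * b⁻¹)⁻¹ * Real.exp (-(‖z‖ ^ 2 / b⁻¹)) = 1 := by
    rw [integral_eq_lintegral_of_nonneg_ae (ae_of_all _ fun z => by positivity)
      (by fun_prop), h, ENNReal.toReal_one]
  rw [integral_const_mul] at h'
  have : ∀ z : ℂ, ‖z‖ ^ 2 / b⁻¹ = b * ‖z‖ ^ 2 := fun z => by field_simp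
  simp_rw [this] at h'
  have hpi := Real.pi_pos
  field_simp at h' ⊢
  linarith

/-- The moment generating function of the nearest neighbour metric. -/
theorem integral_exp_metric_complexGaussian {p θ : ℝ} (hp : 0 < p) (hθ : θ ≤ 0) (g f : ℂ) :
    ∫ x, Real.exp (θ * ‖g - f * x‖ ^ 2) ∂complexGaussian p =
      Real.exp (θ * ‖g‖ ^ 2 / (1 - θ * ‖f‖ ^ 2 * p)) / (1 - θ * ‖f‖ ^ 2 * p) := by
  have hb1 : 0 < 1 - θ * ‖f‖ ^ 2 * p := by
    have : 0 ≤ -θ * ‖f‖ ^ 2 * p := by have : 0 ≤ -θ := by linarith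
                                      positivity
    linarith
  -- Completing the square: the exponent `θ|g - f z|² - |z|²/p` equals `-b|z - c|²` plus a constant,
  -- with `c = -(θ/b) f^* g` and constant `θ|g|²/(p b)`.
  set b := p⁻¹ - θ * ‖f‖ ^ 2 with hbdef
  have hpb : 1 - θ * ‖f‖ ^ 2 * p = p * b := by rw [hbdef]; field_simp
  have hb : 0 < b := by
    rw [hpb] at hb1; exact (pos_iff_pos_of_mul_pos hb1).1 hp
  rw [hpb]
  set c : ℂ := ((-θ / b : ℝ) : ℂ) * (star f * g) with hc
  rw [complexGaussian_eq_withDensity hp, integral_withDensity_eq_integral_toReal_smul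
    (by fun_prop) (ae_of_all _ fun _ => ENNReal.ofReal_lt_top)]
  have key : ∀ z : ℂ, (ENNReal.ofReal ((Real.pi * p)⁻¹ * Real.exp (-(‖z‖ ^ 2 / p)))).toReal •
      Real.exp (θ * ‖g - f * z‖ ^ 2) =
      ((Real.pi * p)⁻¹ * Real.exp (θ * ‖g‖ ^ 2 / (p * b))) *
        Real.exp (-(b * ‖z - c‖ ^ 2)) := by
    intro z
    rw [ENNReal.toReal_ofReal (by positivity), smul_eq_mul, mul_assoc, mul_assoc, ← Real.exp_add,
      ← Real.exp_add]
    congr 2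
    have e1 : b * ‖z - c‖ ^ 2 = b * ‖z‖ ^ 2 + 2 * θ * (star z * (star f * g)).re +
        θ ^ 2 / b * (‖f‖ ^ 2 * ‖g‖ ^ 2) := by
      simp only [hc, Complex.sq_norm, Complex.normSq_apply, Complex.sub_re, Complex.sub_im,
        Complex.mul_re, Complex.mul_im, Complex.ofReal_re, Complex.ofReal_im, Complex.star_def,
        Complex.conj_re, Complex.conj_im]
      field_simp
      ring
    have e2 : ‖g - f * z‖ ^ 2 = ‖g‖ ^ 2 - 2 * (star z * (star f * g)).re + ‖f‖ ^ 2 * ‖z‖ ^ 2 := by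
      simp only [Complex.sq_norm, Complex.normSq_apply, Complex.sub_re, Complex.sub_im,
        Complex.mul_re, Complex.mul_im, Complex.star_def,
        Complex.conj_re, Complex.conj_im]
      ring
    rw [e1, e2]
    have e3 : θ * ‖g‖ ^ 2 / (p * b) = θ * ‖g‖ ^ 2 + θ ^ 2 / b * (‖f‖ ^ 2 * ‖g‖ ^ 2) := by
      have : p * (θ * ‖f‖ ^ 2) = 1 - p * b := by rw [← hpb]; ring
      field_simp
      linear_combination -(‖g‖ ^ 2 * θ) * this
    rw [e3]
    have : b * ‖z‖ ^ 2 = ‖z‖ ^ 2 / p - θ * ‖f‖ ^ 2 * ‖z‖ ^ 2 := by rw [hbdef]; ring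
    rw [this]; ring
  simp_rw [key]
  rw [integral_const_mul, integral_exp_neg_normSq hb]
  have hpi := Real.pi_pos
  field_simp

theorem integral_cexp_re_mul_complexGaussian {v : ℝ} (hv : 0 ≤ v) (c : ℂ) :
    ∫ z, Complex.exp ((c * z).re * Complex.I) ∂complexGaussian v =
      Complex.exp ((-(v * ‖c‖ ^ 2 / 4) : ℝ) : ℂ) := by
  have hvc : (((v / 2).toNNReal : ℝ≥0) : ℝ) = v / 2 := Real.coe_toNNReal _ (by positivity)
  rw [integral_complexGaussian]
  have h1 := charFun_gaussianReal (μ := 0) (v := (v / 2).toNNReal) c.re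
  have h2 := charFun_gaussianReal (μ := 0) (v := (v / 2).toNNReal) (-c.im)
  rw [charFun_apply_real] at h1 h2
  have e : ∀ q : ℝ × ℝ, Complex.exp (((c * ⟨q.1, q.2⟩ : ℂ).re : ℂ) * Complex.I) =
      Complex.exp (c.re * q.1 * Complex.I) * Complex.exp ((-c.im : ℝ) * q.2 * Complex.I) := by
    intro q
    rw [← Complex.exp_add]
    congr 1
    simp only [Complex.mul_re]
    push_cast
    ring
  simp_rw [e]
  rw [integral_prod_mul (fun x : ℝ => Complex.exp (c.re * x * Complex.I))
    (fun x : ℝ => Complex.exp ((-c.im : ℝ) * x * Complex.I)), h1, h2, ← Complex.exp_add]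
  congr 1
  rw [hvc, Complex.sq_norm, Complex.normSq_apply]
  push_cast
  ring

/-! ### Linear images of complex Gaussian vectors -/

/-- The law of a vector of independent `CN(0, d i)` components. -/
noncomputable abbrev gaussVec {ι : Type*} [Fintype ι] (d : ι → ℝ) : Measure (ι → ℂ) :=
  Measure.pi fun i => complexGaussian (d i)

section GaussVec

variable {ι κ τ : Type*} [Fintype ι] [Fintype κ] [Fintype τ]

theorem integral_cexp_dotProduct_gaussVec {d : ι → ℝ} (hd : ∀ i, 0 ≤ d i) (c : ι → ℂ) :
    ∫ x, Complex.exp ((c ⬝ᵥ x).re * Complex.I) ∂gaussVec d =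
      Complex.exp ((-((∑ i, d i * ‖c i‖ ^ 2) / 4) : ℝ) : ℂ) := by
  have e : ∀ x : ι → ℂ, Complex.exp ((c ⬝ᵥ x).re * Complex.I) =
      ∏ i, Complex.exp ((c i * x i).re * Complex.I) := by
    intro x
    rw [← Complex.exp_sum, dotProduct, Complex.re_sum]
    push_cast
    rw [Finset.sum_mul]
  simp_rw [e]
  rw [integral_fintype_prod_eq_prod (fun i z => Complex.exp ((c i * z).re * Complex.I))]
  simp_rw [integral_cexp_re_mul_complexGaussian (hd _), ← Complex.exp_sum]
  congr 1
  push_cast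
  rw [Finset.sum_neg_distrib, Finset.sum_div]

theorem integral_cexp_dotProduct_prod {d : ι → ℝ} {e : κ → ℝ} (hd : ∀ i, 0 ≤ d i)
    (he : ∀ j, 0 ≤ e j) (c : ι → ℂ) (c' : κ → ℂ) :
    ∫ q, Complex.exp ((c ⬝ᵥ q.1 + c' ⬝ᵥ q.2).re * Complex.I) ∂(gaussVec d).prod (gaussVec e) =
      Complex.exp ((-((∑ i, d i * ‖c i‖ ^ 2 + ∑ j, e j * ‖c' j‖ ^ 2) / 4) : ℝ) : ℂ) := by
  have h : ∀ q : (ι → ℂ) × (κ → ℂ), Complex.exp ((c ⬝ᵥ q.1 + c' ⬝ᵥ q.2).re * Complex.I) =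
      Complex.exp ((c ⬝ᵥ q.1).re * Complex.I) * Complex.exp ((c' ⬝ᵥ q.2).re * Complex.I) := by
    intro q
    rw [← Complex.exp_add, Complex.add_re]
    push_cast
    ring_nf
  simp_rw [h]
  rw [integral_prod_mul (fun x => Complex.exp ((c ⬝ᵥ x).re * Complex.I))
    (fun x => Complex.exp ((c' ⬝ᵥ x).re * Complex.I)), integral_cexp_dotProduct_gaussVec hd,
    integral_cexp_dotProduct_gaussVec he, ← Complex.exp_add]
  congr 1
  push_cast
  ring

/-- Characteristic functions are taken over real functionals; this form, bilinear and without
conjugation, lets them be computed coordinate by coordinate. -/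
theorem exists_eq_re_dotProduct (L : StrongDual ℝ (ι → ℂ)) :
    ∃ t : ι → ℂ, ∀ y, L y = (t ⬝ᵥ y).re := by
  classical
  -- The minus sign comes from `Re (t I) = -Im t`.
  refine ⟨fun i => ⟨L (Pi.single i 1), -L (Pi.single i Complex.I)⟩, fun y => ?_⟩
  have hy : y = ∑ i, ((y i).re • (Pi.single i 1 : ι → ℂ) +
      (y i).im • (Pi.single i Complex.I : ι → ℂ)) := by
    funext j
    simp [Finset.sum_apply, Pi.single_apply, Finset.sum_add_distrib]
  conv_lhs => rw [hy]
  simp only [map_sum, map_add, map_smul, dotProduct, Complex.re_sum, Complex.mul_re, smul_eq_mul]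
  exact Finset.sum_congr rfl fun i _ => by ring

theorem ext_of_integral_cexp_dotProduct {m₁ m₂ : Measure (ι → ℂ)} [IsFiniteMeasure m₁]
    [IsFiniteMeasure m₂]
    (h : ∀ t : ι → ℂ, ∫ y, Complex.exp ((t ⬝ᵥ y).re * Complex.I) ∂m₁ =
      ∫ y, Complex.exp ((t ⬝ᵥ y).re * Complex.I) ∂m₂) : m₁ = m₂ := by
  refine Measure.ext_of_charFunDual (funext fun L => ?_)
  obtain ⟨t, ht⟩ := exists_eq_re_dotProduct L
  simp_rw [charFunDual_apply, ht]
  exact h t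

@[fun_prop]
theorem Measurable.dotProduct' {α : Type*} [MeasurableSpace α] {u v : α → ι → ℂ}
    (hu : Measurable u) (hv : Measurable v) : Measurable fun a => u a ⬝ᵥ v a := by
  unfold dotProduct; fun_prop

/-- A linear functional of independent Gaussians is Gaussian. -/
theorem map_dotProduct_prod_gaussVec {d : ι → ℝ} {e : κ → ℝ} (hd : ∀ i, 0 ≤ d i)
    (he : ∀ j, 0 ≤ e j) (c : ι → ℂ) (c' : κ → ℂ) :
    ((gaussVec d).prod (gaussVec e)).map (fun q => c ⬝ᵥ q.1 + c' ⬝ᵥ q.2) =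
      complexGaussian (∑ i, d i * ‖c i‖ ^ 2 + ∑ j, e j * ‖c' j‖ ^ 2) := by
  have hm : Measurable fun q : (ι → ℂ) × (κ → ℂ) => c ⬝ᵥ q.1 + c' ⬝ᵥ q.2 := by fun_prop
  have : IsProbabilityMeasure (((gaussVec d).prod (gaussVec e)).map
      (fun q => c ⬝ᵥ q.1 + c' ⬝ᵥ q.2)) := Measure.isProbabilityMeasure_map hm.aemeasurable
  have hv : 0 ≤ ∑ i, d i * ‖c i‖ ^ 2 + ∑ j, e j * ‖c' j‖ ^ 2 :=
    add_nonneg (Finset.sum_nonneg fun i _ => mul_nonneg (hd i) (by positivity))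
      (Finset.sum_nonneg fun i _ => mul_nonneg (he i) (by positivity))
  refine Measure.ext_of_charFun (funext fun t => ?_)
  have hin : ∀ x : ℂ, inner ℝ x t = (star t * x).re := fun x => by
    rw [Complex.inner]; simp [mul_comm]
  simp_rw [charFun_apply, hin]
  rw [integral_cexp_re_mul_complexGaussian hv, integral_map hm.aemeasurable (by fun_prop)]
  have := integral_cexp_dotProduct_prod hd he (star t • c) (star t • c')
  simp_rw [smul_dotProduct, ← smul_add, smul_eq_mul] at this
  rw [this]
  congr 3
  simp only [Pi.smul_apply, norm_smul, norm_star, mul_pow]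
  rw [add_mul, Finset.sum_mul, Finset.sum_mul]
  congr 2 <;> exact Finset.sum_congr rfl fun _ _ => by ring

/-- The cross term isolates the covariance, so variances add exactly when it vanishes. -/
theorem sum_mul_normSq_add (d : ι → ℝ) (s : ℂ) (a b : ι → ℂ) :
    ∑ i, d i * ‖s * a i + b i‖ ^ 2 = ∑ i, d i * ‖s * a i‖ ^ 2 + ∑ i, d i * ‖b i‖ ^ 2 +
      2 * (s * ∑ i, d i * (a i * star (b i))).re := by
  rw [Finset.mul_sum, Complex.re_sum, Finset.mul_sum, ← Finset.sum_add_distrib,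
    ← Finset.sum_add_distrib]
  refine Finset.sum_congr rfl fun i _ => ?_
  simp only [Complex.sq_norm, Complex.normSq_apply, Complex.add_re, Complex.add_im,
    Complex.mul_re, Complex.mul_im, Complex.star_def, Complex.conj_re, Complex.conj_im,
    Complex.ofReal_re, Complex.ofReal_im]
  ring

/-- A linear functional that is uncorrelated with a linear map is independent of it. -/
theorem map_prodMk_eq_prod_of_uncorrelated {d : ι → ℝ} {e : κ → ℝ} (hd : ∀ i, 0 ≤ d i)
    (he : ∀ j, 0 ≤ e j) (a : ι → ℂ) (a' : κ → ℂ) {ρ : Type*} [Fintype ρ]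
    (T : (ι → ℂ) × (κ → ℂ) → (ρ → ℂ) × (τ → ℂ)) (hT : Measurable T)
    (hcov : ∀ (u : ρ → ℂ) (v : τ → ℂ), ∃ (b : ι → ℂ) (b' : κ → ℂ),
      (∀ q, u ⬝ᵥ (T q).1 + v ⬝ᵥ (T q).2 = b ⬝ᵥ q.1 + b' ⬝ᵥ q.2) ∧
      ∑ i, d i * (a i * star (b i)) + ∑ j, e j * (a' j * star (b' j)) = 0) :
    ((gaussVec d).prod (gaussVec e)).map (fun q => (T q, a ⬝ᵥ q.1 + a' ⬝ᵥ q.2)) =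
      (((gaussVec d).prod (gaussVec e)).map T).prod
        (complexGaussian (∑ i, d i * ‖a i‖ ^ 2 + ∑ j, e j * ‖a' j‖ ^ 2)) := by
  have hm : Measurable fun q : (ι → ℂ) × (κ → ℂ) => a ⬝ᵥ q.1 + a' ⬝ᵥ q.2 := by fun_prop
  rw [← map_dotProduct_prod_gaussVec hd he, ← indepFun_iff_map_prod_eq_prod_map_map
    hT.aemeasurable hm.aemeasurable, indepFun_iff_charFunDual_prod hT.aemeasurable hm.aemeasurable]
  -- A real functional on the joint space splits into a part `(u, v)` on `T` and a scalar `s` on the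
  -- linear functional. Independence amounts to factorization of the characteristic function at
  -- every such `L`.
  intro L
  obtain ⟨u, hu⟩ := exists_eq_re_dotProduct
    (L ∘SL .inl ℝ _ _ ∘SL .inl ℝ (ρ → ℂ) (τ → ℂ))
  obtain ⟨v, hv⟩ := exists_eq_re_dotProduct
    (L ∘SL .inl ℝ _ _ ∘SL .inr ℝ (ρ → ℂ) (τ → ℂ))
  obtain ⟨s', hs⟩ := exists_eq_re_dotProduct (ι := Unit)
    (L ∘SL .inr ℝ ((ρ → ℂ) × (τ → ℂ)) ℂ ∘SL ContinuousLinearMap.proj ())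
  set s := s' () with hsdef
  have hLs : ∀ z, L (0, z) = (s * z).re := fun z => by
    simpa [dotProduct] using hs (fun _ => z)
  have hLT : ∀ t : (ρ → ℂ) × (τ → ℂ), L (t, 0) = (u ⬝ᵥ t.1 + v ⬝ᵥ t.2).re := fun t => by
    have h1 := hu t.1
    have h2 := hv t.2
    simp only [ContinuousLinearMap.comp_apply, ContinuousLinearMap.inl_apply,
      ContinuousLinearMap.inr_apply] at h1 h2
    rw [Complex.add_re, ← h1, ← h2, ← map_add]
    simp
  obtain ⟨b, b', hb, hzero⟩ := hcov u v
  have hL : ∀ q : (ι → ℂ) × (κ → ℂ), L (T q, a ⬝ᵥ q.1 + a' ⬝ᵥ q.2) =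
      ((s • a + b) ⬝ᵥ q.1 + (s • a' + b') ⬝ᵥ q.2).re := by
    intro q
    have : ((T q, a ⬝ᵥ q.1 + a' ⬝ᵥ q.2) : ((ρ → ℂ) × (τ → ℂ)) × ℂ) =
        (T q, 0) + (0, a ⬝ᵥ q.1 + a' ⬝ᵥ q.2) := by simp
    rw [this, map_add, hLs, hLT, hb, ← Complex.add_re]
    simp only [add_dotProduct, smul_dotProduct, smul_eq_mul]
    congr 1; ring
  rw [charFunDual_apply, charFunDual_apply, charFunDual_apply,
    integral_map (by fun_prop) (by fun_prop), integral_map (by fun_prop) (by fun_prop),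
    integral_map (by fun_prop) (by fun_prop)]
  simp only [ContinuousLinearMap.comp_apply, ContinuousLinearMap.inl_apply,
      ContinuousLinearMap.inr_apply, hL, hLs, hLT, hb]
  have hse : ∀ q : (ι → ℂ) × (κ → ℂ), s * (a ⬝ᵥ q.1 + a' ⬝ᵥ q.2) =
      (s • a) ⬝ᵥ q.1 + (s • a') ⬝ᵥ q.2 := fun q => by
    simp only [smul_dotProduct, smul_eq_mul]; ring
  simp_rw [hse]
  rw [integral_cexp_dotProduct_prod hd he, integral_cexp_dotProduct_prod hd he,
    integral_cexp_dotProduct_prod hd he, ← Complex.exp_add]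
  congr 1
  simp only [Pi.add_apply, Pi.smul_apply, smul_eq_mul]
  rw [sum_mul_normSq_add, sum_mul_normSq_add, ← Complex.ofReal_add]
  congr 1
  -- The Gaussian exponents differ from additivity only by this covariance term.
  have hz : (s * ∑ i, d i * (a i * star (b i))).re + (s * ∑ j, e j * (a' j * star (b' j))).re
      = 0 := by
    rw [← Complex.add_re, ← mul_add, hzero]; simp
  linarith

end GaussVec

/-! ### Linear algebra of one decoding stage -/

section Stage

open scoped ComplexOrder

variable {nr nt : ℕ} {P : Fin nt → ℝ} {σ : ℝ}

theorem posDef_interferenceCov (hP : ∀ i, 0 < P i) (hσ : 0 < σ) (h : Matrix (Fin nr) (Fin nt) ℂ)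
    (i : Fin nt) : (interferenceCov P σ h i).PosDef := by
  refine PosDef.posSemidef_add (posSemidef_sum _ fun k _ => ?_) ?_
  · exact (posSemidef_vecMulVec_self_star (h.col k)).smul
      (Complex.zero_le_real.2 (hP k).le)
  · exact PosDef.one.smul (Complex.zero_lt_real.2 (by positivity))

theorem star_dotProduct_interferenceCov_mulVec (P : Fin nt → ℝ) (σ : ℝ)
    (h : Matrix (Fin nr) (Fin nt) ℂ) (i : Fin nt) (a u : Fin nr → ℂ) :
    a ⬝ᵥ (interferenceCov P σ h i *ᵥ u) =
      ∑ k ∈ Finset.Ioi i, (P k : ℂ) * ((a ⬝ᵥ h.col k) * (star (h.col k) ⬝ᵥ u)) +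
        ((σ ^ 2 : ℝ) : ℂ) * (a ⬝ᵥ u) := by
  rw [interferenceCov, add_mulVec, dotProduct_add, smul_mulVec, one_mulVec, dotProduct_smul,
    sum_mulVec, dotProduct_sum, smul_eq_mul]
  congr 1
  refine Finset.sum_congr rfl fun k _ => ?_
  rw [smul_mulVec, dotProduct_smul, vecMulVec_mulVec, smul_eq_mul, dotProduct_smul]
  simp

section PosDefFacts

variable (hP : ∀ i, 0 < P i) (hσ : 0 < σ) (h : Matrix (Fin nr) (Fin nt) ℂ) (i : Fin nt)
include hP hσ

theorem interferenceCov_mulVec_inv_mulVec (u : Fin nr → ℂ) :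
    interferenceCov P σ h i *ᵥ ((interferenceCov P σ h i)⁻¹ *ᵥ u) = u := by
  rw [mulVec_mulVec, mul_nonsing_inv _ ((posDef_interferenceCov hP hσ h i).isUnit.map detMonoidHom),
    one_mulVec]

theorem ofReal_quadForm :
    (quadForm P σ h i : ℂ) = star (h.col i) ⬝ᵥ ((interferenceCov P σ h i)⁻¹ *ᵥ h.col i) := by
  have := (posDef_interferenceCov hP hσ h i).inv.posSemidef.dotProduct_mulVec_nonneg (h.col i)
  rw [Complex.le_def] at this
  apply Complex.ext <;> simp [quadForm, ← this.2]

theorem quadForm_nonneg : 0 ≤ quadForm P σ h i := by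
  have := (posDef_interferenceCov hP hσ h i).inv.posSemidef.dotProduct_mulVec_nonneg (h.col i)
  exact (Complex.le_def.1 this).1

theorem one_add_mul_quadForm_pos : 0 < 1 + P i * quadForm P σ h i := by
  have := mul_nonneg (hP i).le (quadForm_nonneg hP hσ h i)
  linarith

theorem errVar_pos : 0 < errVar P σ h i :=
  div_pos (hP i) (one_add_mul_quadForm_pos hP hσ h i)

/-- Both sides are the gain `a_i^* h_i` of the MMSE filter, computed below. -/
theorem errVar_mul_quadForm : errVar P σ h i * quadForm P σ h i = (P i - errVar P σ h i) / P i := by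
  have := one_add_mul_quadForm_pos hP hσ h i
  have := hP i
  rw [errVar]
  field_simp
  ring

theorem errVar_le : errVar P σ h i ≤ P i := by
  have h1 := errVar_mul_quadForm hP hσ h i
  have h2 := mul_nonneg (errVar_pos hP hσ h i).le (quadForm_nonneg hP hσ h i)
  have h3 := hP i
  rw [h1, le_div_iff₀ h3] at h2
  linarith

/-- Sherman-Morrison, checked by substitution: with `q = quadForm`, the vector `w K⁻¹ h_i` solves
the defining linear system because `w (1 + P_i q) = P_i`. -/
theorem vblastFilter_eq :
    vblastFilter P σ h i =
      (errVar P σ h i : ℂ) • ((interferenceCov P σ h i)⁻¹ *ᵥ h.col i) := by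
  set C := (P i : ℂ) • vecMulVec (h.col i) (star (h.col i)) + interferenceCov P σ h i with hC
  have hCd : C.PosDef := PosDef.posSemidef_add ((posSemidef_vecMulVec_self_star (h.col i)).smul
      (Complex.zero_le_real.2 (hP i).le)) (posDef_interferenceCov hP hσ h i)
  have h1 : C *ᵥ ((errVar P σ h i : ℂ) • ((interferenceCov P σ h i)⁻¹ *ᵥ h.col i)) =
      (P i : ℂ) • h.col i := by
    rw [mulVec_smul, hC, add_mulVec, interferenceCov_mulVec_inv_mulVec hP hσ, smul_mulVec,
      vecMulVec_mulVec, ← ofReal_quadForm hP hσ]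
    ext j
    have := one_add_mul_quadForm_pos hP hσ h i
    have e : (P i : ℂ) = errVar P σ h i * (P i * quadForm P σ h i + 1) := by
      norm_cast
      rw [errVar]; field_simp; ring
    simp only [Pi.smul_apply, Pi.add_apply, smul_eq_mul, MulOpposite.smul_eq_mul_unop,
      MulOpposite.unop_op]
    conv_rhs => rw [e]
    ring
  rw [vblastFilter, ← h1, mulVec_mulVec, nonsing_inv_mul _ (hCd.isUnit.map detMonoidHom),
    one_mulVec]

theorem star_vblastFilter_dotProduct_col :
    star (vblastFilter P σ h i) ⬝ᵥ h.col i = (((P i - errVar P σ h i) / P i : ℝ) : ℂ) := by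
  rw [vblastFilter_eq hP hσ, star_dotProduct, dotProduct_smul, star_smul,
    ← ofReal_quadForm hP hσ, ← errVar_mul_quadForm hP hσ]
  simp

/-- These are the normal equations; they make the error orthogonal to the observation and cancel the
first-order terms in the mean squared error. -/
theorem interferenceCov_mulVec_vblastFilter :
    interferenceCov P σ h i *ᵥ vblastFilter P σ h i = (errVar P σ h i : ℂ) • h.col i := by
  rw [vblastFilter_eq hP hσ, mulVec_smul, interferenceCov_mulVec_inv_mulVec hP hσ]

theorem star_vblastFilter_dotProduct_interferenceCov_mulVec (u : Fin nr → ℂ) :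
    star (vblastFilter P σ h i) ⬝ᵥ (interferenceCov P σ h i *ᵥ u) =
      (errVar P σ h i : ℂ) * (star (h.col i) ⬝ᵥ u) := by
  have hH := (posDef_interferenceCov hP hσ h i).isHermitian
  rw [dotProduct_mulVec, ← hH.eq, ← star_mulVec, interferenceCov_mulVec_vblastFilter hP hσ,
    star_smul, smul_dotProduct]
  simp

theorem sinr_vblastFilter :
    sinr P σ h i (vblastFilter P σ h i) = P i * quadForm P σ h i := by
  rw [sinr, star_vblastFilter_dotProduct_interferenceCov_mulVec hP hσ,
    star_vblastFilter_dotProduct_col hP hσ, vblastFilter_eq hP hσ, dotProduct_smul,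
    ← ofReal_quadForm hP hσ, ← errVar_mul_quadForm hP hσ, smul_eq_mul, Complex.norm_real,
    ← Complex.ofReal_mul, ← Complex.ofReal_mul, Complex.ofReal_re, Real.norm_eq_abs, sq_abs]
  have := errVar_pos hP hσ h i
  -- If the quadratic form vanishes, the SINR reads `0 / 0`, and the convention `0 / 0 = 0` gives
  -- the required value.
  rcases eq_or_ne (quadForm P σ h i) 0 with h0 | h0
  · simp [h0]
  · field_simp

theorem quadForm_eq_zero_iff : quadForm P σ h i = 0 ↔ errVar P σ h i = P i := by
  have h1 := errVar_mul_quadForm hP hσ h i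
  have h2 := errVar_pos hP hσ h i
  have h3 := hP i
  constructor
  · intro h0
    rw [h0, mul_zero, eq_comm, div_eq_zero_iff] at h1
    rcases h1 with h1 | h1 <;> linarith
  · intro h0
    rw [h0] at h1
    simpa [h3.ne'] using h1

end PosDefFacts

/-- Coefficients of the channel input in the estimation error of the filter `b`. -/
noncomputable def errCoeff (h : Matrix (Fin nr) (Fin nt) ℂ) (i : Fin nt) (b : Fin nr → ℂ)
    (k : Fin nt) : ℂ :=
  if k < i then 0 else (if k = i then 1 else 0) - star b ⬝ᵥ h.col k

theorem cancelled_apply_eq (h : Matrix (Fin nr) (Fin nt) ℂ) (i : Fin nt) (x : Fin nt → ℂ)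
    (z : Fin nr → ℂ) :
    cancelled h i (h *ᵥ x + z) (fun k => x k) =
      (∑ k, if k < i then 0 else x k • h.col k) + z := by
  have h1 : h *ᵥ x = ∑ k, x k • h.col k := by
    ext j
    simp [mulVec, dotProduct, Finset.sum_apply, mul_comm]
  have h2 : ∑ k : Set.Iio i, x k • h.col (k : Fin nt) =
      ∑ k, if k < i then x k • h.col k else 0 := by
    rw [← Finset.sum_filter]
    exact (Finset.sum_subtype _ (by simp) (fun k => x k • h.col k)).symm
  rw [cancelled, h1, h2, add_sub_right_comm, ← Finset.sum_sub_distrib]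
  congr 1
  refine Finset.sum_congr rfl fun k _ => ?_
  split_ifs <;> simp

theorem sub_star_dotProduct_cancelled (h : Matrix (Fin nr) (Fin nt) ℂ) (i : Fin nt)
    (b : Fin nr → ℂ) (q : (Fin nt → ℂ) × (Fin nr → ℂ)) :
    q.1 i - star b ⬝ᵥ cancelled h i (h *ᵥ q.1 + q.2) (fun k => q.1 k) =
      errCoeff h i b ⬝ᵥ q.1 + (-star b) ⬝ᵥ q.2 := by
  rw [cancelled_apply_eq, dotProduct_add, dotProduct_sum, neg_dotProduct]
  have : errCoeff h i b ⬝ᵥ q.1 = q.1 i -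
      ∑ k, star b ⬝ᵥ (if k < i then 0 else q.1 k • h.col k) := by
    have h1 : q.1 i = ∑ k, if k = i then q.1 k else 0 := by simp
    rw [h1, ← Finset.sum_sub_distrib, dotProduct]
    refine Finset.sum_congr rfl fun k _ => ?_
    rw [errCoeff]
    split_ifs with h2 h3 h3
    · exact absurd h3 h2.ne
    · simp
    · rw [dotProduct_smul, smul_eq_mul]; ring
    · rw [dotProduct_smul, smul_eq_mul]; ring
  rw [this]; ring

/-- The target is a general monoid so that the same splitting serves the real variance and the
complex covariance. -/
theorem sum_errCoeff_mul {M : Type*} [AddCommMonoid M] (h : Matrix (Fin nr) (Fin nt) ℂ)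
    (i : Fin nt) (b : Fin nr → ℂ) (G : Fin nt → ℂ → M) (hG : ∀ k, G k 0 = 0) :
    ∑ k, G k (errCoeff h i b k) = G i (1 - star b ⬝ᵥ h.col i) +
      ∑ k ∈ Finset.Ioi i, G k (-(star b ⬝ᵥ h.col k)) := by
  have h1 : ∀ k ∈ Finset.Ioi i, G k (-(star b ⬝ᵥ h.col k)) = G k (errCoeff h i b k) := by
    intro k hk
    rw [Finset.mem_Ioi] at hk
    rw [errCoeff, if_neg hk.not_gt, if_neg hk.ne', zero_sub]
  have h2 : G i (1 - star b ⬝ᵥ h.col i) = G i (errCoeff h i b i) := by simp [errCoeff]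
  rw [Finset.sum_congr rfl h1, h2, ← Finset.sum_insert (f := fun k => G k (errCoeff h i b k))
    (by simp), Finset.Ioi_insert]
  refine (Finset.sum_subset (Finset.subset_univ _) fun k _ hk => ?_).symm
  rw [Finset.mem_Ici, not_le] at hk
  rw [errCoeff, if_pos hk, hG]

/-- The variance of the estimation error of the filter `b`. -/
theorem sum_errCoeff_normSq (P : Fin nt → ℝ) (σ : ℝ) (h : Matrix (Fin nr) (Fin nt) ℂ) (i : Fin nt)
    (b : Fin nr → ℂ) :
    ∑ k, P k * ‖errCoeff h i b k‖ ^ 2 + ∑ j, σ ^ 2 * ‖(-star b) j‖ ^ 2 =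
      P i * ‖1 - star b ⬝ᵥ h.col i‖ ^ 2 + (star b ⬝ᵥ (interferenceCov P σ h i *ᵥ b)).re := by
  rw [sum_errCoeff_mul h i b (fun k c => P k * ‖c‖ ^ 2) (by simp), add_assoc]
  congr 1
  rw [star_dotProduct_interferenceCov_mulVec, Complex.add_re, Complex.re_sum, ← Finset.mul_sum]
  congr 1
  · refine Finset.sum_congr rfl fun k _ => ?_
    rw [star_dotProduct (h.col k), Complex.star_def, Complex.mul_conj, ← Complex.ofReal_mul,
      Complex.ofReal_re, norm_neg, Complex.normSq_eq_norm_sq]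
  · rw [Complex.re_ofReal_mul, dotProduct, Complex.re_sum]
    congr 1
    refine Finset.sum_congr rfl fun j _ => ?_
    simp [Complex.sq_norm, Complex.normSq_apply]

theorem star_dotProduct_interferenceCov_mulVec_nonneg (hP : ∀ i, 0 < P i) (hσ : 0 < σ)
    (h : Matrix (Fin nr) (Fin nt) ℂ) (i : Fin nt) (b : Fin nr → ℂ) :
    0 ≤ (star b ⬝ᵥ (interferenceCov P σ h i *ᵥ b)).re :=
  (Complex.le_def.1
    ((posDef_interferenceCov hP hσ h i).posSemidef.dotProduct_mulVec_nonneg b)).1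

theorem linearMSE_eq (hP : ∀ i, 0 < P i) (hσ : 0 < σ) (h : Matrix (Fin nr) (Fin nt) ℂ)
    (i : Fin nt) (b : Fin nr → ℂ) :
    linearMSE P σ h i b =
      P i * ‖1 - star b ⬝ᵥ h.col i‖ ^ 2 + (star b ⬝ᵥ (interferenceCov P σ h i *ᵥ b)).re := by
  have h0 : ∀ j : Fin nr, 0 ≤ σ ^ 2 := fun _ => by positivity
  have hv : 0 ≤ P i * ‖1 - star b ⬝ᵥ h.col i‖ ^ 2 +
      (star b ⬝ᵥ (interferenceCov P σ h i *ᵥ b)).re :=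
    add_nonneg (mul_nonneg (hP i).le (by positivity))
      (star_dotProduct_interferenceCov_mulVec_nonneg hP hσ h i b)
  rw [linearMSE]
  simp_rw [sub_star_dotProduct_cancelled]
  have hm : Measurable fun q : (Fin nt → ℂ) × (Fin nr → ℂ) =>
    errCoeff h i b ⬝ᵥ q.1 + (-star b) ⬝ᵥ q.2 := by fun_prop
  rw [← integral_map (f := fun z : ℂ => ‖z‖ ^ 2) hm.aemeasurable (by fun_prop),
    map_dotProduct_prod_gaussVec (fun k => (hP k).le) h0, sum_errCoeff_normSq]
  simpa using (integral_normSq_sub_mul_complexGaussian hv 0 1).2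

/-- The signal mismatch contributes `w²/P_i` and the interference `w (P_i - w)/P_i`; this justifies
the name `errVar`. -/
theorem linearMSE_vblastFilter (hP : ∀ i, 0 < P i) (hσ : 0 < σ) (h : Matrix (Fin nr) (Fin nt) ℂ)
    (i : Fin nt) : P i * ‖1 - star (vblastFilter P σ h i) ⬝ᵥ h.col i‖ ^ 2 +
      (star (vblastFilter P σ h i) ⬝ᵥ (interferenceCov P σ h i *ᵥ vblastFilter P σ h i)).re =
      errVar P σ h i := by
  rw [star_vblastFilter_dotProduct_interferenceCov_mulVec hP hσ,
    star_vblastFilter_dotProduct_col hP hσ, vblastFilter_eq hP hσ, dotProduct_smul,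
    ← ofReal_quadForm hP hσ, smul_eq_mul, ← Complex.ofReal_mul, ← Complex.ofReal_mul,
    errVar_mul_quadForm hP hσ, ← Complex.ofReal_one, ← Complex.ofReal_sub, Complex.norm_real,
    Complex.ofReal_re, Real.norm_eq_abs, sq_abs]
  have := (hP i).ne'
  field_simp
  ring

/-- The V-BLAST filter has the least mean squared error. -/
theorem linearMSE_vblastFilter_le (hP : ∀ i, 0 < P i) (hσ : 0 < σ)
    (h : Matrix (Fin nr) (Fin nt) ℂ) (i : Fin nt) (b : Fin nr → ℂ) :
    linearMSE P σ h i (vblastFilter P σ h i) ≤ linearMSE P σ h i b := by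
  rw [linearMSE_eq hP hσ, linearMSE_eq hP hσ]
  set a := vblastFilter P σ h i with ha
  set K := interferenceCov P σ h i with hK
  -- Expand around the optimum. The first-order terms are `-2w Re(d^* h_i)` from the mismatch and
  -- `+2w Re(d^* h_i)` from the interference. What remains is a nonnegative quadratic form in `d`.
  set d := b - a with hd
  have hb : b = a + d := by simp [hd]
  have h1 : star a ⬝ᵥ (K *ᵥ d) = (errVar P σ h i : ℂ) * star (star d ⬝ᵥ h.col i) := by
    rw [star_vblastFilter_dotProduct_interferenceCov_mulVec hP hσ, ← star_dotProduct]
  have h2 : star d ⬝ᵥ (K *ᵥ a) = (errVar P σ h i : ℂ) * (star d ⬝ᵥ h.col i) := by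
    rw [interferenceCov_mulVec_vblastFilter hP hσ, dotProduct_smul, smul_eq_mul]
  have h3 : star b ⬝ᵥ h.col i =
      (((P i - errVar P σ h i) / P i : ℝ) : ℂ) + star d ⬝ᵥ h.col i := by
    rw [hb, star_add, add_dotProduct, star_vblastFilter_dotProduct_col hP hσ]
  have h4 : (star b ⬝ᵥ (K *ᵥ b)).re = (star a ⬝ᵥ (K *ᵥ a)).re +
      2 * errVar P σ h i * (star d ⬝ᵥ h.col i).re + (star d ⬝ᵥ (K *ᵥ d)).re := by
    rw [hb, star_add, mulVec_add, add_dotProduct, dotProduct_add, dotProduct_add, h1, h2]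
    simp
    ring
  have h5 := star_dotProduct_interferenceCov_mulVec_nonneg hP hσ h i d
  rw [h3, h4, star_vblastFilter_dotProduct_col hP hσ]
  set t := star d ⬝ᵥ h.col i
  have hPi := hP i
  have h6 : ‖1 - ((((P i - errVar P σ h i) / P i : ℝ) : ℂ) + t)‖ ^ 2 =
      ‖(1 : ℂ) - (((P i - errVar P σ h i) / P i : ℝ) : ℂ)‖ ^ 2 -
        2 * (errVar P σ h i / P i) * t.re + ‖t‖ ^ 2 := by
    simp only [Complex.sq_norm, Complex.normSq_apply, Complex.sub_re, Complex.sub_im,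
      Complex.add_re, Complex.add_im, Complex.one_re, Complex.one_im, Complex.ofReal_re,
      Complex.ofReal_im]
    field_simp
    ring
  rw [h6]
  have h7 : P i * (2 * (errVar P σ h i / P i) * t.re) = 2 * errVar P σ h i * t.re := by field_simp
  have h8 : 0 ≤ P i * ‖t‖ ^ 2 := by positivity
  linarith

/-- The V-BLAST estimate, as a function of what the decoder observes. -/
noncomputable def vblastEstimate (P : Fin nt → ℝ) (σ : ℝ) (i : Fin nt)
    (s : (Fin nr → ℂ) × Matrix (Fin nr) (Fin nt) ℂ × (Set.Iio i → ℂ)) : ℂ :=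
  star (vblastFilter P σ s.2.1 i) ⬝ᵥ cancelled s.2.1 i s.1 s.2.2

/-- Coefficients of the channel input in the estimate. -/
theorem star_dotProduct_cancelled (h : Matrix (Fin nr) (Fin nt) ℂ) (i : Fin nt)
    (b : Fin nr → ℂ) (q : (Fin nt → ℂ) × (Fin nr → ℂ)) :
    star b ⬝ᵥ cancelled h i (h *ᵥ q.1 + q.2) (fun k => q.1 k) =
      (Pi.single i 1 - errCoeff h i b) ⬝ᵥ q.1 + star b ⬝ᵥ q.2 := by
  have := sub_star_dotProduct_cancelled h i b q
  rw [sub_dotProduct, single_one_dotProduct]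
  rw [neg_dotProduct] at this
  linear_combination -this

/-- The coefficients of the estimate are those of `X_i` minus those of the error, so their moduli
differ from the error's only at index `i`. -/
theorem sum_single_sub_errCoeff_normSq (P : Fin nt → ℝ) (σ : ℝ) (h : Matrix (Fin nr) (Fin nt) ℂ)
    (i : Fin nt) (b : Fin nr → ℂ) :
    ∑ k, P k * ‖(Pi.single i 1 - errCoeff h i b : Fin nt → ℂ) k‖ ^ 2 + ∑ j, σ ^ 2 * ‖star b j‖ ^ 2 =
      P i * ‖star b ⬝ᵥ h.col i‖ ^ 2 + (star b ⬝ᵥ (interferenceCov P σ h i *ᵥ b)).re := by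
  have h1 := sum_errCoeff_normSq P σ h i b
  have h2 : ∑ k, P k * ‖(Pi.single i 1 - errCoeff h i b : Fin nt → ℂ) k‖ ^ 2 =
      ∑ k, P k * ‖errCoeff h i b k‖ ^ 2 + P i * ‖star b ⬝ᵥ h.col i‖ ^ 2 -
        P i * ‖1 - star b ⬝ᵥ h.col i‖ ^ 2 := by
    rw [Fintype.sum_eq_add_sum_compl i, Fintype.sum_eq_add_sum_compl i (fun k =>
      P k * ‖errCoeff h i b k‖ ^ 2)]
    have h3 : ∀ k ∈ ({i}ᶜ : Finset (Fin nt)), P k * ‖(Pi.single i 1 - errCoeff h i b : Fin nt → ℂ) k‖ ^ 2 =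
        P k * ‖errCoeff h i b k‖ ^ 2 := by
      intro k hk
      have : k ≠ i := by simpa using hk
      simp [this]
    rw [Finset.sum_congr rfl h3]
    simp [errCoeff]
    ring
  have h3 : ∑ j, σ ^ 2 * ‖(-star b) j‖ ^ 2 = ∑ j, σ ^ 2 * ‖star b j‖ ^ 2 := by simp
  rw [h2, ← h3]
  linarith

end Stage

/-! ### Measurability in the channel matrix -/

instance Matrix.instBorelSpaceComplex {m n : Type*} [Countable m] [Countable n] :
    BorelSpace (Matrix m n ℂ) :=
  inferInstanceAs (BorelSpace (m → n → ℂ))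

instance Matrix.instSecondCountableTopologyComplex {m n : Type*} [Countable m] [Countable n] :
    SecondCountableTopology (Matrix m n ℂ) :=
  inferInstanceAs (SecondCountableTopology (m → n → ℂ))

theorem measurable_matrix_apply {m n : Type*} (i : m) (j : n) :
    Measurable fun A : Matrix m n ℂ => A i j :=
  (measurable_pi_apply j).comp (measurable_pi_apply (X := fun _ : m => n → ℂ) i)

theorem Measurable.matrix_apply {α m n : Type*} [MeasurableSpace α] {A : α → Matrix m n ℂ}
    (hA : Measurable A) (i : m) (j : n) : Measurable fun a => A a i j :=
  (measurable_matrix_apply i j).comp hA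

theorem measurable_matrix_iff {α m n : Type*} [MeasurableSpace α] {A : α → Matrix m n ℂ} :
    Measurable A ↔ ∀ i j, Measurable fun a => A a i j := by
  refine ⟨fun h i j => h.matrix_apply i j, fun h => ?_⟩
  exact measurable_pi_iff.2 fun i => measurable_pi_iff.2 fun j => h i j

@[fun_prop]
theorem Measurable.matrix_mulVec {α m n : Type*} [MeasurableSpace α] [Fintype n]
    {A : α → Matrix m n ℂ} {v : α → n → ℂ} (hA : Measurable A) (hv : Measurable v) :
    Measurable fun a => A a *ᵥ v a := by
  refine measurable_pi_iff.2 fun i => ?_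
  simp only [mulVec, dotProduct]
  exact Finset.measurable_fun_sum _ fun j _ => (hA.matrix_apply i j).mul (by fun_prop)

@[fun_prop]
theorem Measurable.matrix_inv {α n : Type*} [MeasurableSpace α] [Fintype n] [DecidableEq n]
    {A : α → Matrix n n ℂ} (hA : Measurable A) : Measurable fun a => (A a)⁻¹ := by
  refine measurable_matrix_iff.2 fun i j => ?_
  have h1 : Measurable fun a => (A a).det :=
    (Continuous.matrix_det continuous_id).measurable.comp hA
  have h2 : Measurable fun a => (A a).adjugate :=
    (Continuous.matrix_adjugate continuous_id).measurable.comp hA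
  simp only [inv_def, Ring.inverse_eq_inv, Matrix.smul_apply, smul_eq_mul]
  exact h1.inv.mul (h2.matrix_apply i j)

@[fun_prop]
theorem Measurable.matrix_smul_vecMulVec_star {α m : Type*} [MeasurableSpace α]
    {u : α → m → ℂ} (hu : Measurable u) (c : ℂ) :
    Measurable fun a => c • vecMulVec (u a) (star (u a)) := by
  refine measurable_matrix_iff.2 fun j l => ?_
  simp only [Matrix.smul_apply, vecMulVec_apply, smul_eq_mul, Pi.star_apply]
  fun_prop

@[fun_prop]
theorem Measurable.matrix_add {α m n : Type*} [MeasurableSpace α] {A B : α → Matrix m n ℂ}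
    (hA : Measurable A) (hB : Measurable B) : Measurable fun a => A a + B a :=
  measurable_matrix_iff.2 fun i j => (hA.matrix_apply i j).add (hB.matrix_apply i j)

theorem measurable_col {m n : Type*} (k : n) :
    Measurable fun h : Matrix m n ℂ => h.col k :=
  measurable_pi_iff.2 fun j => measurable_matrix_apply j k

section Stage

variable {nr nt : ℕ} (P : Fin nt → ℝ) (σ : ℝ) (i : Fin nt)

theorem measurable_interferenceCov :
    Measurable fun h : Matrix (Fin nr) (Fin nt) ℂ => interferenceCov P σ h i := by
  refine Measurable.matrix_add (measurable_matrix_iff.2 fun j l => ?_) measurable_const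
  simp only [Matrix.sum_apply]
  exact Finset.measurable_fun_sum _ fun k _ =>
    ((measurable_col k).matrix_smul_vecMulVec_star _).matrix_apply j l

theorem measurable_quadForm :
    Measurable fun h : Matrix (Fin nr) (Fin nt) ℂ => quadForm P σ h i := by
  have h1 := measurable_interferenceCov (nr := nr) P σ i
  have h2 := measurable_col (m := Fin nr) i
  unfold quadForm
  fun_prop

theorem measurable_errVar :
    Measurable fun h : Matrix (Fin nr) (Fin nt) ℂ => errVar P σ h i := by
  have h1 := measurable_quadForm (nr := nr) P σ i
  unfold errVar
  fun_prop

theorem measurable_gnndrWeight :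
    Measurable fun h : Matrix (Fin nr) (Fin nt) ℂ => gnndrWeight P σ h i := by
  have h1 := measurable_errVar (nr := nr) P σ i
  unfold gnndrWeight
  fun_prop

theorem measurable_vblastFilter :
    Measurable fun h : Matrix (Fin nr) (Fin nt) ℂ => vblastFilter P σ h i := by
  have h1 := measurable_interferenceCov (nr := nr) P σ i
  have h2 := measurable_col (m := Fin nr) i
  have h3 : Measurable fun h : Matrix (Fin nr) (Fin nt) ℂ =>
      (P i : ℂ) • vecMulVec (h.col i) (star (h.col i)) + interferenceCov P σ h i := by
    fun_prop
  unfold vblastFilter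
  fun_prop

theorem measurable_cancelled :
    Measurable fun s : (Fin nr → ℂ) × Matrix (Fin nr) (Fin nt) ℂ × (Set.Iio i → ℂ) =>
      cancelled s.2.1 i s.1 s.2.2 := by
  refine measurable_pi_iff.2 fun j => ?_
  simp only [cancelled, Pi.sub_apply, Finset.sum_apply, Pi.smul_apply, smul_eq_mul]
  have h1 : ∀ k, Measurable fun s : (Fin nr → ℂ) × Matrix (Fin nr) (Fin nt) ℂ ×
      (Set.Iio i → ℂ) => s.2.1.col k j := fun k =>
    (measurable_matrix_apply j k).comp (by fun_prop)
  exact Measurable.sub (by fun_prop) (Finset.measurable_fun_sum _ fun k _ =>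
    Measurable.mul (by fun_prop) (h1 k))

theorem measurable_vblastEstimate :
    Measurable (vblastEstimate (nr := nr) P σ i) := by
  have h1 := measurable_cancelled (nr := nr) i
  have h2 := measurable_vblastFilter (nr := nr) P σ i
  unfold vblastEstimate
  fun_prop

/-! ### The input and the estimate given the observation -/

variable {P σ i}

/-- For a fixed channel matrix, the error of the V-BLAST estimate is Gaussian and independent of
the observation. -/
theorem map_observation_error (hP : ∀ i, 0 < P i) (hσ : 0 < σ)
    (h : Matrix (Fin nr) (Fin nt) ℂ) (i : Fin nt) :
    ((gaussVec P).prod (gaussVec fun _ : Fin nr => σ ^ 2)).map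
      (fun q => ((h *ᵥ q.1 + q.2, fun k : Set.Iio i => q.1 k),
        errCoeff h i (vblastFilter P σ h i) ⬝ᵥ q.1 + (-star (vblastFilter P σ h i)) ⬝ᵥ q.2)) =
    (((gaussVec P).prod (gaussVec fun _ : Fin nr => σ ^ 2)).map
      (fun q => (h *ᵥ q.1 + q.2, fun k : Set.Iio i => q.1 k))).prod
        (complexGaussian (errVar P σ h i)) := by
  have h0 : ∀ j : Fin nr, 0 ≤ σ ^ 2 := fun _ => by positivity
  rw [map_prodMk_eq_prod_of_uncorrelated (fun k => (hP k).le) h0 _ _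
    (fun q => (h *ᵥ q.1 + q.2, fun k : Set.Iio i => q.1 k)) (by fun_prop) ?_,
    sum_errCoeff_normSq, linearMSE_vblastFilter hP hσ]
  intro u v
  set a := vblastFilter P σ h i with ha
  -- `V` extends `v` by zero, so that a functional of the decoded inputs becomes one of the whole
  -- input.
  obtain ⟨V, hV1, hV2⟩ : ∃ V : Fin nt → ℂ, (∀ k : Set.Iio i, V k = v k) ∧
      ∀ k, ¬ k < i → V k = 0 :=
    ⟨fun k => if hk : k ∈ Set.Iio i then v ⟨k, hk⟩ else 0, fun k => dif_pos k.2,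
      fun k hk => dif_neg hk⟩
  refine ⟨fun k => u ⬝ᵥ h.col k + V k, u, fun q => ?_, ?_⟩
  · have h1 : v ⬝ᵥ (fun k : Set.Iio i => q.1 k) = ∑ k, V k * q.1 k := by
      have h2 := Finset.sum_subtype (p := fun k => k ∈ Set.Iio i) (F := inferInstance)
        (Finset.univ.filter (· < i)) (by simp) (fun k => V k * q.1 k)
      rw [Finset.sum_filter] at h2
      simp only [dotProduct, ← hV1]
      rw [← h2]
      refine Finset.sum_congr rfl fun k _ => ?_
      split_ifs with hk
      · rfl
      · rw [hV2 k hk, zero_mul]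
    have h4 : u ⬝ᵥ (h *ᵥ q.1) = ∑ k, (u ⬝ᵥ h.col k) * q.1 k := by
      rw [dotProduct_mulVec]
      rfl
    have h5 : (fun k => u ⬝ᵥ h.col k + V k) ⬝ᵥ q.1 = ∑ k, (u ⬝ᵥ h.col k + V k) * q.1 k := rfl
    rw [dotProduct_add, h1, h4, h5]
    simp only [add_mul, Finset.sum_add_distrib]
    ring
  -- The error has no component along the decoded inputs and `V` has none elsewhere, so `V` drops
  -- out of the covariance.
  · have hk : ∀ k, (P k : ℂ) * (errCoeff h i a k * star (u ⬝ᵥ h.col k + V k)) =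
        (P k : ℂ) * (errCoeff h i a k * star (u ⬝ᵥ h.col k)) := by
      intro k
      by_cases hki : k < i
      · rw [errCoeff, if_pos hki, zero_mul, zero_mul]
      · rw [hV2 k hki, add_zero]
    rw [Finset.sum_congr rfl fun k _ => hk k, sum_errCoeff_mul h i a
      (fun k c => (P k : ℂ) * (c * star (u ⬝ᵥ h.col k))) (by simp)]
    have h1 := star_dotProduct_interferenceCov_mulVec P σ h i (star a) (star u)
    rw [star_vblastFilter_dotProduct_interferenceCov_mulVec hP hσ] at h1
    have h2 : ∀ k, star (h.col k) ⬝ᵥ star u = star (u ⬝ᵥ h.col k) := fun k => by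
      rw [star_dotProduct_star]
    simp_rw [h2] at h1
    have h3 : ∑ j, ((σ ^ 2 : ℝ) : ℂ) * ((-star a) j * star (u j)) =
        -(((σ ^ 2 : ℝ) : ℂ) * (star a ⬝ᵥ star u)) := by
      rw [dotProduct, Finset.mul_sum, ← Finset.sum_neg_distrib]
      refine Finset.sum_congr rfl fun j _ => ?_
      simp only [Pi.neg_apply, Pi.star_apply]
      ring
    have h4 : ∑ k ∈ Finset.Ioi i, (P k : ℂ) * (-(star a ⬝ᵥ h.col k) * star (u ⬝ᵥ h.col k)) =
        -∑ k ∈ Finset.Ioi i, (P k : ℂ) * ((star a ⬝ᵥ h.col k) * star (u ⬝ᵥ h.col k)) := by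
      rw [← Finset.sum_neg_distrib]
      exact Finset.sum_congr rfl fun k _ => by ring
    rw [h3, h4, star_vblastFilter_dotProduct_col hP hσ]
    have h5 : (P i : ℂ) * (1 - (((P i - errVar P σ h i) / P i : ℝ) : ℂ)) = errVar P σ h i := by
      have := (hP i).ne'
      norm_cast
      field_simp
      ring
    -- The `i`th input contributes `w (u h_i)^*`; by the normal equations, later inputs and noise
    -- together contribute its negative.
    linear_combination (star (u ⬝ᵥ h.col i)) * h5 + h1

/-- For a fixed channel matrix, the law of the V-BLAST estimate. -/
theorem map_estimate (hP : ∀ i, 0 < P i) (hσ : 0 < σ)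
    (h : Matrix (Fin nr) (Fin nt) ℂ) (i : Fin nt) :
    ((gaussVec P).prod (gaussVec fun _ : Fin nr => σ ^ 2)).map
      (fun q => vblastEstimate P σ i (h *ᵥ q.1 + q.2, h, fun k : Set.Iio i => q.1 k)) =
    complexGaussian (P i - errVar P σ h i) := by
  have h0 : ∀ j : Fin nr, 0 ≤ σ ^ 2 := fun _ => by positivity
  simp only [vblastEstimate, star_dotProduct_cancelled]
  rw [map_dotProduct_prod_gaussVec (fun k => (hP k).le) h0]
  have h1 := sum_single_sub_errCoeff_normSq P σ h i (vblastFilter P σ h i)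
  have h2 := linearMSE_vblastFilter hP hσ h i
  rw [star_vblastFilter_dotProduct_col hP hσ] at h1 h2
  congr 1
  refine h1.trans ?_
  have hPi := (hP i).ne'
  rw [← Complex.ofReal_one, ← Complex.ofReal_sub, Complex.norm_real, Real.norm_eq_abs,
    sq_abs] at h2
  rw [Complex.norm_real, Real.norm_eq_abs, sq_abs]
  have h3 : P i * (1 - (P i - errVar P σ h i) / P i) ^ 2 =
      errVar P σ h i ^ 2 / P i := by field_simp; ring
  have h4 : P i * ((P i - errVar P σ h i) / P i) ^ 2 =
      P i - 2 * errVar P σ h i + errVar P σ h i ^ 2 / P i := by field_simp; ring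
  linarith

end Stage

/-! ### Averages over the random channel. -/

section Channel

variable {Ω : Type*} [MeasurableSpace Ω] {μ : Measure Ω}
  {nr nt : ℕ} {P : Fin nt → ℝ} {σ : ℝ} {H : Ω → Matrix (Fin nr) (Fin nt) ℂ}
  {X : Ω → Fin nt → ℂ} {Z Y : Ω → Fin nr → ℂ}

theorem map_channel_inputs [IsProbabilityMeasure μ] (hH : Measurable H) (hX : Measurable X) (hZ : Measurable Z)
    (hXlaw : μ.map X = Measure.pi fun i => complexGaussian (P i))
    (hZlaw : μ.map Z = Measure.pi fun _ => complexGaussian (σ ^ 2))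
    (hXZ : IndepFun X Z μ) (hHXZ : IndepFun H (fun ω => (X ω, Z ω)) μ) :
    μ.map (fun ω => (H ω, (X ω, Z ω))) =
      (μ.map H).prod ((gaussVec P).prod (gaussVec fun _ => σ ^ 2)) := by
  rw [(indepFun_iff_map_prod_eq_prod_map_map hH.aemeasurable (hX.prodMk hZ).aemeasurable).1 hHXZ,
    (indepFun_iff_map_prod_eq_prod_map_map hX.aemeasurable hZ.aemeasurable).1 hXZ, hXlaw, hZlaw]

/-- Expectations over the channel, computed conditionally on the channel matrix. -/
theorem lintegral_channel (hH : Measurable H) (hX : Measurable X) (hZ : Measurable Z)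
    (hlaw : μ.map (fun ω => (H ω, (X ω, Z ω))) =
      (μ.map H).prod ((gaussVec P).prod (gaussVec fun _ => σ ^ 2)))
    (hY : ∀ ω, Y ω = H ω *ᵥ X ω + Z ω) (i : Fin nt)
    {F : ((Fin nr → ℂ) × Matrix (Fin nr) (Fin nt) ℂ × (Set.Iio i → ℂ)) × ℂ → ℝ≥0∞}
    (hF : Measurable F) :
    ∫⁻ ω, F (observation Y H X i ω, X ω i) ∂μ =
      ∫⁻ h, ∫⁻ q, F ((h *ᵥ q.1 + q.2, h, fun k : Set.Iio i => q.1 k), q.1 i)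
        ∂(gaussVec P).prod (gaussVec fun _ : Fin nr => σ ^ 2) ∂(μ.map H) := by
  have hm : Measurable fun ω => (H ω, (X ω, Z ω)) := hH.prodMk (hX.prodMk hZ)
  have hG : Measurable fun r : Matrix (Fin nr) (Fin nt) ℂ × ((Fin nt → ℂ) × (Fin nr → ℂ)) =>
      F ((r.1 *ᵥ r.2.1 + r.2.2, r.1, fun k : Set.Iio i => r.2.1 k), r.2.1 i) := by fun_prop
  rw [← lintegral_prod _ hG.aemeasurable, ← hlaw, lintegral_map hG hm]
  simp only [observation, hY]

theorem lintegral_channel_matrix (hH : Measurable H) {c : Matrix (Fin nr) (Fin nt) ℂ → ℝ≥0∞}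
    (hc : Measurable c) : ∫⁻ ω, c (H ω) ∂μ = ∫⁻ h, c h ∂(μ.map H) :=
  (lintegral_map hc hH).symm

variable (hP : ∀ i, 0 < P i) (hσ : 0 < σ) (hH : Measurable H) (hX : Measurable X)
  (hZ : Measurable Z)
  (hlaw : μ.map (fun ω => (H ω, (X ω, Z ω))) =
      (μ.map H).prod ((gaussVec P).prod (gaussVec fun _ => σ ^ 2)))
  (hY : ∀ ω, Y ω = H ω *ᵥ X ω + Z ω) (i : Fin nt)
include hP hσ hH hX hZ hlaw hY

/-- The mean of the metric, by the decomposition of the input into the V-BLAST estimate and an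
independent error. -/
theorem lintegral_metric
    {A B : (Fin nr → ℂ) × Matrix (Fin nr) (Fin nt) ℂ × (Set.Iio i → ℂ) → ℂ}
    (hA : Measurable A) (hB : Measurable B) :
    ∫⁻ ω, ENNReal.ofReal
        (‖A (observation Y H X i ω) - B (observation Y H X i ω) * X ω i‖ ^ 2) ∂μ =
      ∫⁻ ω, ENNReal.ofReal (‖A (observation Y H X i ω) -
          B (observation Y H X i ω) * vblastEstimate P σ i (observation Y H X i ω)‖ ^ 2 +
        ‖B (observation Y H X i ω)‖ ^ 2 * errVar P σ (H ω) i) ∂μ := by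
  have hm := measurable_vblastEstimate (nr := nr) P σ i
  have hw := measurable_errVar (nr := nr) P σ i
  rw [lintegral_channel hH hX hZ hlaw hY i
    (F := fun s => ENNReal.ofReal (‖A s.1 - B s.1 * s.2‖ ^ 2)) (by fun_prop)]
  have := lintegral_channel hH hX hZ hlaw hY i
    (F := fun s => ENNReal.ofReal (‖A s.1 - B s.1 * vblastEstimate P σ i s.1‖ ^ 2 +
        ‖B s.1‖ ^ 2 * errVar P σ s.1.2.1 i)) (by fun_prop)
  refine Eq.trans ?_ this.symm
  refine lintegral_congr fun h => ?_
  have hAm : Measurable fun t : (Fin nr → ℂ) × (Set.Iio i → ℂ) => A (t.1, h, t.2) :=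
    hA.comp (by fun_prop)
  have hBm : Measurable fun t : (Fin nr → ℂ) × (Set.Iio i → ℂ) => B (t.1, h, t.2) :=
    hB.comp (by fun_prop)
  have hmm : Measurable fun t : (Fin nr → ℂ) × (Set.Iio i → ℂ) =>
    vblastEstimate P σ i (t.1, h, t.2) := hm.comp (by fun_prop)
  have hG : Measurable fun r : ((Fin nr → ℂ) × (Set.Iio i → ℂ)) × ℂ =>
      ENNReal.ofReal (‖A (r.1.1, h, r.1.2) - B (r.1.1, h, r.1.2) *
        vblastEstimate P σ i (r.1.1, h, r.1.2) - B (r.1.1, h, r.1.2) * r.2‖ ^ 2) := by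
    fun_prop
  -- Substitute `X_i = m + error`, which turns the integrand into a function of the observation and
  -- the independent error.
  have h1 : ∀ q : (Fin nt → ℂ) × (Fin nr → ℂ),
      ENNReal.ofReal (‖A (h *ᵥ q.1 + q.2, h, fun k : Set.Iio i => q.1 k) -
        B (h *ᵥ q.1 + q.2, h, fun k : Set.Iio i => q.1 k) * q.1 i‖ ^ 2) =
      (fun r : ((Fin nr → ℂ) × (Set.Iio i → ℂ)) × ℂ =>
      ENNReal.ofReal (‖A (r.1.1, h, r.1.2) - B (r.1.1, h, r.1.2) *
        vblastEstimate P σ i (r.1.1, h, r.1.2) - B (r.1.1, h, r.1.2) * r.2‖ ^ 2))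
      (((h *ᵥ q.1 + q.2, fun k : Set.Iio i => q.1 k),
        errCoeff h i (vblastFilter P σ h i) ⬝ᵥ q.1 + (-star (vblastFilter P σ h i)) ⬝ᵥ q.2)) := by
    intro q
    have h2 := sub_star_dotProduct_cancelled h i (vblastFilter P σ h i) q
    simp only [← h2, vblastEstimate]
    congr 3
    ring
  refine ((lintegral_congr h1).trans (lintegral_map hG (by fun_prop)).symm).trans ?_
  rw [map_observation_error hP hσ,
    lintegral_prod _ hG.aemeasurable, lintegral_map (by fun_prop) (by fun_prop)]
  simp only [lintegral_normSq_sub_mul_complexGaussian (errVar_pos hP hσ h i).le]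

/-- Given the channel matrix, the estimate is `CN(0, P_i - w)` and the weight is constant. The upper
bound uses `c = 1 / P_i`, the attaining rule two other weights. -/
theorem lintegral_mul_normSq_estimate {c : Matrix (Fin nr) (Fin nt) ℂ → ℝ} (hc : Measurable c)
    (hc0 : ∀ h, 0 ≤ c h) :
    ∫⁻ ω, ENNReal.ofReal (c (H ω) * ‖vblastEstimate P σ i (observation Y H X i ω)‖ ^ 2) ∂μ =
      ∫⁻ ω, ENNReal.ofReal (c (H ω) * (P i - errVar P σ (H ω) i)) ∂μ := by
  have hm := measurable_vblastEstimate (nr := nr) P σ i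
  have hw := measurable_errVar (nr := nr) P σ i
  have h1 := lintegral_channel hH hX hZ hlaw hY i
    (F := fun s => ENNReal.ofReal (c s.1.2.1 * ‖vblastEstimate P σ i s.1‖ ^ 2)) (by fun_prop)
  refine h1.trans ?_
  rw [lintegral_channel_matrix hH (c := fun h => ENNReal.ofReal (c h * (P i - errVar P σ h i)))
    (by fun_prop)]
  refine lintegral_congr fun h => ?_
  simp only [ENNReal.ofReal_mul (hc0 h)]
  have hmm : Measurable fun q : (Fin nt → ℂ) × (Fin nr → ℂ) =>
    vblastEstimate P σ i (h *ᵥ q.1 + q.2, h, fun k : Set.Iio i => q.1 k) :=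
      hm.comp (by fun_prop)
  rw [lintegral_const_mul _ (by fun_prop)]
  congr 1
  rw [← lintegral_map (f := fun z : ℂ => ENNReal.ofReal (‖z‖ ^ 2)) (by fun_prop) hmm,
    map_estimate hP hσ,
    lintegral_normSq_complexGaussian (sub_nonneg.2 (errVar_le hP hσ h i))]

end Channel

/-! ### The generalized mutual information -/

section ExtExp

variable {Ω : Type*} [MeasurableSpace Ω] (μ : Measure Ω) {u : Ω → ℝ}

theorem extExp_of_nonneg (hu : ∀ ω, 0 ≤ u ω) :
    extExp μ u = ((∫⁻ ω, ENNReal.ofReal (u ω) ∂μ : ℝ≥0∞) : EReal) := by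
  have : ∀ ω, ENNReal.ofReal (-u ω) = 0 := fun ω => ENNReal.ofReal_of_nonpos (by linarith [hu ω])
  simp [extExp, this]

theorem extExp_of_nonpos (hu : ∀ ω, u ω ≤ 0) :
    extExp μ u = -((∫⁻ ω, ENNReal.ofReal (-u ω) ∂μ : ℝ≥0∞) : EReal) := by
  have : ∀ ω, ENNReal.ofReal (u ω) = 0 := fun ω => ENNReal.ofReal_of_nonpos (hu ω)
  simp [extExp, this]

end ExtExp

section EReal

variable {t : ℝ} {J L R : ℝ≥0∞}

theorem EReal.coe_neg_mul_coe_ennreal (ht : 0 < t) :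
    ((-t : ℝ) : EReal) * (J : EReal) = -((ENNReal.ofReal t * J : ℝ≥0∞) : EReal) := by
  rw [EReal.coe_ennreal_mul, EReal.coe_ennreal_ofReal, max_eq_left ht.le, EReal.coe_neg,
    EReal.neg_mul]

/-- An infinite `J` is allowed: the left side is then `⊥`, even when `L` is infinite too. This
covers rules whose mean metric is infinite. -/
theorem EReal.coe_neg_mul_add_le (ht : 0 < t) (h : L ≤ R + ENNReal.ofReal t * J) :
    ((-t : ℝ) : EReal) * (J : EReal) + (L : EReal) ≤ R := by
  rw [EReal.coe_neg_mul_coe_ennreal ht, add_comm, ← sub_eq_add_neg]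
  refine EReal.sub_le_of_le_add ?_
  rw [← EReal.coe_ennreal_add]
  exact_mod_cast h

theorem EReal.le_coe_neg_mul_add (ht : 0 < t) (hJ : J ≠ ∞) (h : R + ENNReal.ofReal t * J ≤ L) :
    (R : EReal) ≤ ((-t : ℝ) : EReal) * (J : EReal) + (L : EReal) := by
  have hK : ENNReal.ofReal t * J ≠ ∞ := ENNReal.mul_ne_top ENNReal.ofReal_ne_top hJ
  rw [EReal.coe_neg_mul_coe_ennreal ht, add_comm, ← sub_eq_add_neg,
    EReal.le_sub_iff_add_le (.inl (EReal.coe_ennreal_ne_bot _))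
      (.inl (EReal.coe_ennreal_eq_top_iff.not.2 hK)), ← EReal.coe_ennreal_add]
  exact_mod_cast h

end EReal

/-- Minus the logarithm of the moment generating function of the metric at `-t`. -/
noncomputable def negLogMGF (p t : ℝ) (g f : ℂ) : ℝ :=
  t * ‖g‖ ^ 2 / (1 + t * ‖f‖ ^ 2 * p) + Real.log (1 + t * ‖f‖ ^ 2 * p)

theorem negLogMGF_nonneg {p t : ℝ} (hp : 0 < p) (ht : 0 < t) (g f : ℂ) : 0 ≤ negLogMGF p t g f := by
  have : 0 ≤ t * ‖f‖ ^ 2 * p := by positivity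
  have := Real.log_nonneg (show 1 ≤ 1 + t * ‖f‖ ^ 2 * p by linarith)
  unfold negLogMGF
  positivity

theorem log_integral_exp_metric {p t : ℝ} (hp : 0 < p) (ht : 0 < t) (g f : ℂ) :
    Real.log (∫ x, Real.exp (-t * ‖g - f * x‖ ^ 2) ∂complexGaussian p) = -negLogMGF p t g f := by
  have h1 : 0 ≤ t * ‖f‖ ^ 2 * p := by positivity
  rw [integral_exp_metric_complexGaussian hp (by linarith), Real.log_div (by positivity)
    (by nlinarith), Real.log_exp, negLogMGF]
  ring_nf

/-- The metric is nonnegative and its log moment generating function nonpositive, so each extended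
expectation reduces to a single integral in `[0, ∞]`; the parameter is `t = -θ`. -/
theorem gmi_eq {Ω 𝒴 𝒱 : Type*} [MeasurableSpace Ω] {nt : ℕ} (μ : Measure Ω) {p : ℝ} (hp : 0 < p)
    (Y : Ω → 𝒴) (V : Ω → 𝒱) (X : Ω → Fin nt → ℂ) (i : Fin nt)
    (g f : 𝒴 × 𝒱 × (Set.Iio i → ℂ) → ℂ) :
    gmi μ p Y V X i g f = ⨆ t : Set.Ioi (0 : ℝ),
      (((-t : ℝ) : ℝ) : EReal) * ((∫⁻ ω, ENNReal.ofReal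
        (‖g (observation Y V X i ω) - f (observation Y V X i ω) * X ω i‖ ^ 2) ∂μ : ℝ≥0∞) : EReal) +
      ((∫⁻ ω, ENNReal.ofReal (negLogMGF p t (g (observation Y V X i ω))
        (f (observation Y V X i ω))) ∂μ : ℝ≥0∞) : EReal) := by
  rw [gmi]
  refine Equiv.iSup_congr ⟨fun θ => ⟨-θ, neg_pos.2 (Set.mem_Iio.1 θ.2)⟩, fun t => ⟨-t, neg_lt_zero.2 (Set.mem_Ioi.1 t.2)⟩,
    fun θ => by simp, fun t => by simp⟩ fun θ => ?_
  obtain ⟨θ, hθ⟩ := θ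
  obtain ⟨t, rfl⟩ : ∃ t, θ = -t := ⟨-θ, by simp⟩
  have ht : 0 < t := by simpa using hθ
  simp only [Equiv.coe_fn_mk, neg_neg]
  simp_rw [log_integral_exp_metric hp ht]
  rw [extExp_of_nonneg _ fun ω => by positivity,
    extExp_of_nonpos _ fun ω => neg_nonpos.2 (negLogMGF_nonneg hp ht _ _)]
  simp_rw [neg_neg]
  rw [sub_eq_add_neg, neg_neg]

/-- The pointwise form of the upper bound on the GMI. -/
theorem negLogMGF_add_le {p t w : ℝ} (hp : 0 < p) (ht : 0 < t) (hw : 0 < w) (g f m : ℂ) :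
    negLogMGF p t g f + (p - w) / p ≤
      ‖m‖ ^ 2 / p + Real.log (p / w) + t * (‖g - f * m‖ ^ 2 + ‖f‖ ^ 2 * w) := by
  have hs : 0 < 1 + t * ‖f‖ ^ 2 * p := by positivity
  -- Cauchy-Schwarz applied to `g = (g - f m) + f m`; `h4` shows the slack, after clearing
  -- denominators, to be a perfect square.
  have h1 : t * ‖g‖ ^ 2 / (1 + t * ‖f‖ ^ 2 * p) ≤ ‖m‖ ^ 2 / p + t * ‖g - f * m‖ ^ 2 := by
    rw [div_le_iff₀ hs]
    set U := ‖g - f * m‖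
    set F := ‖f‖
    set M := ‖m‖
    have h2 : ‖g‖ ≤ U + F * M := by
      have := norm_add_le (g - f * m) (f * m)
      rwa [sub_add_cancel, norm_mul] at this
    have h3 : ‖g‖ ^ 2 ≤ (U + F * M) ^ 2 := by gcongr
    have h4 : (M ^ 2 / p + t * U ^ 2) * (1 + t * F ^ 2 * p) =
        t * (U + F * M) ^ 2 + (M - t * p * U * F) ^ 2 / p := by
      field_simp
      ring
    rw [h4]
    have := mul_le_mul_of_nonneg_left h3 ht.le
    have : 0 ≤ (M - t * p * U * F) ^ 2 / p := by positivity
    linarith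
  -- The tangent-line bound is tight exactly when `1 + t|f|²p = p / w`, which dictates the size of
  -- the optimal `f`.
  have h5 : Real.log (1 + t * ‖f‖ ^ 2 * p) - Real.log (p / w) ≤
      (1 + t * ‖f‖ ^ 2 * p) / (p / w) - 1 := by
    rw [← Real.log_div hs.ne' (by positivity)]
    exact Real.log_le_sub_one_of_pos (by positivity)
  have h6 : (1 + t * ‖f‖ ^ 2 * p) / (p / w) - 1 = t * (‖f‖ ^ 2 * w) - (p - w) / p := by
    field_simp
    ring
  rw [negLogMGF, mul_add]
  linarith

/-! ### Upper bound and attainment for one substream. -/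

section Channel

variable {Ω : Type*} [MeasurableSpace Ω] {μ : Measure Ω}
  {nr nt : ℕ} {P : Fin nt → ℝ} {σ : ℝ} {H : Ω → Matrix (Fin nr) (Fin nt) ℂ}
  {X : Ω → Fin nt → ℂ} {Z Y : Ω → Fin nr → ℂ}

theorem div_errVar (hP : ∀ i, 0 < P i) (h : Matrix (Fin nr) (Fin nt) ℂ) (i : Fin nt) :
    P i / errVar P σ h i = 1 + P i * quadForm P σ h i := by
  rw [errVar, div_div_cancel₀ (hP i).ne']

theorem measurable_observation (hH : Measurable H) (hX : Measurable X) (hY : Measurable Y)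
    (i : Fin nt) : Measurable (observation Y H X i) := by
  unfold observation
  fun_prop

/-- For a vanishing quadratic form, `w = P_i`, and the product is zero whatever the weight is;
otherwise the weight is a genuine inverse square root. -/
theorem gnndrWeight_sq_mul (hP : ∀ i, 0 < P i) (hσ : 0 < σ) (h : Matrix (Fin nr) (Fin nt) ℂ)
    (i : Fin nt) :
    gnndrWeight P σ h i ^ 2 * ((P i - errVar P σ h i) * errVar P σ h i) =
      if quadForm P σ h i = 0 then 0 else 1 := by
  have h1 := errVar_pos hP hσ h i
  have h2 := errVar_le hP hσ h i
  split_ifs with h0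
  · rw [quadForm_eq_zero_iff hP hσ] at h0
    rw [h0]; ring
  · rw [quadForm_eq_zero_iff hP hσ] at h0
    have h3 : 0 < P i - errVar P σ h i := sub_pos.2 (lt_of_le_of_ne h2 h0)
    rw [gnndrWeight, div_pow, one_pow, Real.sq_sqrt (by positivity)]
    field_simp

theorem gnndrWeight_sq_mul_sq (hP : ∀ i, 0 < P i) (hσ : 0 < σ) (h : Matrix (Fin nr) (Fin nt) ℂ)
    (i : Fin nt) :
    gnndrWeight P σ h i ^ 2 * (P i - errVar P σ h i) ^ 2 =
      (P i - errVar P σ h i) / errVar P σ h i := by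
  have h1 := errVar_pos hP hσ h i
  have h2 := gnndrWeight_sq_mul hP hσ h i
  rw [eq_div_iff h1.ne']
  split_ifs at h2 with h0
  · rw [quadForm_eq_zero_iff hP hσ] at h0
    rw [h0]; ring
  · linear_combination (P i - errVar P σ h i) * h2

variable (hP : ∀ i, 0 < P i) (hσ : 0 < σ) (hH : Measurable H) (hX : Measurable X)
  (hZ : Measurable Z)
  (hlaw : μ.map (fun ω => (H ω, (X ω, Z ω))) =
      (μ.map H).prod ((gaussVec P).prod (gaussVec fun _ => σ ^ 2)))
  (hY : ∀ ω, Y ω = H ω *ᵥ X ω + Z ω) (i : Fin nt)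
include hP hσ hH hX hZ hlaw hY

omit hP hσ hlaw in
theorem measurable_channel_output : Measurable Y := by
  have : Y = fun ω => H ω *ᵥ X ω + Z ω := funext hY
  rw [this]
  fun_prop

/-- This is the integrated form of `negLogMGF_add_le`, with `m` the V-BLAST estimate. -/
theorem gmi_le [IsProbabilityMeasure μ]
    {g f : (Fin nr → ℂ) × Matrix (Fin nr) (Fin nt) ℂ × (Set.Iio i → ℂ) → ℂ}
    (hg : Measurable g) (hf : Measurable f) :
    gmi μ (P i) Y H X i g f ≤ extExp μ (fun ω => Real.log (1 + P i * quadForm P σ (H ω) i)) := by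
  have hYm := measurable_channel_output hH hX hZ hY
  have hobs := measurable_observation hH hX hYm i
  have hw := measurable_errVar (nr := nr) P σ i
  have hm := (measurable_vblastEstimate (nr := nr) P σ i).comp hobs
  have hq := (measurable_quadForm (nr := nr) P σ i).comp hH
  have hPi := hP i
  have hlog : ∀ ω, 0 ≤ Real.log (1 + P i * quadForm P σ (H ω) i) := fun ω =>
    Real.log_nonneg (by have := mul_nonneg hPi.le (quadForm_nonneg hP hσ (H ω) i); linarith)
  rw [gmi_eq _ hPi, extExp_of_nonneg _ hlog]
  refine iSup_le fun t => ?_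
  obtain ⟨t, ht⟩ := t
  have ht : 0 < t := ht
  rw [lintegral_metric hP hσ hH hX hZ hlaw hY i hg hf]
  set J := ∫⁻ ω, ENNReal.ofReal (‖g (observation Y H X i ω) - f (observation Y H X i ω) *
    vblastEstimate P σ i (observation Y H X i ω)‖ ^ 2 +
      ‖f (observation Y H X i ω)‖ ^ 2 * errVar P σ (H ω) i) ∂μ with hJ
  set R := ∫⁻ ω, ENNReal.ofReal (Real.log (1 + P i * quadForm P σ (H ω) i)) ∂μ with hR
  set L := ∫⁻ ω, ENNReal.ofReal (negLogMGF (P i) t (g (observation Y H X i ω))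
    (f (observation Y H X i ω))) ∂μ with hL
  have hC := lintegral_mul_normSq_estimate hP hσ hH hX hZ hlaw hY i
    (c := fun _ => (P i)⁻¹) measurable_const (fun _ => by positivity)
  set C := ∫⁻ ω, ENNReal.ofReal ((P i)⁻¹ * (P i - errVar P σ (H ω) i)) ∂μ with hCdef
  have hC1 : C ≠ ∞ := by
    refine ne_top_of_le_ne_top ENNReal.one_ne_top ?_
    calc C ≤ ∫⁻ _, 1 ∂μ := lintegral_mono fun ω => by
          rw [← ENNReal.ofReal_one]
          refine ENNReal.ofReal_le_ofReal ?_
          rw [inv_mul_le_iff₀ hPi]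
          linarith [errVar_pos hP hσ (H ω) i]
      _ = 1 := by simp
  -- The constant `C` is read on the left as the mean of `(P_i - w)/P_i` and on the right as the
  -- mean of `|m|²/P_i`. Being finite, it cancels.
  have hmain : L + C ≤ R + ENNReal.ofReal t * J + C := by
    rw [hL, hCdef, ← lintegral_add_right _ (by fun_prop), ← hCdef, ← hC, hR, hJ,
      ← lintegral_const_mul _ (by fun_prop), ← lintegral_add_left (by fun_prop),
      ← lintegral_add_right _ (by fun_prop)]
    refine lintegral_mono fun ω => ?_
    have hwp := errVar_pos hP hσ (H ω) i
    have hwl := errVar_le hP hσ (H ω) i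
    have h1 := negLogMGF_add_le hPi ht hwp (g (observation Y H X i ω))
      (f (observation Y H X i ω)) (vblastEstimate P σ i (observation Y H X i ω))
    rw [div_errVar hP] at h1
    simp only []
    rw [← ENNReal.ofReal_add (negLogMGF_nonneg hPi ht _ _)
      (mul_nonneg (by positivity) (sub_nonneg.2 hwl)), ← ENNReal.ofReal_mul ht.le,
      ← ENNReal.ofReal_add (hlog ω) (by positivity),
      ← ENNReal.ofReal_add (add_nonneg (hlog ω) (by positivity)) (by positivity)]
    refine ENNReal.ofReal_le_ofReal ?_
    rw [inv_mul_eq_div, inv_mul_eq_div]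
    linarith
  have hmain' : L ≤ R + ENNReal.ofReal t * J := (ENNReal.add_le_add_iff_right hC1).1 hmain
  exact EReal.coe_neg_mul_add_le ht hmain'

/-- The weight makes the tangent-line bound tight at `t = P_i`. The remaining quadratic terms
balance only after averaging the estimate given the channel. -/
theorem le_gmi_vblast [IsProbabilityMeasure μ] :
    extExp μ (fun ω => Real.log (1 + P i * quadForm P σ (H ω) i)) ≤
      gmi μ (P i) Y H X i (vblastProcessing P σ i) (vblastScaling P σ i) := by
  have hYm := measurable_channel_output hH hX hZ hY
  have hobs := measurable_observation hH hX hYm i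
  have hw := measurable_errVar (nr := nr) P σ i
  have hwt := measurable_gnndrWeight (nr := nr) P σ i
  have hm' := measurable_vblastEstimate (nr := nr) P σ i
  have hm := (measurable_vblastEstimate (nr := nr) P σ i).comp hobs
  have hq := (measurable_quadForm (nr := nr) P σ i).comp hH
  have hPi := hP i
  have hlog : ∀ ω, 0 ≤ Real.log (1 + P i * quadForm P σ (H ω) i) := fun ω =>
    Real.log_nonneg (by have := mul_nonneg hPi.le (quadForm_nonneg hP hσ (H ω) i); linarith)
  have hg : Measurable (vblastProcessing (nr := nr) P σ i) := by
    have : vblastProcessing (nr := nr) P σ i = fun s => (gnndrWeight P σ s.2.1 i : ℂ) *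
      vblastEstimate P σ i s := rfl
    rw [this]
    fun_prop
  have hf : Measurable (vblastScaling (nr := nr) P σ i) := by
    unfold vblastScaling
    fun_prop
  rw [gmi_eq _ hPi, extExp_of_nonneg _ hlog]
  refine le_iSup_of_le ⟨P i, hPi⟩ ?_
  rw [lintegral_metric hP hσ hH hX hZ hlaw hY i hg hf]
  -- `D` is the indicator of a nonzero quadratic form. Both `t` times the mean metric and the excess
  -- of the log-moment term over the rate turn out to be its integral, so they cancel.
  set D : Ω → ℝ≥0∞ := fun ω => ENNReal.ofReal (if quadForm P σ (H ω) i = 0 then 0 else 1) with hD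
  have hDle : ∀ ω, D ω ≤ 1 := fun ω => by
    simp only [hD]; split_ifs <;> simp
  have hmetric : ∀ ω, ENNReal.ofReal (P i) * ENNReal.ofReal
      (‖vblastProcessing P σ i (observation Y H X i ω) - vblastScaling P σ i
        (observation Y H X i ω) * vblastEstimate P σ i (observation Y H X i ω)‖ ^ 2 +
      ‖vblastScaling P σ i (observation Y H X i ω)‖ ^ 2 * errVar P σ (H ω) i) =
      ENNReal.ofReal (gnndrWeight P σ (H ω) i ^ 2 * (errVar P σ (H ω) i ^ 2 / P i) *
        ‖vblastEstimate P σ i (observation Y H X i ω)‖ ^ 2) +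
      ENNReal.ofReal (gnndrWeight P σ (H ω) i ^ 2 *
        ((P i - errVar P σ (H ω) i) ^ 2 * errVar P σ (H ω) i / P i)) := by
    intro ω
    have hwp := errVar_pos hP hσ (H ω) i
    have e1 : vblastProcessing P σ i (observation Y H X i ω) - vblastScaling P σ i
        (observation Y H X i ω) * vblastEstimate P σ i (observation Y H X i ω) =
        ((gnndrWeight P σ (H ω) i * (errVar P σ (H ω) i / P i) : ℝ) : ℂ) *
          vblastEstimate P σ i (observation Y H X i ω) := by
      have h1 : vblastProcessing P σ i (observation Y H X i ω) =
        (gnndrWeight P σ (H ω) i : ℂ) * vblastEstimate P σ i (observation Y H X i ω) := rfl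
      have h2 : vblastScaling P σ i (observation Y H X i ω) = ((gnndrWeight P σ (H ω) i *
        ((P i - errVar P σ (H ω) i) / P i) : ℝ) : ℂ) := rfl
      have h3 : (P i : ℂ) ≠ 0 := by exact_mod_cast hPi.ne'
      rw [h1, h2]
      push_cast
      field_simp
      ring
    have e2 : ‖vblastScaling P σ i (observation Y H X i ω)‖ ^ 2 =
        gnndrWeight P σ (H ω) i ^ 2 * ((P i - errVar P σ (H ω) i) / P i) ^ 2 := by
      have h2 : vblastScaling P σ i (observation Y H X i ω) = ((gnndrWeight P σ (H ω) i *
        ((P i - errVar P σ (H ω) i) / P i) : ℝ) : ℂ) := rfl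
      rw [h2, Complex.norm_real, Real.norm_eq_abs, sq_abs, mul_pow]
    rw [e1, e2, norm_mul, mul_pow, Complex.norm_real, Real.norm_eq_abs, sq_abs,
      ← ENNReal.ofReal_mul hPi.le, ← ENNReal.ofReal_add (by positivity) (by positivity)]
    congr 1
    field_simp
  have hJ : ENNReal.ofReal (P i) * ∫⁻ ω, ENNReal.ofReal
      (‖vblastProcessing P σ i (observation Y H X i ω) - vblastScaling P σ i
        (observation Y H X i ω) * vblastEstimate P σ i (observation Y H X i ω)‖ ^ 2 +
      ‖vblastScaling P σ i (observation Y H X i ω)‖ ^ 2 * errVar P σ (H ω) i) ∂μ =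
      ∫⁻ ω, D ω ∂μ := by
    rw [← lintegral_const_mul _ (by fun_prop)]
    simp_rw [hmetric]
    rw [lintegral_add_right _ (by fun_prop), lintegral_mul_normSq_estimate hP hσ hH hX hZ hlaw hY i
      (c := fun h => gnndrWeight P σ h i ^ 2 * (errVar P σ h i ^ 2 / P i)) (by fun_prop)
      (fun h => by positivity), ← lintegral_add_right _ (by fun_prop)]
    refine lintegral_congr fun ω => ?_
    have hwp := errVar_pos hP hσ (H ω) i
    have hwl := sub_nonneg.2 (errVar_le hP hσ (H ω) i)
    simp only [hD]
    rw [← gnndrWeight_sq_mul hP hσ, ← ENNReal.ofReal_add (by positivity) (by positivity)]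
    congr 1
    field_simp
    ring
  have hL : ∫⁻ ω, ENNReal.ofReal (negLogMGF (P i) (P i)
      (vblastProcessing P σ i (observation Y H X i ω))
      (vblastScaling P σ i (observation Y H X i ω))) ∂μ =
      ∫⁻ ω, ENNReal.ofReal (Real.log (1 + P i * quadForm P σ (H ω) i)) ∂μ + ∫⁻ ω, D ω ∂μ := by
    have h1 : ∀ ω, ENNReal.ofReal (negLogMGF (P i) (P i)
        (vblastProcessing P σ i (observation Y H X i ω))
        (vblastScaling P σ i (observation Y H X i ω))) =
        ENNReal.ofReal (Real.log (1 + P i * quadForm P σ (H ω) i)) +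
        ENNReal.ofReal (gnndrWeight P σ (H ω) i ^ 2 * errVar P σ (H ω) i *
          ‖vblastEstimate P σ i (observation Y H X i ω)‖ ^ 2) := by
      intro ω
      have hwp := errVar_pos hP hσ (H ω) i
      have e1 : ‖vblastProcessing P σ i (observation Y H X i ω)‖ ^ 2 =
          gnndrWeight P σ (H ω) i ^ 2 *
            ‖vblastEstimate P σ i (observation Y H X i ω)‖ ^ 2 := by
        have h1 : vblastProcessing P σ i (observation Y H X i ω) =
          (gnndrWeight P σ (H ω) i : ℂ) * vblastEstimate P σ i (observation Y H X i ω) := rfl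
        rw [h1, norm_mul, mul_pow, Complex.norm_real, Real.norm_eq_abs, sq_abs]
      have e2 : ‖vblastScaling P σ i (observation Y H X i ω)‖ ^ 2 =
          gnndrWeight P σ (H ω) i ^ 2 * (P i - errVar P σ (H ω) i) ^ 2 / P i ^ 2 := by
        have h2 : vblastScaling P σ i (observation Y H X i ω) = ((gnndrWeight P σ (H ω) i *
          ((P i - errVar P σ (H ω) i) / P i) : ℝ) : ℂ) := rfl
        rw [h2, Complex.norm_real, Real.norm_eq_abs, sq_abs, mul_pow, div_pow, mul_div_assoc]
      have e3 : 1 + P i * (gnndrWeight P σ (H ω) i ^ 2 * (P i - errVar P σ (H ω) i) ^ 2 /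
          P i ^ 2) * P i = P i / errVar P σ (H ω) i := by
        rw [gnndrWeight_sq_mul_sq hP hσ]
        field_simp
        ring
      rw [negLogMGF, e1, e2, e3, add_comm, ENNReal.ofReal_add (by rw [div_errVar hP]; exact hlog ω)
        (by positivity), div_errVar hP]
      congr 2
      rw [← div_errVar hP]
      field_simp
    simp_rw [h1]
    rw [lintegral_add_left (by fun_prop), lintegral_mul_normSq_estimate hP hσ hH hX hZ hlaw hY i
      (c := fun h => gnndrWeight P σ h i ^ 2 * errVar P σ h i) (by fun_prop)
      (fun h => by have := (errVar_pos hP hσ h i).le; positivity)]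
    congr 1
    refine lintegral_congr fun ω => ?_
    simp only [hD]
    rw [← gnndrWeight_sq_mul hP hσ]
    congr 1
    ring
  -- The mean metric must be finite to be subtracted; it is, because `P_i` times it is the integral
  -- of `D ≤ 1`.
  refine EReal.le_coe_neg_mul_add hPi (fun h => ?_) ?_
  · have h1 : ∫⁻ ω, D ω ∂μ ≤ 1 := (lintegral_mono hDle).trans (by simp)
    rw [← hJ, h, ENNReal.mul_top (by simpa using hPi)] at h1
    exact absurd h1 (by simp)
  · rw [hJ, hL]

theorem gmiOpt_le [IsProbabilityMeasure μ] : gmiOpt μ (P i) Y H X i ≤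
    extExp μ (fun ω => Real.log (1 + P i * quadForm P σ (H ω) i)) :=
  iSup_le fun _ => iSup_le fun _ => iSup_le fun hg => iSup_le fun hf =>
    gmi_le hP hσ hH hX hZ hlaw hY i hg hf

omit hP hσ hH hX hZ hlaw hY in
theorem measurable_linearProcessing {β : Matrix (Fin nr) (Fin nt) ℂ → Fin nr → ℂ}
    {γ : Matrix (Fin nr) (Fin nt) ℂ → Matrix (Fin nr) (Set.Iio i) ℂ} (hβ : Measurable β)
    (hγ : Measurable γ) : Measurable (linearProcessing i β γ) := by
  unfold linearProcessing
  fun_prop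

omit hP hσ hH hX hZ hlaw hY in
theorem gmiLin_le_gmiOpt : gmiLin μ (P i) Y H X i ≤ gmiOpt μ (P i) Y H X i := by
  refine iSup_le fun β => iSup_le fun γ => iSup_le fun φ => iSup_le fun hβ => iSup_le fun hγ =>
    iSup_le fun hφ => ?_
  exact le_iSup_of_le _ (le_iSup_of_le _ (le_iSup_of_le (measurable_linearProcessing i hβ hγ)
    (le_iSup_of_le (hφ.comp (by fun_prop)) le_rfl)))

omit hP hσ hH hX hZ hlaw hY in
-- Interference cancellation is the linear rule whose `γ` consists of the columns of `h` before `i`,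
-- with the weight absorbed into `β`.
theorem gmi_vblast_le_gmiLin :
    gmi μ (P i) Y H X i (vblastProcessing P σ i) (vblastScaling P σ i) ≤
      gmiLin μ (P i) Y H X i := by
  have hw := measurable_errVar (nr := nr) P σ i
  have hwt := measurable_gnndrWeight (nr := nr) P σ i
  have ha := measurable_vblastFilter (nr := nr) P σ i
  have h1 : vblastProcessing P σ i = linearProcessing (nr := nr) i
      (fun h => (gnndrWeight P σ h i : ℂ) • vblastFilter P σ h i)
      (fun h => Matrix.of fun j k => h j k) := by
    funext s
    rw [vblastProcessing, linearProcessing, star_smul, smul_dotProduct, smul_eq_mul]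
    congr 1
    · simp
    · congr 1
      rw [cancelled]
      congr 1
      ext j
      simp [mulVec, dotProduct, Finset.sum_apply, mul_comm]
  rw [h1]
  refine le_iSup_of_le _ (le_iSup_of_le _ (le_iSup_of_le
    (fun h => ((gnndrWeight P σ h i * ((P i - errVar P σ h i) / P i) : ℝ) : ℂ))
    (le_iSup_of_le (by fun_prop) (le_iSup_of_le ?_ (le_iSup_of_le (by fun_prop) le_rfl)))))
  exact measurable_matrix_iff.2 fun j k => measurable_matrix_apply j (k : Fin nt)

theorem gmi_values [IsProbabilityMeasure μ] :
    gmiOpt μ (P i) Y H X i = extExp μ (fun ω => Real.log (1 + P i * quadForm P σ (H ω) i)) ∧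
    gmiLin μ (P i) Y H X i = extExp μ (fun ω => Real.log (1 + P i * quadForm P σ (H ω) i)) ∧
    gmi μ (P i) Y H X i (vblastProcessing P σ i) (vblastScaling P σ i) =
      extExp μ (fun ω => Real.log (1 + P i * quadForm P σ (H ω) i)) := by
  have h1 := gmiOpt_le hP hσ hH hX hZ hlaw hY i
  have h2 := gmiLin_le_gmiOpt (μ := μ) (P := P) (H := H) (X := X) (Y := Y) i
  have h3 := gmi_vblast_le_gmiLin (μ := μ) (P := P) (σ := σ) (H := H) (X := X) (Y := Y) i
  have h4 := le_gmi_vblast hP hσ hH hX hZ hlaw hY i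
  exact ⟨le_antisymm h1 (h4.trans (h3.trans h2)), le_antisymm (h2.trans h1) (h4.trans h3),
    le_antisymm (h3.trans (h2.trans h1)) h4⟩

end Channel

/-! ### The sum of the stage rates -/

section SumRate

open scoped ComplexOrder

variable {nr nt : ℕ} {P : Fin nt → ℝ} {σ : ℝ}

/-- The covariance of the substreams with index at least `j`, plus noise. -/
noncomputable def tailCov (P : Fin nt → ℝ) (σ : ℝ) (h : Matrix (Fin nr) (Fin nt) ℂ) (j : ℕ) :
    Matrix (Fin nr) (Fin nr) ℂ :=
  ∑ k ∈ Finset.univ.filter (fun k : Fin nt => j ≤ k),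
    (P k : ℂ) • vecMulVec (h.col k) (star (h.col k)) + ((σ ^ 2 : ℝ) : ℂ) • 1

theorem tailCov_succ (h : Matrix (Fin nr) (Fin nt) ℂ) (i : Fin nt) :
    tailCov P σ h (i + 1) = interferenceCov P σ h i := by
  rw [tailCov, interferenceCov]
  congr 1
  refine Finset.sum_congr ?_ fun _ _ => rfl
  ext k
  simp only [Finset.mem_filter, Finset.mem_univ, true_and, Finset.mem_Ioi, Fin.lt_def]
  omega

theorem tailCov_self (h : Matrix (Fin nr) (Fin nt) ℂ) (i : Fin nt) :
    tailCov P σ h i =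
      (P i : ℂ) • vecMulVec (h.col i) (star (h.col i)) + interferenceCov P σ h i := by
  rw [tailCov, interferenceCov, ← add_assoc]
  congr 1
  rw [← Finset.sum_insert (f := fun k => (P k : ℂ) • vecMulVec (h.col k) (star (h.col k)))
    (by simp)]
  refine Finset.sum_congr ?_ fun _ _ => rfl
  ext k
  simp only [Finset.mem_filter, Finset.mem_univ, true_and, Finset.mem_insert, Finset.mem_Ioi,
    Fin.ext_iff, Fin.lt_def]
  omega

/-- The matrix determinant lemma for the rank-one update by substream `i`. -/
theorem det_tailCov (hP : ∀ i, 0 < P i) (hσ : 0 < σ) (h : Matrix (Fin nr) (Fin nt) ℂ)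
    (i : Fin nt) :
    (tailCov P σ h i).det =
      ((1 + P i * quadForm P σ h i : ℝ) : ℂ) * (tailCov P σ h (i + 1)).det := by
  have hK := posDef_interferenceCov hP hσ h i
  rw [tailCov_self, tailCov_succ]
  have h1 := det_add_replicateCol_mul_replicateRow (ι := Unit)
    (hK.isUnit.map detMonoidHom : IsUnit (interferenceCov P σ h i).det)
    ((P i : ℂ) • h.col i) (star (h.col i))
  have h2 : replicateCol Unit ((P i : ℂ) • h.col i) * replicateRow Unit (star (h.col i)) =
      (P i : ℂ) • vecMulVec (h.col i) (star (h.col i)) := by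
    rw [← vecMulVec_eq, smul_vecMulVec]
  rw [h2, add_comm] at h1
  rw [h1, mul_comm]
  congr 1
  rw [det_unique]
  have h3 : (replicateRow Unit (star (h.col i)) * (interferenceCov P σ h i)⁻¹ *
      replicateCol Unit ((P i : ℂ) • h.col i)) default default =
      star (h.col i) ⬝ᵥ ((interferenceCov P σ h i)⁻¹ *ᵥ ((P i : ℂ) • h.col i)) := by
    rw [Matrix.mul_assoc]
    rfl
  rw [Matrix.add_apply, h3, mulVec_smul, dotProduct_smul, ← ofReal_quadForm hP hσ]
  simp

theorem tailCov_zero (h : Matrix (Fin nr) (Fin nt) ℂ) :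
    tailCov P σ h 0 = h * diagonal (fun i => (P i : ℂ)) * hᴴ + ((σ ^ 2 : ℝ) : ℂ) • 1 := by
  rw [tailCov]
  congr 1
  ext j l
  simp only [Nat.zero_le, Finset.filter_true, Matrix.sum_apply, Matrix.smul_apply,
    vecMulVec_apply, col_apply, Pi.star_apply, smul_eq_mul]
  rw [Matrix.mul_apply]
  refine Finset.sum_congr rfl fun k _ => ?_
  rw [mul_diagonal, conjTranspose_apply]
  ring

theorem det_tailCov_card (h : Matrix (Fin nr) (Fin nt) ℂ) :
    (tailCov P σ h nt).det = ((σ ^ 2 : ℝ) : ℂ) ^ nr := by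
  have : Finset.univ.filter (fun k : Fin nt => nt ≤ k) = ∅ := by
    ext k; simp
  rw [tailCov, this, Finset.sum_empty, zero_add, det_smul, det_one, Fintype.card_fin, mul_one]

/-- The product telescopes from all substreams down to pure noise, whose determinant `σ^(2 nr)` is
divided out. -/
theorem prod_one_add_mul_quadForm (hP : ∀ i, 0 < P i) (hσ : 0 < σ)
    (h : Matrix (Fin nr) (Fin nt) ℂ) :
    (1 + ((1 / σ ^ 2 : ℝ) : ℂ) • (h * diagonal (fun i => (P i : ℂ)) * hᴴ)).det =
      ((∏ i, (1 + P i * quadForm P σ h i) : ℝ) : ℂ) := by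
  have hs : ((σ ^ 2 : ℝ) : ℂ) ≠ 0 := by
    have : σ ^ 2 ≠ 0 := by positivity
    exact_mod_cast this
  have h1 : ∀ n, (hn : n ≤ nt) → (tailCov P σ h 0).det =
      (∏ i : Fin n, ((1 + P (i.castLE hn) * quadForm P σ h (i.castLE hn) : ℝ) : ℂ)) *
        (tailCov P σ h n).det := by
    intro n
    induction n with
    | zero => intro; simp
    | succ n ih =>
      intro hn
      rw [ih (by omega), Fin.prod_univ_castSucc, mul_assoc]
      congr 1
      exact det_tailCov hP hσ h ⟨n, hn⟩
  have h2 := h1 nt le_rfl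
  rw [det_tailCov_card, tailCov_zero] at h2
  have h3 : h * diagonal (fun i => (P i : ℂ)) * hᴴ + ((σ ^ 2 : ℝ) : ℂ) • 1 =
      ((σ ^ 2 : ℝ) : ℂ) •
        (1 + ((1 / σ ^ 2 : ℝ) : ℂ) • (h * diagonal (fun i => (P i : ℂ)) * hᴴ)) := by
    rw [smul_add, smul_smul, ← Complex.ofReal_mul, mul_one_div_cancel (by positivity),
      Complex.ofReal_one, one_smul, add_comm]
  rw [h3, det_smul, Fintype.card_fin, mul_comm] at h2
  have h4 := mul_right_cancel₀ (pow_ne_zero _ hs) h2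
  rw [h4, Complex.ofReal_prod]
  rfl

theorem sum_extExp_log_eq {Ω : Type*} [MeasurableSpace Ω] {μ : Measure Ω} (hP : ∀ i, 0 < P i)
    (hσ : 0 < σ) {H : Ω → Matrix (Fin nr) (Fin nt) ℂ} (hH : Measurable H) :
    ∑ i, extExp μ (fun ω => Real.log (1 + P i * quadForm P σ (H ω) i)) =
      extExp μ (fun ω => Real.log
        (1 + ((1 / σ ^ 2 : ℝ) : ℂ) • (H ω * diagonal (fun i => (P i : ℂ)) * (H ω)ᴴ)).det.re) := by
  have hlog : ∀ i ω, 0 ≤ Real.log (1 + P i * quadForm P σ (H ω) i) := fun i ω =>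
    Real.log_nonneg (by have := mul_nonneg (hP i).le (quadForm_nonneg hP hσ (H ω) i); linarith)
  have h1 : ∀ ω, Real.log (1 + ((1 / σ ^ 2 : ℝ) : ℂ) •
      (H ω * diagonal (fun i => (P i : ℂ)) * (H ω)ᴴ)).det.re =
      ∑ i, Real.log (1 + P i * quadForm P σ (H ω) i) := fun ω => by
    rw [prod_one_add_mul_quadForm hP hσ, Complex.ofReal_re, Real.log_prod]
    exact fun i _ => (one_add_mul_quadForm_pos hP hσ (H ω) i).ne'
  simp_rw [h1]
  rw [extExp_of_nonneg _ fun ω => Finset.sum_nonneg fun i _ => hlog i ω]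
  simp_rw [extExp_of_nonneg _ (hlog _), ENNReal.ofReal_sum_of_nonneg fun i _ => hlog i _]
  rw [lintegral_finsetSum]
  · induction (Finset.univ : Finset (Fin nt)) using Finset.induction_on with
    | empty => simp
    | insert a s ha ih => rw [Finset.sum_insert ha, Finset.sum_insert ha, ih,
        EReal.coe_ennreal_add]
  · intro i _
    have := (measurable_quadForm (nr := nr) P σ i).comp hH
    fun_prop

end SumRate

/-! ### Densities of Gaussian vectors -/

section Density

open scoped ComplexOrder MatrixOrder

variable {ι κ : Type*} [Fintype ι] [Fintype κ]

theorem gaussVec_eq_withDensity {v : ℝ} (hv : 0 < v) :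
    gaussVec (fun _ : ι => v) = (volume : Measure (ι → ℂ)).withDensity (fun z =>
      ENNReal.ofReal (((Real.pi * v) ^ Fintype.card ι)⁻¹ *
        Real.exp (-((∑ j, ‖z j‖ ^ 2) / v)))) := by
  symm
  refine (Measure.pi_eq fun s hs => ?_).symm
  set φ : ℂ → ℝ := fun z => (Real.pi * v)⁻¹ * Real.exp (-(‖z‖ ^ 2 / v)) with hφ
  have hφ0 : ∀ z, 0 ≤ φ z := fun z => by positivity
  have hφi : ∀ m : Measure ℂ, m ≤ volume → Integrable φ m := by
    intro m hm
    refine Integrable.mono_measure ?_ hm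
    refine ⟨by fun_prop, ?_⟩
    rw [hasFiniteIntegral_iff_ofReal (ae_of_all _ hφ0)]
    have h := measure_univ (μ := complexGaussian v)
    rw [complexGaussian_eq_withDensity hv, withDensity_apply _ .univ, setLIntegral_univ] at h
    rw [h]
    exact ENNReal.one_lt_top
  have hprod : ∀ z : ι → ℂ, ((Real.pi * v) ^ Fintype.card ι)⁻¹ *
      Real.exp (-((∑ j, ‖z j‖ ^ 2) / v)) = ∏ j, φ (z j) := by
    intro z
    rw [Finset.prod_mul_distrib, Finset.prod_const, Finset.card_univ, inv_pow, ← Real.exp_sum,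
      Finset.sum_neg_distrib, Finset.sum_div]
  rw [withDensity_apply _ (MeasurableSet.univ_pi hs), volume_pi, Measure.restrict_pi_pi]
  simp_rw [hprod]
  have hle : ∀ j, (volume : Measure ℂ).restrict (s j) ≤ volume := fun j => Measure.restrict_le_self
  rw [← ofReal_integral_eq_lintegral_ofReal
    (Integrable.fintype_prod (f := fun _ => φ) fun j => hφi _ (hle j))
    (ae_of_all _ fun z => Finset.prod_nonneg fun j _ => hφ0 _),
    integral_fintype_prod_eq_prod (fun _ => φ),
    ENNReal.ofReal_prod_of_nonneg fun j _ => integral_nonneg hφ0]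
  refine Finset.prod_congr rfl fun j _ => ?_
  rw [ofReal_integral_eq_lintegral_ofReal (hφi _ (hle j)) (ae_of_all _ hφ0),
    complexGaussian_eq_withDensity hv, withDensity_apply _ (hs j)]

theorem sum_normSq_eq_dotProduct (t : ι → ℂ) : ((∑ j, ‖t j‖ ^ 2 : ℝ) : ℂ) = t ⬝ᵥ star t := by
  rw [dotProduct, Complex.ofReal_sum]
  refine Finset.sum_congr rfl fun j _ => ?_
  rw [Pi.star_apply, Complex.star_def, Complex.mul_conj, Complex.normSq_eq_norm_sq]

theorem sum_normSq_vecMul (t : ι → ℂ) (A : Matrix ι κ ℂ) :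
    ((∑ j, ‖(t ᵥ* A) j‖ ^ 2 : ℝ) : ℂ) = t ⬝ᵥ ((A * Aᴴ) *ᵥ star t) := by
  rw [sum_normSq_eq_dotProduct, ← mulVec_mulVec, dotProduct_mulVec, star_vecMul]

theorem sum_normSq_vecMul_diagonal [DecidableEq κ] (t : ι → ℂ) (A : Matrix ι κ ℂ) (d : κ → ℝ) :
    ((∑ j, d j * ‖(t ᵥ* A) j‖ ^ 2 : ℝ) : ℂ) =
      t ⬝ᵥ ((A * diagonal (fun j => (d j : ℂ)) * Aᴴ) *ᵥ star t) := by
  rw [← mulVec_mulVec, ← mulVec_mulVec, dotProduct_mulVec, ← star_vecMul, dotProduct,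
    Complex.ofReal_sum]
  refine Finset.sum_congr rfl fun j _ => ?_
  rw [mulVec_diagonal, Pi.star_apply, Complex.star_def, mul_left_comm, Complex.mul_conj,
    Complex.normSq_eq_norm_sq, Complex.ofReal_mul]

theorem Matrix.PosDef.exists_mul_conjTranspose_eq [DecidableEq ι] {K : Matrix ι ι ℂ}
    (hK : K.PosDef) : ∃ A : Matrix ι ι ℂ, A.det ≠ 0 ∧ A * Aᴴ = K := by
  obtain ⟨B, hB⟩ := CStarAlgebra.nonneg_iff_eq_star_mul_self.mp hK.posSemidef.nonneg
  refine ⟨Bᴴ, fun h => ?_, ?_⟩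
  · have h1 : K.det = 0 := by
      rw [hB, det_mul, star_eq_conjTranspose, h, zero_mul]
    exact hK.det_pos.ne' h1
  · rw [conjTranspose_conjTranspose, hB, star_eq_conjTranspose]

/-- Over the reals, the determinant of a complex-linear map is the squared modulus of its complex
determinant. -/
theorem map_mulVec_volume [DecidableEq ι] {A : Matrix ι ι ℂ} (hA : A.det ≠ 0) :
    (volume : Measure (ι → ℂ)).map (A *ᵥ ·) = ENNReal.ofReal (‖A.det‖ ^ 2)⁻¹ • volume := by
  set f : (ι → ℂ) →ₗ[ℝ] (ι → ℂ) := (toLin' A).restrictScalars ℝ with hf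
  have hdet : LinearMap.det f = ‖A.det‖ ^ 2 := by
    rw [hf, LinearMap.det_restrictScalars, LinearMap.det_toLin', Algebra.norm_complex_apply,
      Complex.normSq_eq_norm_sq]
  have h1 : LinearMap.det f ≠ 0 := by
    rw [hdet]; simpa using hA
  have h2 := Measure.map_linearMap_addHaar_eq_smul_addHaar (volume : Measure (ι → ℂ)) h1
  rw [hdet, abs_of_nonneg (by positivity)] at h2
  exact h2

theorem re_star_dotProduct_inv_mulVec [DecidableEq ι] {A : Matrix ι ι ℂ} (hA : A.det ≠ 0)
    (u : ι → ℂ) :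
    (star (A *ᵥ u) ⬝ᵥ ((A * Aᴴ)⁻¹ *ᵥ (A *ᵥ u))).re = ∑ j, ‖u j‖ ^ 2 := by
  have hu : IsUnit A.det := hA.isUnit
  have hu' : IsUnit (Aᴴ).det := by rw [det_conjTranspose]; exact hu.star
  rw [Matrix.mul_inv_rev, mulVec_mulVec, Matrix.mul_assoc, nonsing_inv_mul _ hu, Matrix.mul_one,
    star_mulVec, ← dotProduct_mulVec, mulVec_mulVec, mul_nonsing_inv _ hu', one_mulVec,
    dotProduct_comm, ← sum_normSq_eq_dotProduct, Complex.ofReal_re]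

theorem lintegral_sum_normSq_gaussVec {d : ι → ℝ} (hd : ∀ i, 0 ≤ d i) :
    ∫⁻ x, ENNReal.ofReal (∑ j, ‖x j‖ ^ 2) ∂gaussVec d = ENNReal.ofReal (∑ j, d j) := by
  simp_rw [ENNReal.ofReal_sum_of_nonneg fun j _ => sq_nonneg _]
  rw [lintegral_finsetSum _ fun j _ => by fun_prop, ENNReal.ofReal_sum_of_nonneg fun j _ => hd j]
  refine Finset.sum_congr rfl fun j _ => ?_
  rw [← lintegral_normSq_complexGaussian (hd j)]
  exact (measurePreserving_eval (fun i => complexGaussian (d i)) j).lintegral_comp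
    (f := fun z : ℂ => ENNReal.ofReal (‖z‖ ^ 2)) (by fun_prop)

/-- The density of a linear image of a standard Gaussian vector. -/
theorem map_mulVec_gaussVec [DecidableEq ι] {A : Matrix ι ι ℂ} (hA : A.det ≠ 0) :
    (gaussVec fun _ : ι => (1 : ℝ)).map (A *ᵥ ·) =
      (volume : Measure (ι → ℂ)).withDensity (fun y =>
        ENNReal.ofReal ((Real.pi ^ Fintype.card ι * ‖A.det‖ ^ 2)⁻¹ *
          Real.exp (-(star y ⬝ᵥ ((A * Aᴴ)⁻¹ *ᵥ y)).re))) := by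
  have hm : Measurable (A *ᵥ · : (ι → ℂ) → (ι → ℂ)) := by fun_prop
  refine Measure.ext_of_lintegral _ fun F hF => ?_
  have hφ : Measurable fun y : ι → ℂ => ENNReal.ofReal ((Real.pi ^ Fintype.card ι *
      ‖A.det‖ ^ 2)⁻¹ * Real.exp (-(star y ⬝ᵥ ((A * Aᴴ)⁻¹ *ᵥ y)).re)) := by fun_prop
  have hd : (0 : ℝ) < ‖A.det‖ ^ 2 := by positivity
  rw [lintegral_map hF hm, gaussVec_eq_withDensity one_pos,
    lintegral_withDensity_eq_lintegral_mul _ (by fun_prop)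
      (show Measurable fun u => F (A *ᵥ u) from hF.comp hm),
    lintegral_withDensity_eq_lintegral_mul _ hφ hF]
  have h1 : (volume : Measure (ι → ℂ)) =
      ENNReal.ofReal (‖A.det‖ ^ 2) • (volume : Measure (ι → ℂ)).map (A *ᵥ ·) := by
    rw [map_mulVec_volume hA, smul_smul, ← ENNReal.ofReal_mul (by positivity),
      mul_inv_cancel₀ hd.ne', ENNReal.ofReal_one, one_smul]
  conv_rhs => rw [h1]
  rw [lintegral_smul_measure, lintegral_map (hφ.mul hF) hm, smul_eq_mul]
  refine Eq.trans ?_ (lintegral_const_mul _ ((hφ.mul hF).comp hm))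
  refine lintegral_congr fun u => ?_
  simp only [Pi.mul_apply]
  rw [re_star_dotProduct_inv_mulVec hA, ← mul_assoc, ← ENNReal.ofReal_mul (by positivity)]
  congr 2
  field_simp

/-- The characteristic function depends on the frequency only through its Euclidean norm. -/
theorem gaussVec_map_vecMul_unitary [DecidableEq ι] {v : ℝ} (hv : 0 ≤ v) {U : Matrix ι ι ℂ}
    (hU : U * Uᴴ = 1) :
    (gaussVec fun _ : ι => v).map (· ᵥ* U) = gaussVec fun _ => v := by
  have hm : Measurable (· ᵥ* U : (ι → ℂ) → (ι → ℂ)) := by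
    refine measurable_pi_iff.2 fun j => ?_
    unfold vecMul
    fun_prop
  have : IsProbabilityMeasure ((gaussVec fun _ : ι => v).map (· ᵥ* U)) :=
    Measure.isProbabilityMeasure_map hm.aemeasurable
  refine ext_of_integral_cexp_dotProduct fun t => ?_
  rw [integral_map hm.aemeasurable (by fun_prop)]
  have h1 : ∀ x : ι → ℂ, t ⬝ᵥ (x ᵥ* U) = (U *ᵥ t) ⬝ᵥ x := fun x => by
    rw [dotProduct_comm, ← dotProduct_mulVec, dotProduct_comm]
  simp_rw [h1]
  rw [integral_cexp_dotProduct_gaussVec fun _ => hv, integral_cexp_dotProduct_gaussVec fun _ => hv]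
  have h2 : ∑ i, ‖(U *ᵥ t) i‖ ^ 2 = ∑ i, ‖t i‖ ^ 2 := by
    have h3 : ((∑ i, ‖(U *ᵥ t) i‖ ^ 2 : ℝ) : ℂ) = ((∑ i, ‖t i‖ ^ 2 : ℝ) : ℂ) := by
      rw [sum_normSq_eq_dotProduct, sum_normSq_eq_dotProduct, star_mulVec, dotProduct_comm,
        ← dotProduct_mulVec, mulVec_mulVec, mul_eq_one_comm.1 hU, one_mulVec, dotProduct_comm]
    exact_mod_cast h3
  rw [← Finset.mul_sum, ← Finset.mul_sum, h2]

end Density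

/-! ### The channel output under Gaussian signalling -/

section Output

open scoped ComplexOrder MatrixOrder

variable {nr nt : ℕ} {P : Fin nt → ℝ} {σ : ℝ}

/-- The covariance of the channel output for the channel matrix `h`. -/
noncomputable def outCov (P : Fin nt → ℝ) (σ : ℝ) (h : Matrix (Fin nr) (Fin nt) ℂ) :
    Matrix (Fin nr) (Fin nr) ℂ :=
  h * diagonal (fun i => (P i : ℂ)) * hᴴ + ((σ ^ 2 : ℝ) : ℂ) • 1

/-- The quadratic form in the exponent of the output density. -/
noncomputable def outForm (P : Fin nt → ℝ) (σ : ℝ) (h : Matrix (Fin nr) (Fin nt) ℂ)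
    (y : Fin nr → ℂ) : ℝ :=
  (star y ⬝ᵥ ((outCov P σ h)⁻¹ *ᵥ y)).re

theorem posDef_outCov (hP : ∀ i, 0 < P i) (hσ : 0 < σ) (h : Matrix (Fin nr) (Fin nt) ℂ) :
    (outCov P σ h).PosDef := by
  refine PosDef.posSemidef_add ?_ ?_
  · exact (posSemidef_diagonal_iff.2 fun i =>
      Complex.zero_le_real.2 (hP i).le).mul_mul_conjTranspose_same h
  · exact PosDef.one.smul (Complex.zero_lt_real.2 (by positivity))

theorem outForm_nonneg (hP : ∀ i, 0 < P i) (hσ : 0 < σ) (h : Matrix (Fin nr) (Fin nt) ℂ)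
    (y : Fin nr → ℂ) : 0 ≤ outForm P σ h y :=
  (Complex.le_def.1 ((posDef_outCov hP hσ h).inv.posSemidef.dotProduct_mulVec_nonneg y)).1

/-- The parallelogram law replaces bilinear expansion later on: its terms are nonnegative, so it can
be integrated in `[0, ∞]` with no integrability conditions. -/
theorem outForm_add_add_outForm_sub (h : Matrix (Fin nr) (Fin nt) ℂ) (y z : Fin nr → ℂ) :
    outForm P σ h (y + z) + outForm P σ h (y - z) =
      2 * outForm P σ h y + 2 * outForm P σ h z := by
  simp only [outForm, star_add, star_sub, mulVec_add, mulVec_sub, add_dotProduct, sub_dotProduct,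
    dotProduct_add, dotProduct_sub, Complex.add_re, Complex.sub_re]
  ring

theorem outForm_smul (h : Matrix (Fin nr) (Fin nt) ℂ) (c : ℂ) (y : Fin nr → ℂ) :
    outForm P σ h (c • y) = ‖c‖ ^ 2 * outForm P σ h y := by
  rw [outForm, star_smul, mulVec_smul, smul_dotProduct, dotProduct_smul, smul_eq_mul, smul_eq_mul,
    ← mul_assoc, Complex.star_def, mul_comm (starRingEnd ℂ c), Complex.mul_conj,
    Complex.re_ofReal_mul, Complex.normSq_eq_norm_sq, outForm]

theorem measurable_outForm :
    Measurable fun s : Matrix (Fin nr) (Fin nt) ℂ × (Fin nr → ℂ) => outForm P σ s.1 s.2 := by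
  have h1 : Measurable fun h : Matrix (Fin nr) (Fin nt) ℂ => outCov P σ h :=
    Continuous.measurable (by unfold outCov; fun_prop)
  unfold outForm
  fun_prop

/-- The output under Gaussian signalling, as a linear image of a standard Gaussian vector. -/
theorem map_output_eq_map_mulVec (hP : ∀ i, 0 < P i) (h : Matrix (Fin nr) (Fin nt) ℂ)
    {A : Matrix (Fin nr) (Fin nr) ℂ} (hA : A * Aᴴ = outCov P σ h) :
    ((gaussVec P).prod (gaussVec fun _ : Fin nr => σ ^ 2)).map (fun q => h *ᵥ q.1 + q.2) =
      (gaussVec fun _ : Fin nr => (1 : ℝ)).map (A *ᵥ ·) := by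
  have h0 : ∀ j : Fin nr, 0 ≤ σ ^ 2 := fun _ => by positivity
  have : IsProbabilityMeasure (((gaussVec P).prod (gaussVec fun _ : Fin nr => σ ^ 2)).map
      (fun q => h *ᵥ q.1 + q.2)) := Measure.isProbabilityMeasure_map (by fun_prop)
  have : IsProbabilityMeasure ((gaussVec fun _ : Fin nr => (1 : ℝ)).map (A *ᵥ ·)) :=
    Measure.isProbabilityMeasure_map (by fun_prop)
  refine ext_of_integral_cexp_dotProduct fun t => ?_
  rw [integral_map (by fun_prop) (by fun_prop), integral_map (by fun_prop) (by fun_prop)]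
  simp_rw [dotProduct_add, dotProduct_mulVec]
  rw [integral_cexp_dotProduct_gaussVec fun _ => zero_le_one,
    integral_cexp_dotProduct_prod (fun k => (hP k).le) h0]
  congr 4
  have h1 : ((∑ i, P i * ‖(t ᵥ* h) i‖ ^ 2 + ∑ j, σ ^ 2 * ‖t j‖ ^ 2 : ℝ) : ℂ) =
      ((∑ i, 1 * ‖(t ᵥ* A) i‖ ^ 2 : ℝ) : ℂ) := by
    simp only [one_mul]
    rw [sum_normSq_vecMul, hA, Complex.ofReal_add, sum_normSq_vecMul_diagonal, ← Finset.mul_sum,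
      Complex.ofReal_mul, sum_normSq_eq_dotProduct, outCov, add_mulVec, dotProduct_add,
      smul_mulVec, one_mulVec, dotProduct_smul, smul_eq_mul]
  exact_mod_cast h1

theorem map_output_eq_withDensity (hP : ∀ i, 0 < P i) (hσ : 0 < σ)
    (h : Matrix (Fin nr) (Fin nt) ℂ) :
    ((gaussVec P).prod (gaussVec fun _ : Fin nr => σ ^ 2)).map (fun q => h *ᵥ q.1 + q.2) =
      (volume : Measure (Fin nr → ℂ)).withDensity (fun y =>
        ENNReal.ofReal ((Real.pi ^ nr * (outCov P σ h).det.re)⁻¹ *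
          Real.exp (-outForm P σ h y))) := by
  obtain ⟨A, hA, hAK⟩ := (posDef_outCov hP hσ h).exists_mul_conjTranspose_eq
  rw [map_output_eq_map_mulVec hP h hAK, map_mulVec_gaussVec hA, hAK, Fintype.card_fin]
  have : (outCov P σ h).det.re = ‖A.det‖ ^ 2 := by
    rw [← hAK, det_mul, det_conjTranspose, Complex.star_def, Complex.mul_conj, Complex.ofReal_re,
      Complex.normSq_eq_norm_sq]
  rw [this]
  rfl

/-- Whitening: writing the output as `A u` with `u` standard Gaussian turns the form into `|u|²`. -/
theorem lintegral_outForm_output (hP : ∀ i, 0 < P i) (hσ : 0 < σ)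
    (h : Matrix (Fin nr) (Fin nt) ℂ) :
    ∫⁻ q, ENNReal.ofReal (outForm P σ h (h *ᵥ q.1 + q.2))
      ∂(gaussVec P).prod (gaussVec fun _ : Fin nr => σ ^ 2) = nr := by
  obtain ⟨A, hA, hAK⟩ := (posDef_outCov hP hσ h).exists_mul_conjTranspose_eq
  have hm : Measurable fun y => ENNReal.ofReal (outForm P σ h y) := by
    have := (measurable_outForm (P := P) (σ := σ)).comp (measurable_prodMk_left (x := h))
    exact this.ennreal_ofReal
  rw [← lintegral_map hm (by fun_prop), map_output_eq_map_mulVec hP h hAK,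
    lintegral_map hm (by fun_prop)]
  simp_rw [outForm, ← hAK, re_star_dotProduct_inv_mulVec hA]
  rw [lintegral_sum_normSq_gaussVec fun _ => zero_le_one]
  simp

end Output

/-! ### Mutual information and capacity -/

/-- Mutual information is the least divergence from the product with an arbitrary output law. -/
theorem mutualInfo_le_klDiv_prod {A B : Type*} [MeasurableSpace A] [StandardBorelSpace A]
    [Nonempty A] [MeasurableSpace B] (J : Measure (A × B)) [IsProbabilityMeasure J]
    (τ : Measure B) [IsProbabilityMeasure τ] :
    mutualInfo J ≤ InformationTheory.klDiv J (J.fst.prod τ) := by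
  -- After the swap, the joint law is disintegrated over its second variable, with a conditional
  -- kernel into the standard Borel space `A`. By the chain rule, changing the output law to `τ`
  -- adds exactly the divergence of the true output law from `τ`.
  set J' := J.map Prod.swap with hJ'
  have : IsProbabilityMeasure J' := Measure.isProbabilityMeasure_map (by fun_prop)
  have hsnd : J'.fst = J.snd := Measure.fst_map_swap
  have h1 : InformationTheory.klDiv J' (J.snd.prod J.fst) ≤
      InformationTheory.klDiv J' (τ.prod J.fst) := by
    rw [← J'.disintegrate J'.condKernel, ← Measure.compProd_const, ← Measure.compProd_const,
      InformationTheory.klDiv_compProd_eq_add (ν := τ), hsnd]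
    exact le_add_self
  have h2 : J'.map Prod.swap = J := by
    rw [hJ', Measure.map_map measurable_swap measurable_swap]; simp
  calc mutualInfo J = InformationTheory.klDiv (J'.map Prod.swap)
        ((J.snd.prod J.fst).map Prod.swap) := by rw [h2, Measure.prod_swap, mutualInfo]
    _ ≤ InformationTheory.klDiv J' (J.snd.prod J.fst) :=
        InformationTheory.klDiv_map_le _ _ measurable_swap
    _ ≤ InformationTheory.klDiv J' (τ.prod J.fst) := h1
    _ = InformationTheory.klDiv (J.map Prod.swap) ((J.fst.prod τ).map Prod.swap) := by
        rw [Measure.prod_swap]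
    _ ≤ InformationTheory.klDiv J (J.fst.prod τ) :=
        InformationTheory.klDiv_map_le _ _ measurable_swap

/-! ### The log-determinant and its mean under Rayleigh fading. -/

section Capacity

variable {nr nt : ℕ} {P : Fin nt → ℝ} {σ p : ℝ}

/-- `log det (I + σ⁻² h diag(P) h^*)`. -/
noncomputable def logDet (P : Fin nt → ℝ) (σ : ℝ) (h : Matrix (Fin nr) (Fin nt) ℂ) : ℝ :=
  Real.log (1 + ((1 / σ ^ 2 : ℝ) : ℂ) • (h * diagonal (fun i => (P i : ℂ)) * hᴴ)).det.re

theorem logDet_eq_sum (hP : ∀ i, 0 < P i) (hσ : 0 < σ) (h : Matrix (Fin nr) (Fin nt) ℂ) :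
    logDet P σ h = ∑ i, Real.log (1 + P i * quadForm P σ h i) := by
  rw [logDet, prod_one_add_mul_quadForm hP hσ, Complex.ofReal_re, Real.log_prod]
  exact fun i _ => (one_add_mul_quadForm_pos hP hσ h i).ne'

theorem logDet_nonneg (hP : ∀ i, 0 < P i) (hσ : 0 < σ) (h : Matrix (Fin nr) (Fin nt) ℂ) :
    0 ≤ logDet P σ h := by
  rw [logDet_eq_sum hP hσ]
  refine Finset.sum_nonneg fun i _ => Real.log_nonneg ?_
  have := mul_nonneg (hP i).le (quadForm_nonneg hP hσ h i)
  linarith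

theorem measurable_logDet (hP : ∀ i, 0 < P i) (hσ : 0 < σ) :
    Measurable fun h : Matrix (Fin nr) (Fin nt) ℂ => logDet P σ h := by
  simp_rw [logDet_eq_sum hP hσ]
  have := fun i => measurable_quadForm (nr := nr) P σ i
  fun_prop

/-- This is `K⁻¹ ≤ σ⁻² I` at `h_i`. With `κ = K⁻¹ h_i`, it follows from `σ²|κ|² ≤ h_i^* K⁻¹ h_i` and
the expansion of `|h_i - σ² κ|² ≥ 0`. -/
theorem quadForm_le (hP : ∀ i, 0 < P i) (hσ : 0 < σ) (h : Matrix (Fin nr) (Fin nt) ℂ)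
    (i : Fin nt) : quadForm P σ h i ≤ (∑ j, ‖h j i‖ ^ 2) / σ ^ 2 := by
  set κ := (interferenceCov P σ h i)⁻¹ *ᵥ h.col i with hκ
  have h1 := star_dotProduct_interferenceCov_mulVec P σ h i (star κ) κ
  rw [hκ, interferenceCov_mulVec_inv_mulVec hP hσ, ← hκ] at h1
  have h2 : star κ ⬝ᵥ h.col i = (quadForm P σ h i : ℂ) := by
    have h3 := ofReal_quadForm hP hσ h i
    rw [← hκ] at h3
    rw [star_dotProduct, ← h3]
    simp
  have h4 : quadForm P σ h i = ∑ k ∈ Finset.Ioi i, P k * ‖star κ ⬝ᵥ h.col k‖ ^ 2 +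
      σ ^ 2 * ∑ j, ‖κ j‖ ^ 2 := by
    rw [h2, dotProduct_comm (star κ) κ, ← sum_normSq_eq_dotProduct] at h1
    have h5 : ∀ k, (star κ ⬝ᵥ h.col k) * (star (h.col k) ⬝ᵥ κ) =
        ((‖star κ ⬝ᵥ h.col k‖ ^ 2 : ℝ) : ℂ) := fun k => by
      rw [star_dotProduct (h.col k), Complex.star_def, Complex.mul_conj,
        Complex.normSq_eq_norm_sq]
    simp_rw [h5] at h1
    exact_mod_cast h1
  have h5 : σ ^ 2 * ∑ j, ‖κ j‖ ^ 2 ≤ quadForm P σ h i := by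
    rw [h4]
    have : 0 ≤ ∑ k ∈ Finset.Ioi i, P k * ‖star κ ⬝ᵥ h.col k‖ ^ 2 :=
      Finset.sum_nonneg fun k _ => mul_nonneg (hP k).le (by positivity)
    linarith
  have h6 : ∑ j, ‖h j i - (σ ^ 2 : ℝ) * κ j‖ ^ 2 = ∑ j, ‖h j i‖ ^ 2 -
      2 * σ ^ 2 * quadForm P σ h i + σ ^ 4 * ∑ j, ‖κ j‖ ^ 2 := by
    have h7 : quadForm P σ h i = ∑ j, (star (κ j) * h j i).re := by
      rw [← Complex.re_sum, ← Complex.ofReal_re (quadForm P σ h i), ← h2]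
      rfl
    rw [h7, Finset.mul_sum, Finset.mul_sum, ← Finset.sum_sub_distrib, ← Finset.sum_add_distrib]
    refine Finset.sum_congr rfl fun j _ => ?_
    simp only [Complex.sq_norm, Complex.normSq_apply, Complex.sub_re, Complex.sub_im,
      Complex.mul_re, Complex.mul_im, Complex.star_def, Complex.conj_re, Complex.conj_im,
      Complex.ofReal_re, Complex.ofReal_im]
    ring
  have h8 : 0 ≤ ∑ j, ‖h j i - (σ ^ 2 : ℝ) * κ j‖ ^ 2 := Finset.sum_nonneg fun j _ => by positivity
  have h9 := mul_le_mul_of_nonneg_left h5 (sq_nonneg σ)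
  rw [le_div_iff₀ (by positivity)]
  nlinarith

variable (nr nt) in
/-- The law of a matrix with i.i.d. `CN(0, 1)` entries. -/
noncomputable def rayleigh : Measure (Matrix (Fin nr) (Fin nt) ℂ) :=
  Measure.pi fun _ => Measure.pi fun _ => complexGaussian 1

instance rayleigh.instIsProbabilityMeasure : IsProbabilityMeasure (rayleigh nr nt) :=
  inferInstanceAs (IsProbabilityMeasure
    (Measure.pi fun _ : Fin nr => Measure.pi fun _ : Fin nt => complexGaussian 1))

/-- From `log (1 + x) ≤ x`, the mean is controlled by the second moments of the entries. Finiteness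
permits the divergences below to be computed with Bochner integrals. -/
theorem lintegral_logDet_ne_top (hP : ∀ i, 0 < P i) (hσ : 0 < σ) :
    ∫⁻ h, ENNReal.ofReal (logDet P σ h) ∂rayleigh nr nt ≠ ∞ := by
  have hentry : ∀ j i, ∫⁻ h : Matrix (Fin nr) (Fin nt) ℂ, ENNReal.ofReal (‖h j i‖ ^ 2)
      ∂rayleigh nr nt = 1 := by
    intro j i
    have h1 := (measurePreserving_eval (fun _ : Fin nt => complexGaussian 1) i).comp
      (measurePreserving_eval (fun _ : Fin nr => gaussVec fun _ : Fin nt => (1 : ℝ)) j)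
    have h2 := h1.lintegral_comp (f := fun z : ℂ => ENNReal.ofReal (‖z‖ ^ 2)) (by fun_prop)
    rw [lintegral_normSq_complexGaussian zero_le_one, ENNReal.ofReal_one] at h2
    exact h2
  have hle : ∀ h : Matrix (Fin nr) (Fin nt) ℂ, ENNReal.ofReal (logDet P σ h) ≤
      ∑ i, ∑ j, ENNReal.ofReal (P i / σ ^ 2) * ENNReal.ofReal (‖h j i‖ ^ 2) := by
    intro h
    rw [logDet_eq_sum hP hσ, ENNReal.ofReal_sum_of_nonneg]
    · refine Finset.sum_le_sum fun i _ => ?_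
      rw [← Finset.mul_sum, ← ENNReal.ofReal_sum_of_nonneg fun j _ => sq_nonneg _,
        ← ENNReal.ofReal_mul (div_nonneg (hP i).le (sq_nonneg σ))]
      refine ENNReal.ofReal_le_ofReal ?_
      have h1 := Real.log_le_sub_one_of_pos (one_add_mul_quadForm_pos hP hσ h i)
      have h2 := mul_le_mul_of_nonneg_left (quadForm_le hP hσ h i) (hP i).le
      calc _ ≤ P i * quadForm P σ h i := by linarith
        _ ≤ _ := h2
        _ = _ := by ring
    · intro i _
      refine Real.log_nonneg ?_
      have := mul_nonneg (hP i).le (quadForm_nonneg hP hσ h i)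
      linarith
  refine ne_top_of_le_ne_top ?_ (lintegral_mono hle)
  have hm : ∀ j i, Measurable fun h : Matrix (Fin nr) (Fin nt) ℂ =>
      ENNReal.ofReal (P i / σ ^ 2) * ENNReal.ofReal (‖h j i‖ ^ 2) := fun j i => by
    have := measurable_matrix_apply j i
    fun_prop
  rw [lintegral_finsetSum _ fun i _ => Finset.measurable_fun_sum _ fun j _ => hm j i]
  refine ENNReal.sum_ne_top.2 fun i _ => ?_
  rw [lintegral_finsetSum _ fun j _ => hm j i]
  refine ENNReal.sum_ne_top.2 fun j _ => ?_
  have := measurable_matrix_apply j i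
  rw [lintegral_const_mul _ (by fun_prop), hentry]
  exact ENNReal.mul_ne_top ENNReal.ofReal_ne_top ENNReal.one_ne_top

/-! #### Isotropy of the Rayleigh fading law -/

section Isotropy

theorem measurePreserving_mul_unitary {U : Matrix (Fin nt) (Fin nt) ℂ} (hU : U * Uᴴ = 1) :
    MeasurePreserving (fun h : Matrix (Fin nr) (Fin nt) ℂ => h * U) (rayleigh nr nt)
      (rayleigh nr nt) := by
  refine measurePreserving_pi (fun _ => gaussVec fun _ => 1) (fun _ => gaussVec fun _ => 1)
    (f := fun _ r => r ᵥ* U) fun j => ⟨?_, gaussVec_map_vecMul_unitary zero_le_one hU⟩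
  refine measurable_pi_iff.2 fun j => ?_
  unfold vecMul
  fun_prop

/-- With equal powers the output covariance involves the channel only through `h h^*`. -/
theorem outForm_mul_unitary {U : Matrix (Fin nt) (Fin nt) ℂ} (hU : U * Uᴴ = 1)
    (h : Matrix (Fin nr) (Fin nt) ℂ) (y : Fin nr → ℂ) :
    outForm (fun _ : Fin nt => p) σ (h * U) y = outForm (fun _ => p) σ h y := by
  have : outCov (fun _ : Fin nt => p) σ (h * U) = outCov (fun _ => p) σ h := by
    have hd : diagonal (fun _ : Fin nt => (p : ℂ)) = (p : ℂ) • 1 := by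
      rw [smul_one_eq_diagonal]
    rw [outCov, outCov, hd, conjTranspose_mul]
    simp only [Matrix.mul_smul, Matrix.smul_mul, Matrix.mul_one]
    rw [Matrix.mul_assoc, ← Matrix.mul_assoc U, hU, Matrix.one_mul]
  rw [outForm, outForm, this]

/-- The mean over the fading of the received quadratic form of the input `x`. -/
noncomputable def meanForm (nr : ℕ) (p σ : ℝ) (x : Fin nt → ℂ) : ℝ≥0∞ :=
  ∫⁻ h, ENNReal.ofReal (outForm (fun _ => p) σ h (h *ᵥ x)) ∂rayleigh nr nt

theorem measurable_outForm_mulVec : Measurable fun s : (Fin nt → ℂ) × Matrix (Fin nr) (Fin nt) ℂ =>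
    ENNReal.ofReal (outForm P σ s.2 (s.2 *ᵥ s.1)) := by
  have := measurable_outForm (nr := nr) (P := P) (σ := σ)
  fun_prop

theorem measurable_outForm_mulVec_const (x : Fin nt → ℂ) :
    Measurable fun h : Matrix (Fin nr) (Fin nt) ℂ =>
      ENNReal.ofReal (outForm P σ h (h *ᵥ x)) := by
  have := measurable_outForm (nr := nr) (P := P) (σ := σ)
  fun_prop

theorem measurable_meanForm : Measurable (meanForm (nt := nt) nr p σ) :=
  measurable_outForm_mulVec.lintegral_prod_right'

/-- Replacing `h` by `h U` changes neither the fading law nor the output covariance, and moves `U`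
onto the input. -/
theorem meanForm_unitary {U : Matrix (Fin nt) (Fin nt) ℂ} (hU : U * Uᴴ = 1) (x : Fin nt → ℂ) :
    meanForm nr p σ (U *ᵥ x) = meanForm nr p σ x := by
  rw [meanForm, meanForm]
  rw [← (measurePreserving_mul_unitary (nr := nr) hU).lintegral_comp
    (f := fun h => ENNReal.ofReal (outForm (fun _ => p) σ h (h *ᵥ x)))
    (measurable_outForm_mulVec_const x)]
  simp_rw [outForm_mul_unitary hU, mulVec_mulVec]

theorem meanForm_parallelogram (hp : 0 < p) (hσ : 0 < σ) (x y : Fin nt → ℂ) :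
    meanForm nr p σ (x + y) + meanForm nr p σ (x - y) =
      2 * meanForm nr p σ x + 2 * meanForm nr p σ y := by
  have hn := fun (h : Matrix (Fin nr) (Fin nt) ℂ) => outForm_nonneg (fun _ => hp) hσ h
  simp only [meanForm]
  rw [← lintegral_const_mul _ (measurable_outForm_mulVec_const x),
    ← lintegral_const_mul _ (measurable_outForm_mulVec_const y),
    ← lintegral_add_left (measurable_outForm_mulVec_const _),
    ← lintegral_add_left ((measurable_outForm_mulVec_const _).const_mul _)]
  refine lintegral_congr fun h => ?_
  have h2 : (2 : ℝ≥0∞) = ENNReal.ofReal 2 := by simp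
  rw [h2, ← ENNReal.ofReal_mul zero_le_two, ← ENNReal.ofReal_mul zero_le_two,
    ← ENNReal.ofReal_add (hn _ _) (hn _ _),
    ← ENNReal.ofReal_add (mul_nonneg zero_le_two (hn _ _)) (mul_nonneg zero_le_two (hn _ _)),
    mulVec_add, mulVec_sub, outForm_add_add_outForm_sub]

theorem meanForm_smul (x : Fin nt → ℂ) (c : ℂ) :
    meanForm nr p σ (c • x) = ENNReal.ofReal (‖c‖ ^ 2) * meanForm nr p σ x := by
  simp only [meanForm]
  rw [← lintegral_const_mul _ (measurable_outForm_mulVec_const x)]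
  refine lintegral_congr fun h => ?_
  rw [mulVec_smul, outForm_smul, ENNReal.ofReal_mul (by positivity)]

/-- Flipping signs on the support of `y` is unitary and carries `x + y` to `x - y`, so the two
left-hand terms of the parallelogram law coincide. -/
theorem meanForm_add_of_disjoint (hp : 0 < p) (hσ : 0 < σ) (x y : Fin nt → ℂ)
    (hxy : ∀ k, x k = 0 ∨ y k = 0) :
    meanForm nr p σ (x + y) = meanForm nr p σ x + meanForm nr p σ y := by
  set e : Fin nt → ℂ := fun k => if y k = 0 then 1 else -1 with he
  have hU : diagonal e * (diagonal e)ᴴ = 1 := by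
    rw [diagonal_conjTranspose, diagonal_mul_diagonal, ← diagonal_one]
    congr 1
    funext k
    simp only [he, Pi.star_apply]
    split_ifs <;> simp
  have h1 : diagonal e *ᵥ (x + y) = x - y := by
    funext k
    rw [mulVec_diagonal]
    simp only [he, Pi.add_apply, Pi.sub_apply]
    rcases hxy k with hk | hk
    · by_cases hy : y k = 0 <;> simp [hk, hy]
    · simp [hk]
  have h2 := meanForm_parallelogram (nr := nr) hp hσ x y
  rw [← h1, meanForm_unitary hU, ← two_mul, ← mul_add] at h2
  exact (ENNReal.mul_right_inj two_ne_zero ENNReal.ofNat_ne_top).1 h2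

/-- Transposing two coordinates is unitary. -/
theorem meanForm_single (k l : Fin nt) :
    meanForm nr p σ (Pi.single k (1 : ℂ) : Fin nt → ℂ) =
      meanForm nr p σ (Pi.single l (1 : ℂ) : Fin nt → ℂ) := by
  set U : Matrix (Fin nt) (Fin nt) ℂ := (Equiv.swap k l).toPEquiv.toMatrix with hUdef
  have hU : U * Uᴴ = 1 := by
    ext a b
    rw [hUdef, PEquiv.toMatrix_toPEquiv_mul]
    simp [PEquiv.toMatrix_apply, Equiv.toPEquiv_apply, Matrix.one_apply]
  rw [← meanForm_unitary hU]
  congr 1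
  rw [hUdef, PEquiv.toMatrix_toPEquiv_mulVec]
  funext a
  simp only [Function.comp_apply, Pi.single_apply]
  congr 1
  rw [Equiv.swap_apply_eq_iff, Equiv.swap_apply_left]

/-- The mean form is a multiple of the squared norm. -/
theorem exists_meanForm_eq (hp : 0 < p) (hσ : 0 < σ) :
    ∃ c : ℝ≥0∞, ∀ x : Fin nt → ℂ,
      meanForm nr p σ x = c * ENNReal.ofReal (∑ k, ‖x k‖ ^ 2) := by
  rcases isEmpty_or_nonempty (Fin nt) with hnt | ⟨⟨k₀⟩⟩
  · refine ⟨0, fun x => ?_⟩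
    have : x = (0 : ℂ) • x := Subsingleton.elim _ _
    rw [this, meanForm_smul]
    simp
  · refine ⟨meanForm nr p σ (Pi.single k₀ (1 : ℂ) : Fin nt → ℂ), fun x => ?_⟩
    have h1 : ∀ s : Finset (Fin nt), meanForm nr p σ (∑ k ∈ s, x k • (Pi.single k (1 : ℂ))) =
        ∑ k ∈ s, ENNReal.ofReal (‖x k‖ ^ 2) *
          meanForm nr p σ (Pi.single k₀ (1 : ℂ) : Fin nt → ℂ) := by
      intro s
      induction s using Finset.induction_on with
      | empty =>
        have := meanForm_smul (nr := nr) (p := p) (σ := σ) (0 : Fin nt → ℂ) 0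
        simpa using this
      | insert a s ha ih =>
        rw [Finset.sum_insert ha, Finset.sum_insert ha, meanForm_add_of_disjoint hp hσ, ih,
          meanForm_smul, meanForm_single a k₀]
        intro k
        by_cases hk : k = a
        · right
          subst hk
          rw [Finset.sum_apply]
          refine Finset.sum_eq_zero fun b hb => ?_
          have : k ≠ b := fun h => ha (h ▸ hb)
          simp [this]
        · left
          simp [hk]
    have h2 := h1 Finset.univ
    have h3 : ∑ k, x k • (Pi.single k (1 : ℂ) : Fin nt → ℂ) = x := by
      ext j
      simp [Finset.sum_apply, Pi.single_apply]
    rw [h3, ← Finset.sum_mul,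
      ← ENNReal.ofReal_sum_of_nonneg fun k _ => sq_nonneg _, mul_comm] at h2
    exact h2

end Isotropy

end Capacity

/-- The divergence of a measure with a positive density `exp L`. -/
theorem klDiv_withDensity_exp {α : Type*} [MeasurableSpace α] {J π : Measure α}
    [IsProbabilityMeasure J] [IsProbabilityMeasure π] {L : α → ℝ} (hL : Measurable L)
    (hJ : J = π.withDensity fun a => ENNReal.ofReal (Real.exp (L a))) (hint : Integrable L J) :
    InformationTheory.klDiv J π = ENNReal.ofReal (∫ a, L a ∂J) := by
  have hac : J ≪ π := hJ ▸ withDensity_absolutelyContinuous _ _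
  have h1 : J.rnDeriv π =ᵐ[π] fun a => ENNReal.ofReal (Real.exp (L a)) := by
    conv_lhs => rw [hJ]
    exact Measure.rnDeriv_withDensity π (by fun_prop)
  have h2 : llr J π =ᵐ[J] L := by
    filter_upwards [hac.ae_eq h1] with a ha
    rw [llr, ha, ENNReal.toReal_ofReal (Real.exp_pos _).le, Real.log_exp]
  rw [InformationTheory.klDiv_of_ac_of_integrable hac ((integrable_congr h2).2 hint),
    integral_congr_ae h2]
  simp

/-! ### The joint law and its density relative to Gaussian signalling. -/

section Capacity

variable {nr nt : ℕ} {P : Fin nt → ℝ} {σ p : ℝ}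

theorem measurable_jointLaw_map :
    Measurable fun q : (Fin nt → ℂ) × (Matrix (Fin nr) (Fin nt) ℂ × (Fin nr → ℂ)) =>
      (q.1, (q.2.1, q.2.1 *ᵥ q.1 + q.2.2)) := by
  fun_prop

variable (ν : Measure (Matrix (Fin nr) (Fin nt) ℂ)) [IsProbabilityMeasure ν]
  (ρ : Measure (Fin nt → ℂ)) [IsProbabilityMeasure ρ]

instance jointLaw.instIsProbabilityMeasure : IsProbabilityMeasure (jointLaw ν σ ρ) :=
  Measure.isProbabilityMeasure_map measurable_jointLaw_map.aemeasurable

omit [IsProbabilityMeasure ρ] in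
theorem fst_jointLaw : (jointLaw ν σ ρ).fst = ρ := by
  rw [jointLaw, Measure.fst, Measure.map_map measurable_fst measurable_jointLaw_map]
  exact measurePreserving_fst.map_eq

variable {ν ρ}

omit [IsProbabilityMeasure ρ] in
theorem lintegral_jointLaw
    {F : (Fin nt → ℂ) × (Matrix (Fin nr) (Fin nt) ℂ × (Fin nr → ℂ)) → ℝ≥0∞} (hF : Measurable F) :
    ∫⁻ s, F s ∂jointLaw ν σ ρ = ∫⁻ x, ∫⁻ h, ∫⁻ z, F (x, (h, h *ᵥ x + z))
      ∂(gaussVec fun _ => σ ^ 2) ∂ν ∂ρ := by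
  rw [jointLaw, lintegral_map hF measurable_jointLaw_map, lintegral_prod _ (by fun_prop)]
  refine lintegral_congr fun x => ?_
  rw [lintegral_prod _ (by fun_prop)]

theorem lintegral_snd_jointLaw_gaussVec {F : Matrix (Fin nr) (Fin nt) ℂ × (Fin nr → ℂ) → ℝ≥0∞}
    (hF : Measurable F) :
    ∫⁻ s, F s ∂(jointLaw ν σ (gaussVec P)).snd = ∫⁻ h, ∫⁻ q, F (h, h *ᵥ q.1 + q.2)
      ∂(gaussVec P).prod (gaussVec fun _ => σ ^ 2) ∂ν := by
  rw [Measure.snd, lintegral_map hF measurable_snd,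
    lintegral_jointLaw (F := fun s => F s.2) (by fun_prop)]
  have hm : Measurable fun r : ((Fin nt → ℂ) × Matrix (Fin nr) (Fin nt) ℂ) × (Fin nr → ℂ) =>
      F (r.1.2, r.1.2 *ᵥ r.1.1 + r.2) := by fun_prop
  rw [lintegral_lintegral_swap hm.lintegral_prod_right'.aemeasurable]
  refine lintegral_congr fun h => ?_
  rw [lintegral_prod _ (by fun_prop)]

/-- The information density of the channel with respect to the Gaussian output law. -/
noncomputable def infoDensity (P : Fin nt → ℝ) (σ : ℝ)
    (s : (Fin nt → ℂ) × (Matrix (Fin nr) (Fin nt) ℂ × (Fin nr → ℂ))) : ℝ :=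
  logDet P σ s.2.1 - (∑ j, ‖(s.2.2 - s.2.1 *ᵥ s.1) j‖ ^ 2) / σ ^ 2 + outForm P σ s.2.1 s.2.2

theorem measurable_infoDensity (hP : ∀ i, 0 < P i) (hσ : 0 < σ) :
    Measurable (infoDensity (nr := nr) P σ) := by
  have h1 := measurable_outForm (nr := nr) (P := P) (σ := σ)
  have h2 := measurable_logDet (nr := nr) hP hσ
  unfold infoDensity
  fun_prop

theorem exp_logDet (hP : ∀ i, 0 < P i) (hσ : 0 < σ) (h : Matrix (Fin nr) (Fin nt) ℂ) :
    Real.exp (logDet P σ h) = (outCov P σ h).det.re / (σ ^ 2) ^ nr := by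
  have h1 : outCov P σ h = ((σ ^ 2 : ℝ) : ℂ) •
      (1 + ((1 / σ ^ 2 : ℝ) : ℂ) • (h * diagonal (fun i => (P i : ℂ)) * hᴴ)) := by
    rw [outCov, smul_add, smul_smul, ← Complex.ofReal_mul, mul_one_div_cancel (by positivity),
      Complex.ofReal_one, one_smul, add_comm]
  rw [h1, det_smul, Fintype.card_fin, ← Complex.ofReal_pow, Complex.re_ofReal_mul,
    mul_div_cancel_left₀ _ (by positivity), logDet, Real.exp_log]
  rw [prod_one_add_mul_quadForm hP hσ, Complex.ofReal_re]
  exact Finset.prod_pos fun i _ => one_add_mul_quadForm_pos hP hσ h i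

/-- The exponential of `infoDensity` is the ratio of the density `CN(h x, σ² I)` of the output given
`x` and `h` to its density under Gaussian input given `h` alone. -/
theorem lintegral_noise_eq (hP : ∀ i, 0 < P i) (hσ : 0 < σ) (h : Matrix (Fin nr) (Fin nt) ℂ)
    (x : Fin nt → ℂ) {F : (Fin nr → ℂ) → ℝ≥0∞} (hF : Measurable F) :
    ∫⁻ z, F (h *ᵥ x + z) ∂(gaussVec fun _ => σ ^ 2) =
      ∫⁻ q, ENNReal.ofReal (Real.exp (infoDensity P σ (x, (h, h *ᵥ q.1 + q.2)))) *
        F (h *ᵥ q.1 + q.2) ∂(gaussVec P).prod (gaussVec fun _ => σ ^ 2) := by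
  have hL : Measurable fun y => infoDensity P σ (x, (h, y)) :=
    (measurable_infoDensity hP hσ).comp (by fun_prop)
  have ho : Measurable fun y => outForm P σ h y :=
    measurable_outForm.comp measurable_prodMk_left
  rw [← lintegral_map (f := fun y => ENNReal.ofReal (Real.exp (infoDensity P σ (x, (h, y)))) * F y)
    (by fun_prop) (by fun_prop), map_output_eq_withDensity hP hσ,
    gaussVec_eq_withDensity (by positivity),
    lintegral_withDensity_eq_lintegral_mul _ (by fun_prop) (by fun_prop),
    lintegral_withDensity_eq_lintegral_mul _ (by fun_prop) (by fun_prop),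
    ← lintegral_sub_right_eq_self _ (h *ᵥ x)]
  refine lintegral_congr fun y => ?_
  simp only [Pi.mul_apply]
  rw [add_sub_cancel, ← mul_assoc, ← ENNReal.ofReal_mul
    (mul_nonneg (inv_nonneg.2 (mul_nonneg (by positivity) ?_)) (Real.exp_pos _).le)]
  · congr 2
    have h1 := exp_logDet hP hσ h
    have h2 : 0 < (outCov P σ h).det.re := by
      have h3 := Real.exp_pos (logDet P σ h)
      rw [h1] at h3
      exact (div_pos_iff_of_pos_right (by positivity)).1 h3
    simp only [infoDensity]
    rw [Real.exp_add, Real.exp_sub, h1, Real.exp_neg, Real.exp_neg, Fintype.card_fin, mul_pow]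
    have h4 := Real.exp_pos (outForm P σ h y)
    have h5 := Real.pi_pos
    field_simp
  · have h1 := exp_logDet hP hσ h
    have h3 := Real.exp_pos (logDet P σ h)
    rw [h1] at h3
    exact ((div_pos_iff_of_pos_right (by positivity)).1 h3).le

omit [IsProbabilityMeasure ρ] in
-- The channel matrix has the same law on both sides and is independent of the input, so only the
-- conditional output densities enter; the input law `ρ` is arbitrary.
theorem jointLaw_eq_withDensity (hP : ∀ i, 0 < P i) (hσ : 0 < σ) :
    jointLaw ν σ ρ = (ρ.prod (jointLaw ν σ (gaussVec P)).snd).withDensity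
      fun s => ENNReal.ofReal (Real.exp (infoDensity P σ s)) := by
  have hL := measurable_infoDensity (nr := nr) hP hσ
  refine Measure.ext_of_lintegral _ fun F hF => ?_
  rw [lintegral_withDensity_eq_lintegral_mul _ (by fun_prop) hF, lintegral_jointLaw hF,
    lintegral_prod _ (by fun_prop)]
  refine lintegral_congr fun x => ?_
  simp only [Pi.mul_apply]
  rw [lintegral_snd_jointLaw_gaussVec
    (F := fun s => ENNReal.ofReal (Real.exp (infoDensity P σ (x, s))) * F (x, s)) (by fun_prop)]
  refine lintegral_congr fun h => ?_
  exact lintegral_noise_eq hP hσ h x (F := fun y => F (x, (h, y))) (by fun_prop)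

/-! #### The mean of the information density -/

theorem gaussVec_map_neg {ι : Type*} [Fintype ι] {v : ℝ} (hv : 0 ≤ v) :
    MeasurePreserving (fun z : ι → ℂ => -z) (gaussVec fun _ => v) (gaussVec fun _ => v) := by
  classical
  refine ⟨by fun_prop, ?_⟩
  have := gaussVec_map_vecMul_unitary (ι := ι) hv (U := -1) (by simp)
  simpa [vecMul_neg] using this

/-- The noise is symmetric, so averaging the parallelogram law over `z` and `-z` removes the cross
term. -/
theorem lintegral_outForm_add (hP : ∀ i, 0 < P i) (hσ : 0 < σ) (h : Matrix (Fin nr) (Fin nt) ℂ)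
    (m : Fin nr → ℂ) :
    ∫⁻ z, ENNReal.ofReal (outForm P σ h (m + z)) ∂(gaussVec fun _ => σ ^ 2) =
      ENNReal.ofReal (outForm P σ h m) +
        ∫⁻ z, ENNReal.ofReal (outForm P σ h z) ∂(gaussVec fun _ => σ ^ 2) := by
  have hn := outForm_nonneg hP hσ h
  have ho : Measurable fun y => outForm P σ h y :=
    measurable_outForm.comp measurable_prodMk_left
  have h1 := (gaussVec_map_neg (ι := Fin nr) (sq_nonneg σ)).lintegral_comp
    (f := fun z => ENNReal.ofReal (outForm P σ h (m + z))) (by fun_prop)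
  have h2 : ∫⁻ z, ENNReal.ofReal (outForm P σ h (m + z)) ∂(gaussVec fun _ => σ ^ 2) +
      ∫⁻ z, ENNReal.ofReal (outForm P σ h (m + -z)) ∂(gaussVec fun _ => σ ^ 2) =
      2 * (ENNReal.ofReal (outForm P σ h m) +
        ∫⁻ z, ENNReal.ofReal (outForm P σ h z) ∂(gaussVec fun _ => σ ^ 2)) := by
    have h3 : ENNReal.ofReal (outForm P σ h m) =
        ∫⁻ _, ENNReal.ofReal (outForm P σ h m) ∂(gaussVec fun _ : Fin nr => σ ^ 2) := by simp
    rw [h3, ← lintegral_add_left (by fun_prop), ← lintegral_add_left (by fun_prop),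
      ← lintegral_const_mul _ (by fun_prop)]
    refine lintegral_congr fun z => ?_
    have h4 : (2 : ℝ≥0∞) = ENNReal.ofReal 2 := by simp
    rw [h4, ← ENNReal.ofReal_add (hn _) (hn _), ← ENNReal.ofReal_add (hn _) (hn _),
      ← ENNReal.ofReal_mul zero_le_two, ← sub_eq_add_neg, outForm_add_add_outForm_sub, mul_add]
  rw [h1, ← two_mul] at h2
  exact (ENNReal.mul_right_inj two_ne_zero ENNReal.ofNat_ne_top).1 h2

theorem lintegral_outForm_jointLaw (hp : 0 < p) (hσ : 0 < σ) :
    ∫⁻ s, ENNReal.ofReal (outForm (fun _ => p) σ s.2.1 s.2.2) ∂jointLaw (rayleigh nr nt) σ ρ =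
      ∫⁻ x, meanForm nr p σ x ∂ρ +
        ∫⁻ h, ∫⁻ z, ENNReal.ofReal (outForm (fun _ : Fin nt => p) σ h z)
          ∂(gaussVec fun _ => σ ^ 2) ∂rayleigh nr nt := by
  have ho := measurable_outForm (nr := nr) (P := fun _ : Fin nt => p) (σ := σ)
  rw [lintegral_jointLaw (F := fun s => ENNReal.ofReal (outForm (fun _ => p) σ s.2.1 s.2.2))
    (by fun_prop)]
  simp_rw [lintegral_outForm_add (fun _ => hp) hσ]
  have h1 : ∀ x, ∫⁻ h, (ENNReal.ofReal (outForm (fun _ : Fin nt => p) σ h (h *ᵥ x)) +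
      ∫⁻ z, ENNReal.ofReal (outForm (fun _ : Fin nt => p) σ h z) ∂(gaussVec fun _ => σ ^ 2))
        ∂rayleigh nr nt = meanForm nr p σ x +
      ∫⁻ h, ∫⁻ z, ENNReal.ofReal (outForm (fun _ : Fin nt => p) σ h z)
          ∂(gaussVec fun _ => σ ^ 2) ∂rayleigh nr nt := fun x => by
    rw [lintegral_add_left (measurable_outForm_mulVec_const x)]
    rfl
  simp_rw [h1]
  rw [lintegral_add_left measurable_meanForm]
  simp

theorem lintegral_outForm_jointLaw_gaussVec (hp : 0 < p) (hσ : 0 < σ) :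
    ∫⁻ s, ENNReal.ofReal (outForm (fun _ => p) σ s.2.1 s.2.2)
      ∂jointLaw (rayleigh nr nt) σ (gaussVec fun _ => p) = nr := by
  have ho := measurable_outForm (nr := nr) (P := fun _ : Fin nt => p) (σ := σ)
  have h1 := lintegral_snd_jointLaw_gaussVec (ν := rayleigh nr nt) (P := fun _ => p) (σ := σ)
    (F := fun s => ENNReal.ofReal (outForm (fun _ => p) σ s.1 s.2)) (by fun_prop)
  rw [Measure.snd, lintegral_map (by fun_prop) measurable_snd] at h1
  rw [h1]
  simp_rw [lintegral_outForm_output (fun _ : Fin nt => hp) hσ]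
  simp

/-- The Gaussian input gives exactly `nr`. Another input changes only the signal part, a fixed
multiple of its power, and the Gaussian input spends the whole budget. -/
theorem lintegral_outForm_jointLaw_le (hp : 0 < p) (hσ : 0 < σ)
    (hρ : ∫⁻ x, ENNReal.ofReal (∑ k, ‖x k‖ ^ 2) ∂ρ ≤ ENNReal.ofReal (nt * p)) :
    ∫⁻ s, ENNReal.ofReal (outForm (fun _ => p) σ s.2.1 s.2.2) ∂jointLaw (rayleigh nr nt) σ ρ ≤
      nr := by
  rw [← lintegral_outForm_jointLaw_gaussVec (nt := nt) hp hσ, lintegral_outForm_jointLaw hp hσ,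
    lintegral_outForm_jointLaw hp hσ]
  gcongr ?_ + _
  obtain ⟨c, hc⟩ := exists_meanForm_eq (nr := nr) (nt := nt) hp hσ
  simp_rw [hc]
  rw [lintegral_const_mul _ (by fun_prop), lintegral_const_mul _ (by fun_prop),
    lintegral_sum_normSq_gaussVec fun _ => hp.le]
  gcongr
  simpa using hρ

theorem lintegral_logDet_jointLaw (hP : ∀ i, 0 < P i) (hσ : 0 < σ) :
    ∫⁻ s, ENNReal.ofReal (logDet P σ s.2.1) ∂jointLaw ν σ ρ =
      ∫⁻ h, ENNReal.ofReal (logDet P σ h) ∂ν := by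
  have := measurable_logDet (nr := nr) hP hσ
  rw [lintegral_jointLaw (F := fun s => ENNReal.ofReal (logDet P σ s.2.1)) (by fun_prop)]
  simp

theorem lintegral_noise_jointLaw (hσ : 0 < σ) :
    ∫⁻ s, ENNReal.ofReal ((∑ j, ‖(s.2.2 - s.2.1 *ᵥ s.1) j‖ ^ 2) / σ ^ 2) ∂jointLaw ν σ ρ = nr := by
  rw [lintegral_jointLaw
    (F := fun s => ENNReal.ofReal ((∑ j, ‖(s.2.2 - s.2.1 *ᵥ s.1) j‖ ^ 2) / σ ^ 2)) (by fun_prop)]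
  simp only [add_sub_cancel_left]
  have h1 : ∫⁻ z, ENNReal.ofReal ((∑ j, ‖z j‖ ^ 2) / σ ^ 2)
      ∂(gaussVec fun _ : Fin nr => σ ^ 2) = nr := by
    have h0 : 0 < σ ^ 2 := by positivity
    simp_rw [ENNReal.ofReal_div_of_pos h0, div_eq_mul_inv]
    rw [lintegral_mul_const _ (by fun_prop), lintegral_sum_normSq_gaussVec fun _ => h0.le,
      ← div_eq_mul_inv, ← ENNReal.ofReal_div_of_pos h0]
    simp [h0.ne']
  simp [h1]

theorem integrable_of_lintegral_ofReal {α : Type*} [MeasurableSpace α] {J : Measure α} {u : α → ℝ}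
    (hu : Measurable u) (h0 : ∀ a, 0 ≤ u a) (h : ∫⁻ a, ENNReal.ofReal (u a) ∂J ≠ ∞) :
    Integrable u J ∧ ∫ a, u a ∂J = (∫⁻ a, ENNReal.ofReal (u a) ∂J).toReal :=
  ⟨⟨hu.aestronglyMeasurable, by
    rw [hasFiniteIntegral_iff_ofReal (ae_of_all _ h0)]; exact lt_top_iff_ne_top.2 h⟩,
    integral_eq_lintegral_of_nonneg_ae (ae_of_all _ h0) hu.aestronglyMeasurable⟩

/-- The power constraint makes the output form integrable; the noise term has mean `nr`, so the
divergence can be integrated term by term. -/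
theorem klDiv_jointLaw_prod (hp : 0 < p) (hσ : 0 < σ)
    (hρ : ∫⁻ x, ENNReal.ofReal (∑ k, ‖x k‖ ^ 2) ∂ρ ≤ ENNReal.ofReal (nt * p)) :
    InformationTheory.klDiv (jointLaw (rayleigh nr nt) σ ρ)
      (ρ.prod (jointLaw (rayleigh nr nt) σ (gaussVec fun _ => p)).snd) =
    ENNReal.ofReal ((∫⁻ h, ENNReal.ofReal (logDet (fun _ => p) σ h) ∂rayleigh nr nt).toReal - nr +
      (∫⁻ s, ENNReal.ofReal (outForm (fun _ => p) σ s.2.1 s.2.2)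
        ∂jointLaw (rayleigh nr nt) σ ρ).toReal) := by
  have hP : ∀ _ : Fin nt, 0 < p := fun _ => hp
  have ho := measurable_outForm (nr := nr) (P := fun _ : Fin nt => p) (σ := σ)
  have hl := measurable_logDet (nr := nr) hP hσ
  set J := jointLaw (rayleigh nr nt) σ ρ
  obtain ⟨i1, e1⟩ := integrable_of_lintegral_ofReal (J := J)
    (u := fun s => logDet (fun _ => p) σ s.2.1) (by fun_prop)
    (fun s => logDet_nonneg hP hσ _)
    (by rw [lintegral_logDet_jointLaw hP hσ]; exact lintegral_logDet_ne_top hP hσ)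
  obtain ⟨i2, e2⟩ := integrable_of_lintegral_ofReal (J := J)
    (u := fun s => (∑ j, ‖(s.2.2 - s.2.1 *ᵥ s.1) j‖ ^ 2) / σ ^ 2) (by fun_prop)
    (fun s => by positivity) (by rw [lintegral_noise_jointLaw hσ]; simp)
  obtain ⟨i3, e3⟩ := integrable_of_lintegral_ofReal (J := J)
    (u := fun s => outForm (fun _ => p) σ s.2.1 s.2.2) (by fun_prop)
    (fun s => outForm_nonneg hP hσ _ _)
    (ne_top_of_le_ne_top (by simp) (lintegral_outForm_jointLaw_le hp hσ hρ))
  rw [klDiv_withDensity_exp (measurable_infoDensity hP hσ) (jointLaw_eq_withDensity hP hσ)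
    ((i1.sub i2).add i3)]
  congr 1
  rw [← lintegral_logDet_jointLaw (ν := rayleigh nr nt) (ρ := ρ) hP hσ,
    ← ENNReal.toReal_natCast (n := nr), ← lintegral_noise_jointLaw (ν := rayleigh nr nt) (ρ := ρ) hσ,
    ← e1, ← e2, ← e3, ← integral_sub i1 i2]
  exact integral_add (i1.sub i2) i3

/-- The ergodic capacity under i.i.d. Rayleigh fading. -/
theorem channelCapacity_rayleigh {Ptot : ℝ} (hp : 0 < p) (hσ : 0 < σ)
    (hPtot : nt ≠ 0 → nt * p = Ptot) :
    channelCapacity (rayleigh nr nt) σ Ptot =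
      ∫⁻ h, ENNReal.ofReal (logDet (fun _ => p) σ h) ∂rayleigh nr nt := by
  have hR := lintegral_logDet_ne_top (nr := nr) (fun _ : Fin nt => hp) hσ
  refine le_antisymm ?_ ?_
  · refine iSup_le fun ρ => iSup_le fun hρ1 => iSup_le fun hρ => ?_
    have hρ' : ∫⁻ x, ENNReal.ofReal (∑ k, ‖x k‖ ^ 2) ∂ρ ≤ ENNReal.ofReal (nt * p) := by
      rcases eq_or_ne nt 0 with rfl | hnt
      · simp
      · rwa [hPtot hnt]
    have h1 := mutualInfo_le_klDiv_prod (jointLaw (rayleigh nr nt) σ ρ)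
      (jointLaw (rayleigh nr nt) σ (gaussVec fun _ => p)).snd
    rw [fst_jointLaw, klDiv_jointLaw_prod hp hσ hρ'] at h1
    refine h1.trans ?_
    rw [← ENNReal.ofReal_toReal hR]
    refine ENNReal.ofReal_le_ofReal ?_
    rw [ENNReal.toReal_ofReal ENNReal.toReal_nonneg]
    have h2 := ENNReal.toReal_mono (by simp) (lintegral_outForm_jointLaw_le (nr := nr) hp hσ hρ')
    rw [ENNReal.toReal_natCast] at h2
    linarith
  · have hG : ∫⁻ x, ENNReal.ofReal (∑ k, ‖x k‖ ^ 2) ∂(gaussVec fun _ : Fin nt => p) =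
        ENNReal.ofReal (nt * p) := by
      rw [lintegral_sum_normSq_gaussVec fun _ => hp.le]
      simp
    -- For this input the reference output law is the true one, so the divergence is the mutual
    -- information itself and the two `nr` terms cancel.
    refine le_iSup_of_le (gaussVec fun _ => p) (le_iSup_of_le inferInstance (le_iSup_of_le ?_ ?_))
    · rcases eq_or_ne nt 0 with rfl | hnt
      · simp
      · rw [← hPtot hnt, hG]
    · have h1 := klDiv_jointLaw_prod (nr := nr) hp hσ hG.le
      rw [lintegral_outForm_jointLaw_gaussVec hp hσ] at h1
      rw [mutualInfo, fst_jointLaw, h1]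
      simp [ENNReal.ofReal_toReal hR]

end Capacity

/-! ### Equal powers and assembly of the theorem. -/

theorem smul_mul_diagonal_const_mul {nr nt : ℕ} {P : Fin nt → ℝ} {Ptot : ℝ}
    (hPtot : ∀ i, P i = Ptot / nt) (σ : ℝ) (h : Matrix (Fin nr) (Fin nt) ℂ) :
    ((1 / σ ^ 2 : ℝ) : ℂ) • (h * diagonal (fun i => (P i : ℂ)) * hᴴ) =
      ((Ptot / σ ^ 2 / nt : ℝ) : ℂ) • (h * hᴴ) := by
  have h1 : diagonal (fun i => (P i : ℂ)) = ((Ptot / nt : ℝ) : ℂ) • 1 := by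
    simp_rw [hPtot]
    rw [smul_one_eq_diagonal]
  rw [h1, Matrix.mul_smul, Matrix.mul_one, Matrix.smul_mul, smul_smul, ← Complex.ofReal_mul]
  congr 2
  ring

theorem mainTheorem3 {Ω : Type*} [MeasurableSpace Ω] (μ : Measure Ω) [IsProbabilityMeasure μ]
    {nr nt : ℕ} (P : Fin nt → ℝ) (hP : ∀ i, 0 < P i) (σ : ℝ) (hσ : 0 < σ)
    (H : Ω → Matrix (Fin nr) (Fin nt) ℂ) (X : Ω → Fin nt → ℂ) (Z Y : Ω → Fin nr → ℂ)
    (hH : Measurable H) (hX : Measurable X) (hZ : Measurable Z)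
    (hXlaw : μ.map X = Measure.pi fun i => complexGaussian (P i))
    (hZlaw : μ.map Z = Measure.pi fun _ => complexGaussian (σ ^ 2))
    (hXZ : IndepFun X Z μ) (hHXZ : IndepFun H (fun ω => (X ω, Z ω)) μ)
    (hY : ∀ ω, Y ω = H ω *ᵥ X ω + Z ω) :
    -- the GMI of each substream
    (∀ i, gmiOpt μ (P i) Y H X i = extExp μ (fun ω => Real.log (1 + P i * quadForm P σ (H ω) i)) ∧
      gmiLin μ (P i) Y H X i = extExp μ (fun ω => Real.log (1 + P i * quadForm P σ (H ω) i))) ∧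
    -- the sum GMI
    (∑ i, gmiOpt μ (P i) Y H X i = extExp μ (fun ω => Real.log
        (1 + ((1 / σ ^ 2 : ℝ) : ℂ) • (H ω * diagonal (fun i => (P i : ℂ)) * (H ω)ᴴ)).det.re) ∧
      ∑ i, gmiLin μ (P i) Y H X i = extExp μ (fun ω => Real.log
        (1 + ((1 / σ ^ 2 : ℝ) : ℂ) • (H ω * diagonal (fun i => (P i : ℂ)) * (H ω)ᴴ)).det.re)) ∧
    -- V-BLAST: its filter has the least mean squared error, its rates are the GMIs above, and its
    -- (weighted) estimates give a decoding rule with the maximum GMI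
    (∀ i,
      (∀ (h : Matrix (Fin nr) (Fin nt) ℂ) (b : Fin nr → ℂ),
        linearMSE P σ h i (vblastFilter P σ h i) ≤ linearMSE P σ h i b) ∧
      gmiOpt μ (P i) Y H X i = vblastRate μ P σ H i ∧
      gmi μ (P i) Y H X i (vblastProcessing P σ i) (vblastScaling P σ i) =
        gmiOpt μ (P i) Y H X i) ∧
    -- equal powers, and capacity under i.i.d. Rayleigh fading
    (∀ Ptot : ℝ, (∀ i, P i = Ptot / nt) →
      (∑ i, gmiOpt μ (P i) Y H X i = extExp μ (fun ω => Real.log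
          (1 + ((Ptot / σ ^ 2 / nt : ℝ) : ℂ) • (H ω * (H ω)ᴴ)).det.re) ∧
        ∑ i, gmiLin μ (P i) Y H X i = extExp μ (fun ω => Real.log
          (1 + ((Ptot / σ ^ 2 / nt : ℝ) : ℂ) • (H ω * (H ω)ᴴ)).det.re)) ∧
      (μ.map H = (Measure.pi fun _ => Measure.pi fun _ => complexGaussian 1) →
        ∑ i, gmiOpt μ (P i) Y H X i = (channelCapacity (μ.map H) σ Ptot : EReal))) := by
  have hlaw := map_channel_inputs hH hX hZ hXlaw hZlaw hXZ hHXZ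
  have hv := fun i => gmi_values hP hσ hH hX hZ hlaw hY i
  have hopt : ∑ i, gmiOpt μ (P i) Y H X i = extExp μ (fun ω => logDet P σ (H ω)) := by
    rw [Finset.sum_congr rfl fun i _ => (hv i).1]
    exact sum_extExp_log_eq hP hσ hH
  have hlin : ∑ i, gmiLin μ (P i) Y H X i = extExp μ (fun ω => logDet P σ (H ω)) := by
    rw [Finset.sum_congr rfl fun i _ => (hv i).2.1]
    exact sum_extExp_log_eq hP hσ hH
  refine ⟨fun i => ⟨(hv i).1, (hv i).2.1⟩, ⟨hopt, hlin⟩, fun i => ⟨fun h b =>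
    linearMSE_vblastFilter_le hP hσ h i b, ?_, (hv i).2.2.trans (hv i).1.symm⟩,
    fun Ptot hPtot => ⟨?_, fun hRay => ?_⟩⟩
  · rw [(hv i).1, vblastRate]
    simp_rw [sinr_vblastFilter hP hσ]
  · simp_rw [← smul_mul_diagonal_const_mul hPtot σ]
    exact ⟨hopt, hlin⟩
  -- With no transmit antennas `Ptot` is unconstrained and there are no powers to match, so any
  -- positive `p` serves.
  · obtain ⟨p, hp, hPp, hsum⟩ : ∃ p : ℝ, 0 < p ∧ P = (fun _ => p) ∧ (nt ≠ 0 → nt * p = Ptot) := by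
      rcases Nat.eq_zero_or_pos nt with rfl | hnt
      · exact ⟨1, one_pos, Subsingleton.elim _ _, fun h => absurd rfl h⟩
      · refine ⟨Ptot / nt, hPtot ⟨0, hnt⟩ ▸ hP ⟨0, hnt⟩, funext hPtot, fun _ => ?_⟩
        field_simp
    have hR : μ.map H = rayleigh nr nt := hRay
    rw [hopt, extExp_of_nonneg μ fun ω => logDet_nonneg hP hσ (H ω),
      lintegral_channel_matrix hH (measurable_logDet hP hσ).ennreal_ofReal, hR,
      channelCapacity_rayleigh hp hσ hsum, hPp]
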